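/- **Setting.** Let $R$ be a commutative ring and $F(x,y)\in R[[x,y]]$ a one-dimensional commutative formal group law; write $F(x,y)=x+y-xy\,g(x,y)$. Let $M$ be a free $\mathbb Z$-module of finite rank carrying a reduced root datum (finitely many roots $\alpha\in M$ with coroots $\alpha^\vee\in M^\vee$ and reflections $s_\alpha(\lambda)=\lambda-\alpha^\vee(\lambda)\alpha$ satisfying the usual axioms), with Weyl group $W$. Fix a basis of simple roots $\alpha_1,\dots,\alpha_n$, with the corresponding length function on $W$; let $w_0$ be the longest element and $N$ its length. *Formal group ring.* Let $R[[x_M]]$ be the completion of the polynomial ring $R[x_\lambda:\lambda\in M]$ for the powers of its augmentation ideal $(x_\lambda)_{\lambda\in M}$. Let $R[[M]]_F$ be the quotient of $R[[x_M]]$ by the closure of the ideal generated by $x_0$ and all $x_{\lambda+\mu}-F(x_\lambda,x_\mu)$. Let $\varepsilon:R[[M]]_F\to R$ be the augmentation $x_\lambda\mapsto 0$ and $\mathcal I=\ker\varepsilon$. The group $W$ acts on $R[[M]]_F$ by $w(x_\lambda)=x_{w\lambda}$. *Operators.* For a root $\alpha$, $\Delta_\alpha$ is the $R$-linear operator on $R[[M]]_F$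 given by $\Delta_\alpha(u)=(u-s_\alpha(u))/x_\alpha$. Precisely: let $u\mapsto u'$ be the continuous $R$-algebra homomorphism $R[[M]]_F\to R[[M]]_F[[t]]$ sending $x_\lambda$ to $x_\lambda-_F\langle\lambda,\alpha^\vee\rangle\cdot_F t$; then $u'$ has constant term $u$, and $\Delta_\alpha(u)$ is the value at $t=x_\alpha$ of $(u-u')/t$. (It satisfies $x_\alpha\Delta_\alpha(u)=u-s_\alpha(u)$, and it is the operator induced by base change from the universal formal group law over the Lazard ring, where $x_\alpha$ is not a zero divisor.) Put $C_\alpha(u)=u\,g(x_\alpha,x_{-\alpha})-\Delta_\alpha(u)$. For a sequence $I=(i_1,\dots,i_l)$ put $\Delta_I=\Delta_{\alpha_{i_1}}\circ\cdots\circ\Delta_{\alpha_{i_l}}$ and $C_I=C_{\alpha_{i_1}}\circ\cdots\circ C_{\alpha_{i_l}}$. On the symmetric algebra $S^*_R(M)$ there are the analogous classical operators $\Delta^{a}_\alpha(u)=(u-s_\alpha(u))/\alpha$ (defined over $\mathbb Z$ and base changed to $R$), and $\Delta^a_{w_0}$ is their composition along any reduced decomposition of $w_0$. *Torsion index and $u_0$.*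 The torsion index $\tau\ge 0$ is the generator of the ideal $\Delta^a_{w_0}(S^N_{\mathbb Z}(M))\subseteq\mathbb Z$. Let $a\in S^N_R(M)$ be an element with $\Delta^a_{w_0}(a)=\tau$, and let $u_0\in\mathcal I^N$ be an element whose class in $\mathcal I^N/\mathcal I^{N+1}$ is the image of $a$ under the isomorphism $S^N_R(M)\simeq\mathcal I^N/\mathcal I^{N+1}$ that sends a product $\lambda_1\cdots\lambda_N$ to the class of $x_{\lambda_1}\cdots x_{\lambda_N}$. *Characteristic map.* Let $\mathcal D$ be the $R$-subalgebra of $\mathrm{End}_R(R[[M]]_F)$ generated by the $\Delta_\alpha$ for all roots $\alpha$ and by the multiplications by elements of $R[[M]]_F$. Let $\varepsilon\mathcal D=\{\varepsilon\circ D : D\in\mathcal D\}\subseteq\mathrm{Hom}_R(R[[M]]_F,R)$, let $\mathcal H(M)_F=\mathrm{Hom}_R(\varepsilon\mathcal D,R)$, and let $c:R[[M]]_F\to\mathcal H(M)_F$ send $u$ to evaluation at $u$. **Theorem.** Suppose that the torsion index $\tau$ is invertible in $R$. Then elements $a$ and $u_0$ as above exist. For every such $u_0$ and every choice of a reduced decomposition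 $I_w$ for each $w\in W$, the elements $c(\Delta_{I_w}(u_0))$, $w\in W$, form an $R$-basis of the image of the characteristic map $c:R[[M]]_F\to\mathcal H(M)_F$, and likewise the elements $c(C_{I_w}(u_0))$, $w\in W$, form an $R$-basis of the image of $c$. In particular, $c$ is surjective. -/

import Mathlib

noncomputable section

set_option linter.unusedSectionVars false

namespace FormalGroup

open MvPowerSeries Finsupp

variable {R : Type*} [CommRing R]

/-- The power series `g` with `F(x, y) = x + y - x y g(x, y)`. -/
def gSeries (F : FormalGroup R) : MvPowerSeries (Fin 2) R :=
  fun d ↦ -coeff (d + single 0 1 + single 1 1) F.toPowerSeries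

lemma subst_X_zero_coeff (f : MvPowerSeries (Fin 2) R) (n : ℕ) :
    PowerSeries.coeff n (f.subst ![PowerSeries.X, (0 : PowerSeries R)]) =
      coeff (single 0 n) f := by
  rw [PowerSeries.coeff, coeff_subst, finsum_eq_single _ (single 0 n)]
  · simp [← PowerSeries.coeff_def, PowerSeries.coeff_X_pow]
  · intro d hd
    by_cases h1 : d 1 = 0
    · have : d 0 ≠ n := by
        rintro rfl
        apply hd
        ext i
        fin_cases i <;> simp [h1]
      simp [h1, PowerSeries.coeff_X_pow, ← PowerSeries.coeff_def, this.symm]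
    · simp [h1]
  · exact HasSubst.X_zero

lemma subst_zero_X_coeff (f : MvPowerSeries (Fin 2) R) (n : ℕ) :
    PowerSeries.coeff n (f.subst ![(0 : PowerSeries R), PowerSeries.X]) =
      coeff (single 1 n) f := by
  rw [PowerSeries.coeff, coeff_subst, finsum_eq_single _ (single 1 n)]
  · simp [← PowerSeries.coeff_def, PowerSeries.coeff_X_pow]
  · intro d hd
    by_cases h1 : d 0 = 0
    · have : d 1 ≠ n := by
        rintro rfl
        apply hd
        ext i
        fin_cases i <;> simp [h1]
      simp [h1, PowerSeries.coeff_X_pow, ← PowerSeries.coeff_def, this.symm]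
    · simp [h1]
  · exact HasSubst.zero_X

lemma toPowerSeries_eq (F : FormalGroup R) :
    F.toPowerSeries = X 0 + X 1 - X 0 * X 1 * F.gSeries := by
  ext d
  have hx := congrArg (PowerSeries.coeff (d 0)) F.Xzero_eq_X
  have hy := congrArg (PowerSeries.coeff (d 1)) F.zeroX_eq_X
  rw [Xzero, subst_X_zero_coeff] at hx
  rw [zeroX, subst_zero_X_coeff] at hy
  have hmul : (X 0 * X 1 * F.gSeries : MvPowerSeries (Fin 2) R) =
      monomial (single 0 1 + single 1 1) 1 * F.gSeries := by
    rw [X, X, monomial_mul_monomial, one_mul]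
  rw [hmul, map_sub, map_add, coeff_monomial_mul]
  by_cases h0 : d 0 = 0
  · have hd : d = single 1 (d 1) := by ext i; fin_cases i <;> simp [h0]
    have h' : ¬ (single 0 1 + single 1 1 ≤ d) := fun h ↦ by simpa [h0] using h 0
    rw [if_neg h', hd]
    rw [hy, PowerSeries.coeff_X]
    simp [coeff_X, Finsupp.single_eq_single_iff]
  · by_cases h1 : d 1 = 0
    · have hd : d = single 0 (d 0) := by ext i; fin_cases i <;> simp [h1]
      have h' : ¬ (single 0 1 + single 1 1 ≤ d) := fun h ↦ by simpa [h1] using h 1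
      rw [if_neg h', hd]
      rw [hx, PowerSeries.coeff_X]
      simp [coeff_X, Finsupp.single_eq_single_iff]
    · have h' : single 0 1 + single 1 1 ≤ d := fun i ↦ by
        fin_cases i <;> simp <;> omega
      rw [if_pos h', coeff_X, coeff_X, if_neg, if_neg]
      · simp only [gSeries, coeff_apply, one_mul]
        rw [add_assoc, tsub_add_cancel_of_le h']
        simp
      · rintro rfl; simp at h0
      · rintro rfl; simp at h1

/-! ### The formal inverse -/

/-- Successive approximations `y ↦ -x + x y g(x, y)` of the formal inverse. -/
def negApprox (F : FormalGroup R) : ℕ → PowerSeries R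
  | 0 => 0
  | n + 1 => -PowerSeries.X + PowerSeries.X * negApprox F n *
      F.gSeries.subst ![PowerSeries.X, negApprox F n]

/-- The formal inverse, that is, the power series `i` with `F(x, i(x)) = 0`. -/
def neg (F : FormalGroup R) : PowerSeries R :=
  PowerSeries.mk fun n ↦ PowerSeries.coeff n (F.negApprox (n + 1))

lemma hasSubst_pair {a b : PowerSeries R} (ha : PowerSeries.constantCoeff a = 0)
    (hb : PowerSeries.constantCoeff b = 0) : HasSubst (S := R) ![a, b] :=
  hasSubst_of_constantCoeff_zero fun i ↦ by fin_cases i <;> simpa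

lemma X_pow_dvd_subst_sub (f : MvPowerSeries (Fin 2) R) {y z : PowerSeries R}
    (hy : PowerSeries.constantCoeff y = 0) (hz : PowerSeries.constantCoeff z = 0) {n : ℕ}
    (h : PowerSeries.X ^ n ∣ y - z) :
    PowerSeries.X ^ n ∣ f.subst ![PowerSeries.X, y] - f.subst ![PowerSeries.X, z] := by
  rw [PowerSeries.X_pow_dvd_iff]
  intro m hm
  rw [map_sub, sub_eq_zero, PowerSeries.coeff, 
    coeff_subst (hasSubst_pair (by simp) hy), coeff_subst (hasSubst_pair (by simp) hz)]
  refine finsum_congr fun d ↦ ?_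
  congr 1
  rw [← sub_eq_zero, ← map_sub]
  refine (PowerSeries.X_pow_dvd_iff (φ := _)).1 ?_ m hm
  simp only [Finsupp.prod_fintype, pow_zero, implies_true, Fin.prod_univ_two, Matrix.cons_val_zero,
    Matrix.cons_val_one, ← mul_sub]
  exact (h.trans (sub_dvd_pow_sub_pow y z _)).mul_left _

lemma constantCoeff_negApprox (F : FormalGroup R) (n : ℕ) :
    PowerSeries.constantCoeff (F.negApprox n) = 0 := by
  cases n <;> simp [negApprox]

lemma X_pow_dvd_step (F : FormalGroup R) {y z : PowerSeries R}
    (hy : PowerSeries.constantCoeff y = 0) (hz : PowerSeries.constantCoeff z = 0) {n : ℕ}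
    (h : PowerSeries.X ^ n ∣ y - z) :
    PowerSeries.X ^ (n + 1) ∣
      (-PowerSeries.X + PowerSeries.X * y * F.gSeries.subst ![PowerSeries.X, y]) -
      (-PowerSeries.X + PowerSeries.X * z * F.gSeries.subst ![PowerSeries.X, z]) := by
  have e : (-PowerSeries.X + PowerSeries.X * y * F.gSeries.subst ![PowerSeries.X, y]) -
      (-PowerSeries.X + PowerSeries.X * z * F.gSeries.subst ![PowerSeries.X, z]) =
      PowerSeries.X * ((y - z) * F.gSeries.subst ![PowerSeries.X, y] +
        z * (F.gSeries.subst ![PowerSeries.X, y] - F.gSeries.subst ![PowerSeries.X, z])) := by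
    ring
  rw [e, pow_succ']
  exact mul_dvd_mul_left _ (dvd_add (h.mul_right _) ((X_pow_dvd_subst_sub _ hy hz h).mul_left _))

lemma X_pow_dvd_negApprox (F : FormalGroup R) (n : ℕ) :
    PowerSeries.X ^ n ∣ F.negApprox (n + 1) - F.negApprox n := by
  induction n with
  | zero => simp
  | succ n ih =>
    exact X_pow_dvd_step F (F.constantCoeff_negApprox _) (F.constantCoeff_negApprox _) ih

lemma X_pow_dvd_neg_sub (F : FormalGroup R) (n : ℕ) :
    PowerSeries.X ^ n ∣ F.neg - F.negApprox n := by
  have key : ∀ m k, PowerSeries.X ^ m ∣ F.negApprox (m + k) - F.negApprox m := by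
    intro m k
    induction k with
    | zero => simp
    | succ k ih =>
      have := (pow_dvd_pow PowerSeries.X (Nat.le_add_right m k)).trans
        (F.X_pow_dvd_negApprox (m + k))
      simpa [add_assoc] using dvd_add this ih
  rw [PowerSeries.X_pow_dvd_iff]
  intro m hm
  obtain ⟨k, rfl⟩ := Nat.exists_eq_add_of_lt hm
  have := (PowerSeries.X_pow_dvd_iff.1 (key (m + 1) k)) m (Nat.lt_succ_self m)
  rw [map_sub, sub_eq_zero] at this ⊢
  rw [neg, PowerSeries.coeff_mk, ← this]
  congr 2
  omega

lemma constantCoeff_neg (F : FormalGroup R) : PowerSeries.constantCoeff F.neg = 0 := by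
  rw [← PowerSeries.coeff_zero_eq_constantCoeff_apply, neg, PowerSeries.coeff_mk,
    PowerSeries.coeff_zero_eq_constantCoeff_apply, constantCoeff_negApprox]

theorem subst_X_neg (F : FormalGroup R) :
    F.toPowerSeries.subst ![PowerSeries.X, F.neg] = (0 : PowerSeries R) := by
  have hs := hasSubst_pair (R := R) (a := PowerSeries.X) (by simp) F.constantCoeff_neg
  have fix : F.neg = -PowerSeries.X +
      PowerSeries.X * F.neg * F.gSeries.subst ![PowerSeries.X, F.neg] := by
    rw [← sub_eq_zero]
    ext n
    have h1 := F.X_pow_dvd_neg_sub (n + 1)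
    have h2 := X_pow_dvd_step F F.constantCoeff_neg (F.constantCoeff_negApprox n)
      (F.X_pow_dvd_neg_sub n)
    have h3 := dvd_sub h1 h2
    simp only [negApprox, sub_sub_sub_cancel_right] at h3
    exact (PowerSeries.X_pow_dvd_iff.1 h3) n (Nat.lt_succ_self n)
  rw [toPowerSeries_eq, subst_sub hs, subst_add hs, subst_mul hs, subst_mul hs, subst_X hs,
    subst_X hs]
  simp only [Matrix.cons_val_zero, Matrix.cons_val_one]
  nth_rw 1 [fix]
  ring

end FormalGroup

section evaluation

namespace FormalGroup

open MvPowerSeries Finsupp Topology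

variable {R : Type*} [CommRing R] {B : Type*} [CommRing B] [Algebra R B] [UniformSpace B]

/-- The value `f(a, b)` of a power series in two variables in a topological `R`-algebra. -/
def evalPair (f : MvPowerSeries (Fin 2) R) (a b : B) : B :=
  ∑' d : Fin 2 →₀ ℕ, coeff d f • (a ^ d 0 * b ^ d 1)

/-- The value `f(a)` of a power series in one variable in a topological `R`-algebra. -/
def evalOne (f : PowerSeries R) (a : B) : B :=
  ∑' n : ℕ, PowerSeries.coeff n f • a ^ n

variable [IsUniformAddGroup B] [IsTopologicalRing B] [CompleteSpace B] [T2Space B]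
  [IsLinearTopology B B]

lemma continuousSMul_of_discrete [TopologicalSpace R] [DiscreteTopology R] :
    ContinuousSMul R B := by
  refine ⟨continuous_prod_of_discrete_left.2 fun r ↦ ?_⟩
  simp only [Algebra.smul_def]
  exact continuous_const_mul _

/-- Evaluation of power series over the discrete ring `R` at a finite family of topologically
nilpotent elements. -/
def evalHom {σ : Type*} [Finite σ] (a : σ → B) (ha : ∀ i, IsTopologicallyNilpotent (a i)) :
    MvPowerSeries σ R →ₐ[R] B :=
  letI : UniformSpace R := ⊥
  haveI : DiscreteUniformity R := ⟨rfl⟩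
  haveI : ContinuousSMul R B := continuousSMul_of_discrete
  MvPowerSeries.aeval (a := a) ⟨ha, by simp⟩

lemma evalHom_X {σ : Type*} [Finite σ] (a : σ → B) (ha : ∀ i, IsTopologicallyNilpotent (a i))
    (i : σ) : evalHom (R := R) a ha (X i) = a i := by
  let _ : UniformSpace R := ⊥
  have : DiscreteUniformity R := ⟨rfl⟩
  have : ContinuousSMul R B := continuousSMul_of_discrete
  have := MvPowerSeries.aeval_coe (R := R) (a := a) ⟨ha, by simp⟩ (MvPolynomial.X i)
  simpa [evalHom] using this

lemma evalHom_subst {σ τ : Type*} [Finite σ] [Finite τ] (a : τ → B)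
    (ha : ∀ i, IsTopologicallyNilpotent (a i)) {s : σ → MvPowerSeries τ R} (hs : HasSubst s)
    (hs' : ∀ i, IsTopologicallyNilpotent (evalHom (R := R) a ha (s i)))
    (f : MvPowerSeries σ R) :
    evalHom (R := R) a ha (f.subst s) = evalHom (fun i ↦ evalHom a ha (s i)) hs' f := by
  let _ : UniformSpace R := ⊥
  have : DiscreteUniformity R := ⟨rfl⟩
  have : ContinuousSMul R B := continuousSMul_of_discrete
  have hb : HasEval a := ⟨ha, by simp⟩
  have := eval₂_subst (R := R) (S := R) (T := B) hs hb f
  simp only [evalHom, coe_aeval] at this ⊢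
  convert this

lemma evalHom_map {B' : Type*} [CommRing B'] [Algebra R B'] [UniformSpace B']
    [IsUniformAddGroup B'] [IsTopologicalRing B'] [CompleteSpace B'] [T2Space B']
    [IsLinearTopology B' B'] {σ : Type*} [Finite σ] (a : σ → B)
    (ha : ∀ i, IsTopologicallyNilpotent (a i)) (φ : B →ₐ[R] B') (hφ : Continuous φ)
    (ha' : ∀ i, IsTopologicallyNilpotent (φ (a i))) (f : MvPowerSeries σ R) :
    φ (evalHom a ha f) = evalHom (fun i ↦ φ (a i)) ha' f := by
  let _ : UniformSpace R := ⊥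
  have : DiscreteUniformity R := ⟨rfl⟩
  have : ContinuousSMul R B := continuousSMul_of_discrete
  have : ContinuousSMul R B' := continuousSMul_of_discrete
  have hb : HasEval a := ⟨ha, by simp⟩
  exact DFunLike.congr_fun (comp_aeval (R := R) hb hφ) f

lemma hasSum_evalHom {σ : Type*} [Finite σ] (a : σ → B)
    (ha : ∀ i, IsTopologicallyNilpotent (a i)) (f : MvPowerSeries σ R) :
    HasSum (fun d : σ →₀ ℕ ↦ coeff d f • d.prod fun s e ↦ a s ^ e) (evalHom a ha f) := by
  let _ : UniformSpace R := ⊥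
  have : DiscreteUniformity R := ⟨rfl⟩
  have : ContinuousSMul R B := continuousSMul_of_discrete
  exact hasSum_aeval (R := R) (a := a) ⟨ha, by simp⟩ f

lemma tn_pair {a b : B} (ha : IsTopologicallyNilpotent a) (hb : IsTopologicallyNilpotent b)
    (i : Fin 2) : IsTopologicallyNilpotent (![a, b] i) := by
  fin_cases i <;> simpa

lemma evalPair_eq (f : MvPowerSeries (Fin 2) R) {a b : B} (ha : IsTopologicallyNilpotent a)
    (hb : IsTopologicallyNilpotent b) :
    evalPair f a b = evalHom ![a, b] (tn_pair ha hb) f := by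
  refine HasSum.tsum_eq ?_
  convert hasSum_evalHom ![a, b] (tn_pair ha hb) f using 3 with d
  rw [Finsupp.prod_fintype _ _ (by simp)]
  simp

lemma evalOne_eq (f : PowerSeries R) {a : B} (ha : IsTopologicallyNilpotent a) :
    evalOne f a = evalHom (fun _ : Unit ↦ a) (fun _ ↦ ha) f := by
  let _ : UniformSpace R := ⊥
  have : DiscreteUniformity R := ⟨rfl⟩
  have : ContinuousSMul R B := continuousSMul_of_discrete
  exact HasSum.tsum_eq (PowerSeries.hasSum_aeval (R := R) ha f)

/-- A power series without constant term takes topologically nilpotent values. -/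
lemma tn_evalHom {σ : Type*} [Finite σ] (a : σ → B) (ha : ∀ i, IsTopologicallyNilpotent (a i))
    (f : MvPowerSeries σ R) (hf : constantCoeff f = 0) :
    IsTopologicallyNilpotent (evalHom a ha f) := by
  let _ : UniformSpace R := ⊥
  have : DiscreteUniformity R := ⟨rfl⟩
  have : ContinuousSMul R B := continuousSMul_of_discrete
  have hb : HasEval a := ⟨ha, by simp⟩
  open WithPiTopology in
  have h1 : IsTopologicallyNilpotent f := isTopologicallyNilpotent_of_constantCoeff_zero hf
  exact h1.map (φ := aeval (R := R) hb) (continuous_aeval hb)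

variable (F : FormalGroup R)

lemma tn_fadd {a b : B} (ha : IsTopologicallyNilpotent a) (hb : IsTopologicallyNilpotent b) :
    IsTopologicallyNilpotent (evalPair F.toPowerSeries a b) := by
  rw [evalPair_eq _ ha hb]
  exact tn_evalHom _ _ _ F.zero_constantCoeff

lemma tn_fneg {a : B} (ha : IsTopologicallyNilpotent a) :
    IsTopologicallyNilpotent (evalOne F.neg a) := by
  rw [evalOne_eq _ ha]
  exact tn_evalHom _ _ _ F.constantCoeff_neg

lemma evalHom_congr {σ : Type*} [Finite σ] {a a' : σ → B} (h : a = a')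
    (ha : ∀ i, IsTopologicallyNilpotent (a i)) (f : MvPowerSeries σ R) :
    evalHom a ha f = evalHom a' (h ▸ ha) f := by
  subst h; rfl

/-- `f(g, h)(a) = f(g(a), h(a))`. -/
lemma evalHom_subst_pair {τ : Type*} [Finite τ] (a : τ → B)
    (ha : ∀ i, IsTopologicallyNilpotent (a i)) {g h : MvPowerSeries τ R}
    (hg : constantCoeff g = 0) (hh : constantCoeff h = 0) (f : MvPowerSeries (Fin 2) R) :
    evalHom (R := R) a ha (f.subst ![g, h]) = evalPair f (evalHom a ha g) (evalHom a ha h) := by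
  have hs : HasSubst (S := R) ![g, h] :=
    hasSubst_of_constantCoeff_zero fun i ↦ by fin_cases i <;> simpa
  rw [evalPair_eq _ (tn_evalHom a ha g hg) (tn_evalHom a ha h hh),
    evalHom_subst a ha hs (fun i ↦ tn_evalHom a ha _ (by fin_cases i <;> simpa))]
  refine evalHom_congr (funext fun i ↦ ?_) _ _
  fin_cases i <;> rfl

lemma fadd_assoc {a b c : B} (ha : IsTopologicallyNilpotent a) (hb : IsTopologicallyNilpotent b)
    (hc : IsTopologicallyNilpotent c) :
    evalPair F.toPowerSeries (evalPair F.toPowerSeries a b) c =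
      evalPair F.toPowerSeries a (evalPair F.toPowerSeries b c) := by
  have h3 : ∀ i : Fin 3, IsTopologicallyNilpotent (![a, b, c] i) := fun i ↦ by
    fin_cases i <;> simpa
  have hc2 : ∀ i j : Fin 3, constantCoeff (F.toPowerSeries.subst ![X i, X j]) = (0 : R) :=
    fun i j ↦ constantCoeff_subst_eq_zero HasSubst.X_X
      (fun k ↦ by fin_cases k <;> simp) F.zero_constantCoeff
  have := congrArg (evalHom (R := R) ![a, b, c] h3) F.assoc
  rw [evalHom_subst_pair _ _ (hc2 _ _) (by simp), evalHom_subst_pair _ _ (by simp) (by simp),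
    evalHom_subst_pair _ _ (by simp) (hc2 _ _), evalHom_subst_pair _ _ (by simp) (by simp)] at this
  rw [evalHom_X, evalHom_X, evalHom_X] at this
  exact this

lemma fadd_comm [F.IsComm] {a b : B} (ha : IsTopologicallyNilpotent a)
    (hb : IsTopologicallyNilpotent b) :
    evalPair F.toPowerSeries a b = evalPair F.toPowerSeries b a := by
  rw [evalPair_eq _ ha hb]
  nth_rw 1 [IsComm.comm (F := F)]
  rw [evalHom_subst_pair _ _ (by simp) (by simp), evalHom_X, evalHom_X]
  rfl

lemma fadd_zero {a : B} (ha : IsTopologicallyNilpotent a) :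
    evalPair F.toPowerSeries a 0 = a := by
  have := congrArg (evalHom (R := R) (fun _ : Unit ↦ a) fun _ ↦ ha) F.Xzero_eq_X
  rw [Xzero, evalHom_subst_pair _ _ (PowerSeries.constantCoeff_X (R := R)) (by simp),
    map_zero, PowerSeries.X, evalHom_X] at this
  exact this

lemma fadd_fneg {a : B} (ha : IsTopologicallyNilpotent a) :
    evalPair F.toPowerSeries a (evalOne F.neg a) = 0 := by
  have := congrArg (evalHom (R := R) (fun _ : Unit ↦ a) fun _ ↦ ha) F.subst_X_neg
  rw [evalHom_subst_pair _ _ (PowerSeries.constantCoeff_X (R := R)) F.constantCoeff_neg,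
    map_zero, PowerSeries.X, evalHom_X, ← evalOne_eq] at this
  exact this

variable (B) in
/-- The topologically nilpotent elements of `B`, with the group law `a + b = F(a, b)`. -/
@[ext]
structure Nil (F : FormalGroup R) where
  /-- the underlying element -/
  val : B
  property : IsTopologicallyNilpotent val

instance Nil.instAdd : Add (F.Nil B) := ⟨fun a b ↦ ⟨evalPair F.toPowerSeries a.1 b.1, F.tn_fadd a.2 b.2⟩⟩

instance Nil.instZero : Zero (F.Nil B) := ⟨⟨0, .zero⟩⟩

instance Nil.instNeg : Neg (F.Nil B) := ⟨fun a ↦ ⟨evalOne F.neg a.1, F.tn_fneg a.2⟩⟩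

lemma Nil.val_add (a b : F.Nil B) : (a + b).1 = evalPair F.toPowerSeries a.1 b.1 := rfl

instance Nil.instAddCommGroup [F.IsComm] : AddCommGroup (F.Nil B) where
  add_assoc a b c := Nil.ext (F.fadd_assoc a.2 b.2 c.2)
  add_comm a b := Nil.ext (F.fadd_comm a.2 b.2)
  add_zero a := Nil.ext (F.fadd_zero a.2)
  zero_add a := Nil.ext ((F.fadd_comm .zero a.2).trans (F.fadd_zero a.2))
  neg_add_cancel a := Nil.ext ((F.fadd_comm (F.tn_fneg a.2) a.2).trans (F.fadd_fneg a.2))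
  nsmul := nsmulRec
  zsmul := zsmulRec

lemma map_evalPair {B' : Type*} [CommRing B'] [Algebra R B'] [UniformSpace B']
    [IsUniformAddGroup B'] [IsTopologicalRing B'] [CompleteSpace B'] [T2Space B']
    [IsLinearTopology B' B'] (φ : B →ₐ[R] B') (hφ : Continuous φ)
    (f : MvPowerSeries (Fin 2) R) {a b : B} (ha : IsTopologicallyNilpotent a)
    (hb : IsTopologicallyNilpotent b) :
    φ (evalPair f a b) = evalPair f (φ a) (φ b) := by
  have ha' := ha.map hφ
  have hb' := hb.map hφ
  rw [evalPair_eq _ ha hb, evalPair_eq _ ha' hb', evalHom_map _ _ φ hφ]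
  · refine evalHom_congr (funext fun i ↦ ?_) _ _
    fin_cases i <;> rfl
  · intro i
    fin_cases i
    exacts [ha', hb']

/-- A continuous algebra homomorphism induces a group homomorphism on topologically nilpotent
elements. -/
def Nil.map [F.IsComm] {B' : Type*} [CommRing B'] [Algebra R B'] [UniformSpace B']
    [IsUniformAddGroup B'] [IsTopologicalRing B'] [CompleteSpace B'] [T2Space B']
    [IsLinearTopology B' B'] (φ : B →ₐ[R] B') (hφ : Continuous φ) : F.Nil B →+ F.Nil B' where
  toFun a := ⟨φ a.1, a.2.map hφ⟩
  map_zero' := Nil.ext (map_zero φ)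
  map_add' a b := Nil.ext (map_evalPair φ hφ _ a.2 b.2)

end FormalGroup

end evaluation

/-! ### Formal group rings -/

section rings

open Topology UniformSpace

/-- `R[x_S]` carries the topology defined by the powers of the augmentation ideal
`(x_s : s ∈ S) = ker (x_s ↦ 0)`. -/
instance MvPolynomial.withIdealOfVars (S R : Type*) [CommRing R] :
    WithIdeal (MvPolynomial S R) := ⟨MvPolynomial.idealOfVars S R⟩

instance MvPolynomial.uniformContinuousConstSMul_idealOfVars (S R : Type*) [CommRing R] :
    UniformContinuousConstSMul R (MvPolynomial S R) :=
  ⟨fun r ↦ uniformContinuous_addMonoidHom_of_continuous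
    (f := DistribSMul.toAddMonoidHom (MvPolynomial S R) r) <| by
      have : Continuous fun p : MvPolynomial S R ↦ MvPolynomial.C r * p := continuous_const_mul _
      simp only [MvPolynomial.C_mul'] at this
      exact this⟩

/-- The ring `R⟦x_S⟧`: the completion of `R[x_S]` for the topology given by the powers of the
augmentation ideal. For infinite `S` it is smaller than `MvPowerSeries S R`. -/
abbrev CompletedPoly (S R : Type*) [CommRing R] : Type _ := Completion (MvPolynomial S R)

namespace CompletedPoly

variable {S R : Type*} [CommRing R]

/-- The variable `x_s`. -/
def x (s : S) : CompletedPoly S R := ((MvPolynomial.X s : MvPolynomial S R) : CompletedPoly S R)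

/-- The closure of the `n`-th power of the augmentation ideal. -/
def filt (S R : Type*) [CommRing R] (n : ℕ) : Ideal (CompletedPoly S R) :=
  ((MvPolynomial.idealOfVars S R ^ n).map
    (Completion.coeRingHom : MvPolynomial S R →+* CompletedPoly S R)).closure

lemma coe_filt (n : ℕ) : (filt S R n : Set (CompletedPoly S R)) =
    closure ((fun p : MvPolynomial S R ↦ (p : CompletedPoly S R)) ''
      (MvPolynomial.idealOfVars S R ^ n : Ideal _)) := by
  refine subset_antisymm ?_ (closure_mono ?_)
  · refine closure_minimal ?_ isClosed_closure
    let K : Ideal (CompletedPoly S R) :=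
      { ((MvPolynomial.idealOfVars S R ^ n).toAddSubgroup.map
          (Completion.coeRingHom : MvPolynomial S R →+* CompletedPoly S R).toAddMonoidHom
            ).topologicalClosure with
        smul_mem' := by
          intro a b hb
          have ha : a ∈ closure (Set.range fun p : MvPolynomial S R ↦ (p : CompletedPoly S R)) :=
            Completion.denseRange_coe a
          refine map_mem_closure₂ continuous_mul ha hb ?_
          rintro _ ⟨p, rfl⟩ _ ⟨q, hq, rfl⟩
          exact ⟨p * q, Ideal.mul_mem_left _ p hq, Completion.coe_mul p q⟩ }
    have : (MvPolynomial.idealOfVars S R ^ n).map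
        (Completion.coeRingHom : MvPolynomial S R →+* CompletedPoly S R) ≤ K :=
      Ideal.map_le_iff_le_comap.2 fun p hp ↦ subset_closure ⟨p, hp, rfl⟩
    exact this
  · rintro _ ⟨p, hp, rfl⟩
    exact Ideal.mem_map_of_mem _ hp

lemma hasBasis_filt : (𝓝 (0 : CompletedPoly S R)).HasBasis (fun _ : ℕ ↦ True)
    fun n ↦ (filt S R n : Set (CompletedPoly S R)) := by
  simp only [coe_filt]
  have := (MvPolynomial.idealOfVars S R).hasBasis_nhds_zero_adic.hasBasis_of_isDenseInducing
    (Completion.isDenseInducing_coe (α := MvPolynomial S R))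
  simpa only [Completion.coe_zero] using this

instance isLinearTopology : IsLinearTopology (CompletedPoly S R) (CompletedPoly S R) :=
  IsLinearTopology.mk_of_hasBasis _ hasBasis_filt

instance firstCountableTopology : FirstCountableTopology (CompletedPoly S R) := by
  have : (𝓝 (0 : CompletedPoly S R)).IsCountablyGenerated := hasBasis_filt.isCountablyGenerated
  have := IsUniformAddGroup.uniformity_countably_generated (α := CompletedPoly S R)
  exact UniformSpace.firstCountableTopology _

lemma filt_mul_le (m n : ℕ) : filt S R m * filt S R n ≤ filt S R (m + n) := by
  rw [Ideal.mul_le]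
  intro a ha b hb
  rw [← SetLike.mem_coe, coe_filt] at ha hb ⊢
  refine map_mem_closure₂ continuous_mul ha hb ?_
  rintro _ ⟨p, hp, rfl⟩ _ ⟨q, hq, rfl⟩
  exact ⟨p * q, by rw [pow_add]; exact Ideal.mul_mem_mul hp hq, Completion.coe_mul p q⟩

lemma filt_one_pow_le (n : ℕ) : filt S R 1 ^ n ≤ filt S R n := by
  induction n with
  | zero =>
    intro a _
    rw [← SetLike.mem_coe, coe_filt]
    simpa using Completion.denseRange_coe (α := MvPolynomial S R) a
  | succ n ih => exact (pow_succ _ n).le.trans ((Ideal.mul_mono_left ih).trans (filt_mul_le n 1))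

lemma x_mem_filt (s : S) : (x s : CompletedPoly S R) ∈ filt S R 1 := by
  rw [← SetLike.mem_coe, coe_filt]
  refine subset_closure ⟨MvPolynomial.X s, ?_, rfl⟩
  rw [pow_one]
  exact Ideal.subset_span ⟨s, rfl⟩

lemma tn_of_mem_filt {a : CompletedPoly S R} (ha : a ∈ filt S R 1) :
    IsTopologicallyNilpotent a := by
  rw [IsTopologicallyNilpotent, hasBasis_filt.tendsto_right_iff]
  intro n _
  filter_upwards [Filter.eventually_ge_atTop n] with k hk
  exact filt_one_pow_le n (Ideal.pow_le_pow_right hk (Ideal.pow_mem_pow ha k))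

end CompletedPoly

variable {R : Type*} [CommRing R]

/-- The closure of the ideal of `R⟦x_M⟧` generated by `x_0` and all
`x_{l + m} - F(x_l, x_m)`. -/
def FormalGroup.relIdeal (F : FormalGroup R) (M : Type*) [AddCommGroup M] :
    Ideal (CompletedPoly M R) :=
  (Ideal.span ({CompletedPoly.x 0} ∪ Set.range fun l : M × M ↦
    CompletedPoly.x (l.1 + l.2) -
      evalPair F.toPowerSeries (CompletedPoly.x l.1) (CompletedPoly.x l.2))).closure

/-- The formal group ring `R⟦M⟧_F`. -/
def FormalGroup.Ring (F : FormalGroup R) (M : Type*) [AddCommGroup M] : Type _ :=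
  CompletedPoly M R ⧸ F.relIdeal M

namespace FormalGroup.Ring

variable {F : FormalGroup R} {M : Type*} [AddCommGroup M]

instance instCommRing : CommRing (F.Ring M) :=
  inferInstanceAs (CommRing (CompletedPoly M R ⧸ F.relIdeal M))

instance instAlgebra : Algebra R (F.Ring M) :=
  inferInstanceAs (Algebra R (CompletedPoly M R ⧸ F.relIdeal M))

/-- The quotient map `R⟦x_M⟧ → R⟦M⟧_F`. -/
def mk (F : FormalGroup R) (M : Type*) [AddCommGroup M] : CompletedPoly M R →ₐ[R] F.Ring M :=
  Ideal.Quotient.mkₐ R (F.relIdeal M)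

lemma mk_surjective : Function.Surjective (mk F M) := Ideal.Quotient.mk_surjective

/-- `R⟦M⟧_F` carries the quotient topology. -/
instance instTopologicalSpace : TopologicalSpace (F.Ring M) :=
  inferInstanceAs (TopologicalSpace (CompletedPoly M R ⧸ F.relIdeal M))

instance isTopologicalRing : IsTopologicalRing (F.Ring M) :=
  inferInstanceAs (IsTopologicalRing (CompletedPoly M R ⧸ F.relIdeal M))

instance instUniformSpace : UniformSpace (F.Ring M) := IsTopologicalAddGroup.rightUniformSpace (F.Ring M)

instance isUniformAddGroup : IsUniformAddGroup (F.Ring M) := isUniformAddGroup_of_addCommGroup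

instance completeSpace : CompleteSpace (F.Ring M) :=
  QuotientAddGroup.completeSpace_right (CompletedPoly M R) (F.relIdeal M).toAddSubgroup

lemma continuous_mk : Continuous (mk F M) := continuous_quot_mk

lemma isOpenMap_mk : IsOpenMap (mk F M) := QuotientRing.isOpenMap_coe _

instance t2Space : T2Space (F.Ring M) := by
  have : IsClosed ((F.relIdeal M).toAddSubgroup : Set (CompletedPoly M R)) := isClosed_closure
  have : T3Space (CompletedPoly M R ⧸ (F.relIdeal M).toAddSubgroup) := inferInstance
  exact (inferInstance : T2Space (CompletedPoly M R ⧸ (F.relIdeal M).toAddSubgroup))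

/-- The class of `x_l` in `R⟦M⟧_F`. -/
def x (F : FormalGroup R) {M : Type*} [AddCommGroup M] (l : M) : F.Ring M :=
  mk F M (CompletedPoly.x l)

/-- The images of the ideals `CompletedPoly.filt` form a basis of neighbourhoods of zero. -/
def filt (F : FormalGroup R) (M : Type*) [AddCommGroup M] (n : ℕ) : Ideal (F.Ring M) :=
  (CompletedPoly.filt M R n).map (mk F M)

lemma coe_filt (n : ℕ) : (filt F M n : Set (F.Ring M)) =
    mk F M '' (CompletedPoly.filt M R n : Set (CompletedPoly M R)) := by
  ext a
  simp only [filt, SetLike.mem_coe, Set.mem_image]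
  exact Ideal.mem_map_iff_of_surjective _ mk_surjective

lemma hasBasis_filt : (𝓝 (0 : F.Ring M)).HasBasis (fun _ : ℕ ↦ True)
    fun n ↦ (filt F M n : Set (F.Ring M)) := by
  have h := (CompletedPoly.hasBasis_filt (S := M) (R := R)).map (mk F M)
  rw [isOpenMap_mk.map_nhds_eq continuous_mk.continuousAt, map_zero] at h
  simpa only [coe_filt] using h

instance isLinearTopology : IsLinearTopology (F.Ring M) (F.Ring M) :=
  IsLinearTopology.mk_of_hasBasis _ hasBasis_filt

lemma filt_one_pow_le (n : ℕ) : filt F M 1 ^ n ≤ filt F M n := by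
  rw [filt, ← Ideal.map_pow]
  exact Ideal.map_mono (CompletedPoly.filt_one_pow_le n)

lemma x_mem_filt (l : M) : x F l ∈ filt F M 1 :=
  Ideal.mem_map_of_mem _ (CompletedPoly.x_mem_filt l)

lemma tn_of_mem_filt {a : F.Ring M} (ha : a ∈ filt F M 1) : IsTopologicallyNilpotent a := by
  rw [IsTopologicallyNilpotent, hasBasis_filt.tendsto_right_iff]
  intro n _
  filter_upwards [Filter.eventually_ge_atTop n] with k hk
  exact filt_one_pow_le n (Ideal.pow_le_pow_right hk (Ideal.pow_mem_pow ha k))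

lemma tn_x (l : M) : IsTopologicallyNilpotent (x F l) := tn_of_mem_filt (x_mem_filt l)

lemma x_zero : x F (0 : M) = 0 :=
  Ideal.Quotient.eq_zero_iff_mem.2 (subset_closure (Ideal.subset_span (Or.inl rfl)))

lemma x_add (l m : M) : x F (l + m) = evalPair F.toPowerSeries (x F l) (x F m) := by
  have h : mk F M (CompletedPoly.x (l + m) -
      evalPair F.toPowerSeries (CompletedPoly.x l) (CompletedPoly.x m)) = 0 :=
    Ideal.Quotient.eq_zero_iff_mem.2
      (subset_closure (Ideal.subset_span (Or.inr ⟨(l, m), rfl⟩)))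
  rw [map_sub, sub_eq_zero, map_evalPair (mk F M) continuous_mk _
    (CompletedPoly.tn_of_mem_filt (CompletedPoly.x_mem_filt _))
    (CompletedPoly.tn_of_mem_filt (CompletedPoly.x_mem_filt _))] at h
  exact h

/-- The homomorphism `l ↦ x_l` from `M` to the topologically nilpotent elements. -/
def xHom (F : FormalGroup R) [F.IsComm] (M : Type*) [AddCommGroup M] : M →+ F.Nil (F.Ring M) where
  toFun l := ⟨x F l, tn_x l⟩
  map_zero' := Nil.ext x_zero
  map_add' l m := Nil.ext (x_add l m)

section lift

variable {B : Type*} [CommRing B] [Algebra R B] [UniformSpace B]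
  [IsUniformAddGroup B] [IsTopologicalRing B] [CompleteSpace B] [T2Space B]
  [IsLinearTopology B B] [F.IsComm]

lemma continuous_aeval (f : M →+ F.Nil B) (K : Ideal B) (hf : ∀ l, (f l).val ∈ K)
    (hK : ∀ U ∈ 𝓝 (0 : B), ∃ n, ((K ^ n : Ideal B) : Set B) ⊆ U) :
    Continuous (MvPolynomial.aeval (R := R) fun l ↦ (f l).val) := by
  refine continuous_of_continuousAt_zero (MvPolynomial.aeval (R := R) fun l ↦ (f l).val) ?_
  rw [ContinuousAt, map_zero,
    (MvPolynomial.idealOfVars M R).hasBasis_nhds_zero_adic.tendsto_left_iff]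
  intro U hU
  obtain ⟨n, hn⟩ := hK U hU
  refine ⟨n, trivial, fun p hp ↦ hn ?_⟩
  have h1 : MvPolynomial.idealOfVars M R ≤
      K.comap (MvPolynomial.aeval (R := R) fun l ↦ (f l).val) := by
    rw [MvPolynomial.idealOfVars, Ideal.span_le]
    rintro _ ⟨l, rfl⟩
    simpa using hf l
  exact Ideal.le_comap_pow _ n (Ideal.pow_right_mono h1 n hp)

lemma extensionHom_algebraMap (f : M →+ F.Nil B) (K : Ideal B) (hf : ∀ l, (f l).val ∈ K)
    (hK : ∀ U ∈ 𝓝 (0 : B), ∃ n, ((K ^ n : Ideal B) : Set B) ⊆ U) (r : R) :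
    Completion.extensionHom (MvPolynomial.aeval (R := R) fun l ↦ (f l).val).toRingHom
      (continuous_aeval f K hf hK) (algebraMap R (CompletedPoly M R) r) = algebraMap R B r := by
  rw [Completion.algebraMap_def, Completion.extensionHom_coe]
  exact AlgHom.commutes (MvPolynomial.aeval (R := R) fun l ↦ (f l).val) r

/-- The extension of `x_l ↦ f l` to `R⟦x_M⟧`. -/
def liftAux (f : M →+ F.Nil B) (K : Ideal B) (hf : ∀ l, (f l).val ∈ K)
    (hK : ∀ U ∈ 𝓝 (0 : B), ∃ n, ((K ^ n : Ideal B) : Set B) ⊆ U) : CompletedPoly M R →ₐ[R] B where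
  toRingHom := Completion.extensionHom (MvPolynomial.aeval (R := R) fun l ↦ (f l).val).toRingHom
    (continuous_aeval f K hf hK)
  commutes' := extensionHom_algebraMap f K hf hK

variable (f : M →+ F.Nil B) (K : Ideal B) (hf : ∀ l, (f l).val ∈ K)
    (hK : ∀ U ∈ 𝓝 (0 : B), ∃ n, ((K ^ n : Ideal B) : Set B) ⊆ U)

lemma continuous_liftAux : Continuous (liftAux f K hf hK) := Completion.continuous_extension

lemma liftAux_x (l : M) : liftAux f K hf hK (CompletedPoly.x l) = (f l).val :=
  (Completion.extensionHom_coe _ (continuous_aeval f K hf hK) (MvPolynomial.X l)).trans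
    (MvPolynomial.aeval_X (R := R) (fun l ↦ (f l).val) l)

lemma liftAux_eq_zero (a : CompletedPoly M R) (ha : a ∈ F.relIdeal M) :
    liftAux f K hf hK a = 0 := by
  have hc : IsClosed {a | liftAux f K hf hK a = 0} :=
    isClosed_eq (continuous_liftAux f K hf hK) continuous_const
  suffices h : Ideal.span _ ≤ RingHom.ker (liftAux f K hf hK) from
    closure_minimal (fun b hb ↦ h hb) hc ha
  rw [Ideal.span_le]
  rintro _ (rfl | ⟨⟨l, m⟩, rfl⟩)
  · rw [SetLike.mem_coe, RingHom.mem_ker, liftAux_x, map_zero]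
    rfl
  · rw [SetLike.mem_coe, RingHom.mem_ker, map_sub,
      map_evalPair _ (continuous_liftAux f K hf hK) _
      (CompletedPoly.tn_of_mem_filt (CompletedPoly.x_mem_filt _))
      (CompletedPoly.tn_of_mem_filt (CompletedPoly.x_mem_filt _)), liftAux_x, liftAux_x, liftAux_x,
      map_add, Nil.val_add, sub_self]

/-- The continuous algebra homomorphism `R⟦M⟧_F → B` sending `x_l` to `f l`, for a homomorphism
`f` from `M` to the topologically nilpotent elements of `B` taking values in an ideal whose powers
tend to zero. -/
def lift : F.Ring M →ₐ[R] B :=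
  Ideal.Quotient.liftₐ (F.relIdeal M) (liftAux f K hf hK) (liftAux_eq_zero f K hf hK)

lemma continuous_lift : Continuous (lift f K hf hK) :=
  Continuous.quotient_lift (continuous_liftAux f K hf hK) _

lemma lift_x (l : M) : lift f K hf hK (x F l) = (f l).val := liftAux_x f K hf hK l

/-- A continuous algebra homomorphism on `R⟦M⟧_F` is determined by the images of the `x_l`. -/
lemma hom_ext {φ ψ : F.Ring M →ₐ[R] B} (hφ : Continuous φ) (hψ : Continuous ψ)
    (h : ∀ l, φ (x F l) = ψ (x F l)) : φ = ψ := by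
  ext a
  obtain ⟨a, rfl⟩ := mk_surjective a
  refine Completion.induction_on a
    (isClosed_eq (hφ.comp continuous_mk) (hψ.comp continuous_mk)) fun p ↦ ?_
  let j : MvPolynomial M R →ₐ[R] CompletedPoly M R :=
    { (Completion.coeRingHom : MvPolynomial M R →+* CompletedPoly M R) with
      commutes' := fun _ ↦ rfl }
  have : (φ.comp (mk F M)).comp j = (ψ.comp (mk F M)).comp j :=
    MvPolynomial.algHom_ext fun l ↦ h l
  exact DFunLike.congr_fun this p

end lift

/-- The augmentation `R⟦M⟧_F → R`, sending every `x_l` to `0`. -/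
def aug (F : FormalGroup R) [F.IsComm] (M : Type*) [AddCommGroup M] : F.Ring M →ₐ[R] R :=
  letI : UniformSpace R := ⊥
  haveI : DiscreteUniformity R := ⟨rfl⟩
  haveI : IsUniformAddGroup R := inferInstance
  lift (0 : M →+ F.Nil R) ⊥ (fun _ ↦ rfl) fun U hU ↦ ⟨1, by
    rintro _ (h : _ ∈ (⊥ : Ideal R) ^ 1)
    rw [pow_one, Ideal.mem_bot] at h
    rw [h]
    exact mem_of_mem_nhds hU⟩

/-- The augmentation ideal of `R⟦M⟧_F`. -/
def augIdeal (F : FormalGroup R) [F.IsComm] (M : Type*) [AddCommGroup M] : Ideal (F.Ring M) :=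
  RingHom.ker (aug F M)

lemma aug_x [F.IsComm] (l : M) : aug F M (x F l) = 0 := by
  let _ : UniformSpace R := ⊥
  have : DiscreteUniformity R := ⟨rfl⟩
  have : IsUniformAddGroup R := inferInstance
  exact lift_x (B := R) _ _ _ _ l

end FormalGroup.Ring

end rings

/-! ### Divided difference operators on formal group rings -/

namespace FormalGroup.Ring

open Topology
open scoped PowerSeries.WithPiTopology

variable {R : Type*} [CommRing R] {F : FormalGroup R} {M : Type*} [AddCommGroup M]

lemma pow_filt_one_subset (U : Set (F.Ring M)) (hU : U ∈ 𝓝 0) :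
    ∃ n, ((filt F M 1 ^ n : Ideal (F.Ring M)) : Set (F.Ring M)) ⊆ U := by
  obtain ⟨n, -, hn⟩ := hasBasis_filt.mem_iff.1 hU
  exact ⟨n, fun a ha ↦ hn (filt_one_pow_le n ha)⟩

/-- The continuous algebra homomorphism `R⟦M⟧_F → R⟦M'⟧_F`, `x_l ↦ x_{f l}`, induced by a
homomorphism `f : M → M'`. -/
def map (F : FormalGroup R) [F.IsComm] {M' : Type*} [AddCommGroup M'] (f : M →+ M') :
    F.Ring M →ₐ[R] F.Ring M' :=
  lift ((xHom F M').comp f) (filt F M' 1) (fun l ↦ x_mem_filt (f l)) pow_filt_one_subset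

lemma continuous_map [F.IsComm] {M' : Type*} [AddCommGroup M'] (f : M →+ M') :
    Continuous (map F f) := continuous_lift _ _ _ _

lemma map_x [F.IsComm] {M' : Type*} [AddCommGroup M'] (f : M →+ M') (l : M) :
    map F f (x F l) = x F (f l) := lift_x _ _ _ _ l

instance isLinearTopology_powerSeries :
    IsLinearTopology (PowerSeries (F.Ring M)) (PowerSeries (F.Ring M)) :=
  inferInstanceAs
    (IsLinearTopology (MvPowerSeries Unit (F.Ring M)) (MvPowerSeries Unit (F.Ring M)))

/-- The power series over `R⟦M⟧_F` whose constant coefficient lies in `filt F M 1`. -/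
def seriesIdeal (F : FormalGroup R) (M : Type*) [AddCommGroup M] :
    Ideal (PowerSeries (F.Ring M)) :=
  (filt F M 1).comap PowerSeries.constantCoeff

lemma coeff_mem_of_mem_pow (n : ℕ) {f : PowerSeries (F.Ring M)} (hf : f ∈ seriesIdeal F M ^ n)
    (m : ℕ) : PowerSeries.coeff m f ∈ filt F M 1 ^ (n - m) := by
  induction n generalizing f m with
  | zero => simp
  | succ n ih =>
    rw [pow_succ'] at hf
    refine Submodule.mul_induction_on hf (fun g hg h hh ↦ ?_) (fun g h hg hh ↦ ?_)
    · rw [PowerSeries.coeff_mul]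
      refine Ideal.sum_mem _ fun ij hij ↦ ?_
      obtain ⟨i, j⟩ := ij
      have hij : i + j = m := Finset.HasAntidiagonal.mem_antidiagonal.1 hij
      simp only
      rcases Nat.eq_zero_or_pos i with rfl | hi
      · have hj : j = m := by omega
        subst hj
        have h1 : PowerSeries.coeff 0 g ∈ filt F M 1 := by
          rw [PowerSeries.coeff_zero_eq_constantCoeff_apply]; exact hg
        have h2 := Ideal.mul_mem_mul h1 (ih hh j)
        rw [← pow_succ'] at h2
        exact Ideal.pow_le_pow_right (by omega) h2
      · exact Ideal.mul_mem_left _ _ (Ideal.pow_le_pow_right (by omega) (ih hh j))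
    · rw [map_add]
      exact Ideal.add_mem _ hg hh

lemma pow_seriesIdeal_subset (U : Set (PowerSeries (F.Ring M))) (hU : U ∈ 𝓝 0) :
    ∃ n, ((seriesIdeal F M ^ n : Ideal _) : Set (PowerSeries (F.Ring M))) ⊆ U := by
  obtain ⟨⟨J, d⟩, hJ, hU⟩ :=
    (MvPowerSeries.LinearTopology.hasBasis_nhds_zero (σ := Unit) (R := F.Ring M)).mem_iff.1 hU
  obtain ⟨n, hn⟩ := pow_filt_one_subset _ hJ
  refine ⟨n + d (), fun f hf ↦ hU ?_⟩
  rw [SetLike.mem_coe, MvPowerSeries.LinearTopology.mem_basis_iff]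
  intro e he
  have h1 := coeff_mem_of_mem_pow _ hf (e ())
  have h2 : e () ≤ d () := he ()
  have h3 := hn (Ideal.pow_le_pow_right (by omega) h1)
  rwa [PowerSeries.coeff, ← Finsupp.unique_single e] at h3

variable [F.IsComm]

lemma continuous_constantCoeff :
    Continuous (PowerSeries.constantCoeff : PowerSeries (F.Ring M) →+* F.Ring M) :=
  PowerSeries.WithPiTopology.continuous_constantCoeff _

/-- The constant power series, as an algebra homomorphism. -/
def const (F : FormalGroup R) (M : Type*) [AddCommGroup M] :
    F.Ring M →ₐ[R] PowerSeries (F.Ring M) :=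
  IsScalarTower.toAlgHom R (F.Ring M) (PowerSeries (F.Ring M))

lemma const_apply (u : F.Ring M) : const F M u = PowerSeries.C u := rfl

lemma continuous_constHom : Continuous (const F M) :=
  PowerSeries.WithPiTopology.continuous_C

/-- The constant coefficient, as an algebra homomorphism. -/
def constCoeff (F : FormalGroup R) (M : Type*) [AddCommGroup M] :
    PowerSeries (F.Ring M) →ₐ[R] F.Ring M where
  toRingHom := PowerSeries.constantCoeff
  commutes' r := by
    change PowerSeries.constantCoeff (PowerSeries.C (algebraMap R (F.Ring M) r)) = _
    simp

/-- The homomorphism `l ↦ x_l -_F ⟨l, f⟩ ·_F t` to the topologically nilpotent elements of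
`R⟦M⟧_F⟦t⟧`. -/
def shiftHom (F : FormalGroup R) [F.IsComm] (f : M →+ ℤ) : M →+ F.Nil (PowerSeries (F.Ring M)) :=
  (Nil.map F (const F M) continuous_constHom).comp (xHom F M) -
    ((zmultiplesHom (F.Nil (PowerSeries (F.Ring M)))) ⟨PowerSeries.X, PowerSeries.HasEval.X⟩).comp f

end FormalGroup.Ring

namespace FormalGroup.Ring

open Topology
open scoped PowerSeries.WithPiTopology

variable {R : Type*} [CommRing R] {F : FormalGroup R} [F.IsComm] {M : Type*} [AddCommGroup M]

lemma continuous_constCoeff : Continuous (constCoeff F M) := continuous_constantCoeff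

lemma map_constCoeff_shiftHom (f : M →+ ℤ) (l : M) :
    Nil.map F (constCoeff F M) continuous_constCoeff (shiftHom F f l) = xHom F M l := by
  have h : Nil.map F (constCoeff F M) continuous_constCoeff
      ⟨PowerSeries.X, PowerSeries.HasEval.X⟩ = 0 :=
    Nil.ext (PowerSeries.constantCoeff_X (R := F.Ring M))
  simp only [shiftHom, AddMonoidHom.sub_apply, AddMonoidHom.comp_apply, map_sub,
    zmultiplesHom_apply, map_zsmul, h, smul_zero, sub_zero]
  exact Nil.ext (PowerSeries.constantCoeff_C _)

lemma constantCoeff_shiftHom (f : M →+ ℤ) (l : M) :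
    PowerSeries.constantCoeff (shiftHom F f l).val = x F l :=
  congrArg Nil.val (map_constCoeff_shiftHom f l)

lemma shiftHom_mem (f : M →+ ℤ) (l : M) : (shiftHom F f l).val ∈ seriesIdeal F M := by
  rw [seriesIdeal, Ideal.mem_comap, constantCoeff_shiftHom]
  exact x_mem_filt l

/-- The continuous algebra homomorphism `R⟦M⟧_F → R⟦M⟧_F⟦t⟧`,
`x_l ↦ x_l -_F ⟨l, f⟩ ·_F t`. -/
def shift (F : FormalGroup R) [F.IsComm] (f : M →+ ℤ) :
    F.Ring M →ₐ[R] PowerSeries (F.Ring M) :=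
  lift (shiftHom F f) (seriesIdeal F M) (shiftHom_mem f) pow_seriesIdeal_subset

lemma continuous_shift (f : M →+ ℤ) : Continuous (shift F f) := continuous_lift _ _ _ _

lemma shift_x (f : M →+ ℤ) (l : M) : shift F f (x F l) = (shiftHom F f l).val :=
  lift_x _ _ _ _ l

lemma constantCoeff_shift (f : M →+ ℤ) (u : F.Ring M) :
    PowerSeries.constantCoeff (shift F f u) = u := by
  have : (constCoeff F M).comp (shift F f) = AlgHom.id R _ :=
    hom_ext (continuous_constCoeff.comp (continuous_shift f)) continuous_id fun l ↦ by
      change PowerSeries.constantCoeff (shift F f (x F l)) = x F l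
      rw [shift_x, constantCoeff_shiftHom]
  exact DFunLike.congr_fun this u

/-- Evaluation of power series over `R⟦M⟧_F` at `t = x_l`. -/
def evalAt (F : FormalGroup R) {M : Type*} [AddCommGroup M] (l : M) :
    PowerSeries (F.Ring M) →ₐ[F.Ring M] F.Ring M :=
  PowerSeries.aeval (R := F.Ring M) (tn_x (F := F) l)

lemma continuous_evalAt (l : M) : Continuous (evalAt F l) := PowerSeries.continuous_aeval _

lemma evalAt_X (l : M) : evalAt F l PowerSeries.X = x F l := by
  have := PowerSeries.aeval_coe (R := F.Ring M) (tn_x (F := F) l) Polynomial.X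
  simpa [evalAt] using this

/-- `g ↦ (g - g(0)) / t`. -/
def divT (A : Type*) [CommRing A] : PowerSeries A →ₗ[A] PowerSeries A where
  toFun g := PowerSeries.mk fun n ↦ PowerSeries.coeff (n + 1) g
  map_add' _ _ := by ext; simp
  map_smul' _ _ := by ext; simp

lemma X_mul_divT {A : Type*} [CommRing A] (g : PowerSeries A)
    (hg : PowerSeries.constantCoeff g = 0) : PowerSeries.X * divT A g = g := by
  ext n
  cases n with
  | zero => simp [hg]
  | succ n => simp [divT, PowerSeries.coeff_succ_X_mul]

/-- The divided difference operator of a pair `(α, α^∨)`: the value at `t = x_α` of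
`(u - u') / t`, where `u' = shift u` is obtained from `u` by the substitution
`x_l ↦ x_l -_F ⟨l, α^∨⟩ ·_F t`. Setting `t = x_α` in `u'` gives `s_α(u)`, so this is the quotient
`(u - s_α(u)) / x_α` whenever `x_α` is not a zero divisor, for example over a domain of characteristic
zero such as the Lazard ring; it is given by universal formulas, hence compatible with base change
along ring homomorphisms, so over any `R` it is the operator induced from the Lazard ring. -/
def divDiff (F : FormalGroup R) [F.IsComm] (α : M) (f : M →+ ℤ) : F.Ring M →ₗ[R] F.Ring M :=
  ((evalAt F α).toLinearMap.comp (divT (F.Ring M))).restrictScalars R ∘ₗ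
    ((const F M).toLinearMap - (shift F f).toLinearMap)

lemma divDiff_apply (α : M) (f : M →+ ℤ) (u : F.Ring M) :
    divDiff F α f u = evalAt F α (divT _ (PowerSeries.C u - shift F f u)) := rfl

/-- The endomorphism `l ↦ l - ⟨l, α^∨⟩ α`. -/
def reflHom (α : M) (f : M →+ ℤ) : M →+ M := AddMonoidHom.id M - (zmultiplesHom M α).comp f

lemma evalAt_shift (α : M) (f : M →+ ℤ) (u : F.Ring M) :
    evalAt F α (shift F f u) = map F (reflHom α f) u := by
  have : ((evalAt F α).restrictScalars R).comp (shift F f) = map F (reflHom α f) := by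
    refine hom_ext ((continuous_evalAt α).comp (continuous_shift f)) (continuous_map _)
      fun l ↦ ?_
    rw [map_x]
    change evalAt F α (shift F f (x F l)) = _
    rw [shift_x]
    have h1 : Nil.map F ((evalAt F α).restrictScalars R) (continuous_evalAt α) (shiftHom F f l) =
        xHom F M (reflHom α f l) := by
      have hX : Nil.map F ((evalAt F α).restrictScalars R) (continuous_evalAt α)
          ⟨PowerSeries.X, PowerSeries.HasEval.X⟩ = xHom F M α := Nil.ext (evalAt_X α)
      simp only [shiftHom, reflHom, AddMonoidHom.sub_apply, AddMonoidHom.comp_apply, map_sub,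
        zmultiplesHom_apply, map_zsmul, hX, AddMonoidHom.id_apply]
      congr 1
      exact Nil.ext ((evalAt F α).commutes (x F l))
    exact congrArg Nil.val h1
  exact DFunLike.congr_fun this u

/-- `x_α Δ_α(u) = u - s_α(u)`. -/
theorem x_mul_divDiff (α : M) (f : M →+ ℤ) (u : F.Ring M) :
    x F α * divDiff F α f u = u - map F (reflHom α f) u := by
  rw [divDiff_apply, ← evalAt_X, ← map_mul, X_mul_divT, map_sub, evalAt_shift]
  · congr 1
    exact (evalAt F α).commutes u
  · rw [map_sub, constantCoeff_shift, PowerSeries.constantCoeff_C, sub_self]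

end FormalGroup.Ring

/-! ### The additive case: operators on the symmetric algebra -/

section additive

open TensorProduct

/-- The symmetric algebra `S_R(M)` over `R` of the abelian group `M`. -/
abbrev LatticeSym (R M : Type*) [CommRing R] [AddCommGroup M] : Type _ := SymmetricAlgebra R (R ⊗[ℤ] M)

namespace LatticeSym

variable (R : Type*) {M : Type*} [CommRing R] [AddCommGroup M]

/-- The inclusion `M → S_R(M)`. -/
def of : M →ₗ[ℤ] LatticeSym R M :=
  (SymmetricAlgebra.ι R (R ⊗[ℤ] M)).restrictScalars ℤ ∘ₗ TensorProduct.mk ℤ R M 1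

variable (M) in
/-- The graded piece `S^n_R(M)`. -/
def graded (n : ℕ) : Submodule R (LatticeSym R M) :=
  LinearMap.range (SymmetricAlgebra.ι R (R ⊗[ℤ] M)) ^ n

/-- The algebra homomorphism `S_R(M) → A` extending `g : M → A`. -/
def lift {A : Type*} [CommRing A] [Algebra R A] (g : M →ₗ[ℤ] A) : LatticeSym R M →ₐ[R] A :=
  SymmetricAlgebra.lift (LinearMap.liftBaseChange R g)

lemma lift_of {A : Type*} [CommRing A] [Algebra R A] (g : M →ₗ[ℤ] A) (l : M) :
    lift R g (of R l) = g l :=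
  (SymmetricAlgebra.lift_ι_apply (LinearMap.liftBaseChange R g) (1 ⊗ₜ[ℤ] l)).trans
    (by simp)

/-- The algebra homomorphism `S_R(M) → S_R(M)[t]`, `l ↦ l - ⟨l, f⟩ t`. -/
def shift (f : M →ₗ[ℤ] ℤ) : LatticeSym R M →ₐ[R] Polynomial (LatticeSym R M) :=
  lift R <|
    (Polynomial.CAlgHom (R := R) (A := LatticeSym R M)).toLinearMap.restrictScalars ℤ ∘ₗ of R -
      (LinearMap.toSpanSingleton ℤ (Polynomial (LatticeSym R M)) Polynomial.X) ∘ₗ f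

lemma shift_of (f : M →ₗ[ℤ] ℤ) (l : M) :
    shift R f (of R l) = Polynomial.C (of R l) - f l • Polynomial.X := by
  rw [shift, lift_of]
  simp

variable {R} in
lemma hom_ext {A : Type*} [CommRing A] [Algebra R A] {φ ψ : LatticeSym R M →ₐ[R] A}
    (h : ∀ l, φ (of R l) = ψ (of R l)) : φ = ψ := by
  refine SymmetricAlgebra.algHom_ext (TensorProduct.AlgebraTensorModule.curry_injective ?_)
  ext l
  exact h l

lemma coeff_zero_shift (f : M →ₗ[ℤ] ℤ) (u : LatticeSym R M) : (shift R f u).coeff 0 = u := by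
  have : ((Polynomial.aeval (0 : LatticeSym R M)).restrictScalars R).comp (shift R f) =
      AlgHom.id R _ := hom_ext fun l ↦ by
    simp [shift_of]
  have := DFunLike.congr_fun this u
  simpa [Polynomial.coeff_zero_eq_aeval_zero] using this

/-- The additive divided difference operator of a pair `(α, α^∨)` on `S_R(M)`: the value at
`t = α` of `(u - u') / t`, where `u' = shift u` is obtained from `u` by the substitution
`l ↦ l - ⟨l, α^∨⟩ t`. -/
def divDiff (α : M) (f : M →ₗ[ℤ] ℤ) : LatticeSym R M →ₗ[R] LatticeSym R M where
  toFun u := ((Polynomial.C u - shift R f u).divX).eval (of R α)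
  map_add' u v := by
    rw [← Polynomial.eval_add, ← Polynomial.divX_add, map_add, map_add, add_sub_add_comm]
  map_smul' r u := by
    have h : Polynomial.C (r • u) - shift R f (r • u) =
        Polynomial.C (algebraMap R (LatticeSym R M) r) * (Polynomial.C u - shift R f u) := by
      rw [map_smul (shift R f), mul_sub, ← Polynomial.C_mul, ← Algebra.smul_def, Algebra.smul_def r (shift R f u)]
      rfl
    rw [RingHom.id_apply, h, Polynomial.divX_C_mul, Polynomial.eval_C_mul, ← Algebra.smul_def]

/-- The action of an endomorphism of `M` on `S_R(M)`. -/
def map (g : M →ₗ[ℤ] M) : LatticeSym R M →ₐ[R] LatticeSym R M :=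
  lift R (of R ∘ₗ g)

/-- `α Δ_α(u) = u - s_α(u)`. -/
theorem of_mul_divDiff (α : M) (f : M →ₗ[ℤ] ℤ) (u : LatticeSym R M) :
    of R α * divDiff R α f u = u - map R (LinearMap.id - f.smulRight α) u := by
  have h1 := Polynomial.X_mul_divX_add (Polynomial.C u - shift R f u)
  rw [Polynomial.coeff_sub, Polynomial.coeff_C_zero, coeff_zero_shift, sub_self, map_zero,
    add_zero] at h1
  have h2 := congrArg (Polynomial.eval (of R α)) h1
  rw [Polynomial.eval_mul, Polynomial.eval_X, Polynomial.eval_sub, Polynomial.eval_C] at h2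
  have h3 : ((Polynomial.aeval (of R α)).restrictScalars R).comp (shift R f) =
      map R (LinearMap.id - f.smulRight α) := hom_ext fun l ↦ by
    rw [map, lift_of]
    simp [shift_of]
  rw [← h3]
  exact h2

end LatticeSym

end additive

/-! ### Words in simple reflections, the torsion index -/

namespace RootPairing.Base

variable {ι M N : Type*} [AddCommGroup M] [AddCommGroup N] {P : RootPairing ι ℤ M N}
  (b : P.Base)

/-- The product `s_{i_1} ⋯ s_{i_l}` of simple reflections. -/
def wordProd (I : List b.support) : P.weylGroup :=
  (I.map fun i ↦ weylGroup.ofIdx P (i : ι)).prod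

/-- The length function of the Weyl group with respect to the simple reflections. -/
def length (w : P.weylGroup) : ℕ :=
  sInf {n | ∃ I : List b.support, I.length = n ∧ b.wordProd I = w}

/-- `I` is a reduced decomposition of `w`. -/
def IsReducedDecomposition (I : List b.support) (w : P.weylGroup) : Prop :=
  b.wordProd I = w ∧ I.length = b.length w

/-- `w` is the longest element of the Weyl group. -/
def IsLongest (w : P.weylGroup) : Prop := ∀ v, b.length v ≤ b.length w

/-- The composition `Δ_{i_1} ∘ ⋯ ∘ Δ_{i_l}` of the additive divided difference operators on
`S_R(M)`. -/
def symWord (R : Type*) [CommRing R] (I : List b.support) : Module.End R (LatticeSym R M) :=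
  (I.map fun i ↦ (LatticeSym.divDiff R (P.root i) (P.coroot' i) :
    Module.End R (LatticeSym R M))).prod

/-- The torsion index `τ`: the nonnegative generator of the ideal `Δ_{w₀}(S^N_ℤ(M)) ⊆ ℤ`, where
`N` is the length of the longest element `w₀` and `Δ_{w₀}` is the composition of additive
operators along any reduced decomposition of `w₀`. -/
def torsionIndex : ℕ :=
  (Submodule.IsPrincipal.generator (Ideal.span {z : ℤ | ∃ (w₀ : P.weylGroup) (I : List b.support),
    b.IsLongest w₀ ∧ b.IsReducedDecomposition I w₀ ∧ ∃ a ∈ LatticeSym.graded ℤ M (b.length w₀),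
      b.symWord ℤ I a = algebraMap ℤ (LatticeSym ℤ M) z})).natAbs

end RootPairing.Base

/-! ### Operators attached to a root datum and the characteristic map -/

namespace FormalGroup

open FormalGroup.Ring

variable {R : Type*} [CommRing R] (F : FormalGroup R) [F.IsComm]
  {ι M N : Type*} [AddCommGroup M] [AddCommGroup N] (P : RootPairing ι ℤ M N)

/-- The operator `Δ_α` on `R⟦M⟧_F` of the root `α` of index `i`. -/
def Del (i : ι) : Module.End R (F.Ring M) :=
  divDiff F (P.root i) (P.coroot' i).toAddMonoidHom

/-- The element `e_α = g(x_α, x_{-α})`. -/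
def e (α : M) : F.Ring M := evalPair F.gSeries (x F α) (x F (-α))

/-- The operator `C_α(u) = u e_α - Δ_α(u)`. -/
def C (i : ι) : Module.End R (F.Ring M) :=
  LinearMap.mulRight R (F.e (P.root i)) - F.Del P i

variable {P} in
/-- The composition `Δ_I = Δ_{i_1} ∘ ⋯ ∘ Δ_{i_l}`. -/
def DelWord (b : P.Base) (I : List b.support) : Module.End R (F.Ring M) :=
  (I.map fun i ↦ F.Del P (i : ι)).prod

variable {P} in
/-- The composition `C_I = C_{i_1} ∘ ⋯ ∘ C_{i_l}`. -/
def CWord (b : P.Base) (I : List b.support) : Module.End R (F.Ring M) :=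
  (I.map fun i ↦ F.C P (i : ι)).prod

/-- The subalgebra of `R`-linear endomorphisms of `R⟦M⟧_F` generated by the `Δ_α`, for all roots
`α`, and by the multiplications by elements of `R⟦M⟧_F`. -/
def operatorAlgebra : Subalgebra R (Module.End R (F.Ring M)) :=
  Algebra.adjoin R (Set.range (F.Del P) ∪ Set.range (LinearMap.mulLeft R (A := F.Ring M)))

/-- The `R`-module `εD` of all linear forms `ε ∘ D`, where `D` runs through `operatorAlgebra` and
`ε` is the augmentation. -/
def augOperators : Submodule R (Module.Dual R (F.Ring M)) :=
  (Subalgebra.toSubmodule (F.operatorAlgebra P)).map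
    (LinearMap.compRight R (M := F.Ring M) (aug F M).toLinearMap)

/-- `H(M)_F`, the `R`-dual of `εD`. -/
abbrev H : Type _ := Module.Dual R (F.augOperators P)

/-- The characteristic map `c : R⟦M⟧_F → H(M)_F`, sending `u` to the evaluation at `u`. -/
def charMap : F.Ring M →ₗ[R] F.H P := (F.augOperators P).subtype.flip

/-- `u` lies in the `n`-th power of the augmentation ideal `I` and its class in `I^n / I^(n+1)` is
the image of `a ∈ S^n_R(M)` under the isomorphism `S^*_R(M) ≃ ⨁ I^n / I^(n+1)` sending `l ∈ M` to
the class of `x_l`. -/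
def IsLift (n : ℕ) (a : LatticeSym R M) (u : F.Ring M) : Prop :=
  ∃ p : MvPolynomial M R, p.IsHomogeneous n ∧ MvPolynomial.aeval (LatticeSym.of R) p = a ∧
    u - MvPolynomial.aeval (x F) p ∈ augIdeal F M ^ (n + 1)

variable {P} in
/-- The condition on the element `u₀`: its class in `I^N / I^(N+1)`, where `N` is the length of
the longest element `w₀`, corresponds to an element `a ∈ S^N_R(M)` whose image under the additive
operator `Δ_{w₀}` is the torsion index. -/
def IsTop (b : P.Base) (u₀ : F.Ring M) : Prop :=
  ∃ (w₀ : P.weylGroup) (I₀ : List b.support), b.IsLongest w₀ ∧ b.IsReducedDecomposition I₀ w₀ ∧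
    ∃ a ∈ LatticeSym.graded R M (b.length w₀),
      b.symWord R I₀ a = algebraMap R _ (b.torsionIndex : R) ∧ F.IsLift (b.length w₀) a u₀

end FormalGroup

end

noncomputable section

set_option linter.unusedSectionVars false

/-! ### Inversions, exchange and the longest element -/

namespace RootPairing

variable {ι M N : Type*} [AddCommGroup M] [AddCommGroup N] {P : RootPairing ι ℤ M N}

/-! Everything rests on the square matrix with entries ε Δ_{I_v} Δ_{I_w}(u₀), for v, w in W. On the
graded pieces of the augmentation filtration Δ_α induces the additive operator Δ^a_α, which lowers
degree by one (`IsLift.divDiff`). Since u₀ has leading form a in degree N, an entry with l(v) + l(w)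
< N is the augmentation of an element of I and vanishes. If l(v) + l(w) = N, the entry is the scalar
obtained by applying the additive word I_v ++ I_w to a. It is τ when vw = w₀, because the additive
composition depends only on the group element, and 0 otherwise, because additive compositions along
non-reduced words vanish. Reindexing the columns by w = x⁻¹w₀ makes the matrix triangular for the
length function with τ on the diagonal, hence invertible (`isUnit_det_aug_delWord`). Multiplication
by e_α does not lower the filtration, so C_α has leading form -Δ^a_α, and replacing the inner
Δ_{I_w} by C_{I_w} only changes the diagonal by signs.

It remains to see that the forms ε Δ_{I_v} span εD (`exists_aug_eq_sum`). If every x_α were regular,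
each operator in D would become, after multiplication by a regular element, a combination of the
automorphisms w in W. Linear algebra over the formal group ring, with the same matrix now known to
be invertible before augmentation, would then express it through the Δ_{I_v}. But a root can be
divisible in M, and then x_α may be a zero divisor. The lattice is therefore replaced by the pairs
(κ, λ) in M × M with κ - λ in the root lattice, W acting on κ. The vectors (α_i, 0) belong to a
basis, so the x_α are regular there, and the split projection to the first factor is compatible with
all operators.

Finally, when a spanning family of εD pairs with a family of linear forms by an invertible matrix,
those forms are a basis of the dual (`Matrix.linearIndependent_of_isUnit_det`,
`Matrix.span_eq_top_of_isUnit_det`). The basis so obtained consists of values of c, which gives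
surjectivity. -/

lemma weylGroup.ofIdx_mul_self (i : ι) : weylGroup.ofIdx P i * weylGroup.ofIdx P i = 1 :=
  Subtype.ext (mul_eq_one_iff_inv_eq.2 (Equiv.reflection_inv P i))

lemma weylGroup.ofIdx_inv (i : ι) : (weylGroup.ofIdx P i)⁻¹ = weylGroup.ofIdx P i :=
  Subtype.ext (Equiv.reflection_inv P i)

lemma weylGroup.ofIdx_smul_idx (i j : ι) : weylGroup.ofIdx P i • j = P.reflectionPerm i j := rfl

lemma weylGroup.ofIdx_smul_smul (i j : ι) :
    weylGroup.ofIdx P i • weylGroup.ofIdx P i • j = j := by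
  rw [smul_smul, ofIdx_mul_self, one_smul]

lemma weylGroup.root_smul (w : P.weylGroup) (i : ι) : P.root (w • i) = w • P.root i :=
  Equiv.root_indexEquiv_eq_smul P i (w : P.Aut)

lemma weylGroup.ofIdx_smul_eq (i : ι) (m : M) :
    weylGroup.ofIdx P i • m = m - P.coroot' i m • P.root i :=
  P.reflection_apply i m

lemma weylGroup.coroot'_smul (w : P.weylGroup) (i : ι) (m : M) :
    P.coroot' (w • i) (w • m) = P.coroot' i m := by
  obtain ⟨w, hw⟩ := w
  induction hw using weylGroup.induction generalizing i m with
  | mem j =>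
    change P.coroot' (P.reflectionPerm j i) (P.reflection j m) = _
    simp only [coroot', coroot_reflectionPerm,
      LinearMap.flip_apply, reflection_apply, coreflection_apply, map_sub, map_smul,
      LinearMap.sub_apply, LinearMap.smul_apply, root_coroot_two, smul_eq_mul, root_coroot_eq_pairing]
    ring
  | one => rfl
  | mul g₁ g₂ h₁ h₂ ih₁ ih₂ =>
    rw [← Submonoid.mk_mul_mk _ _ _ h₁ h₂, mul_smul, mul_smul, ih₁, ih₂]

lemma weylGroup.ext_smul {v w : P.weylGroup} (h : ∀ m : M, v • m = w • m) : v = w :=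
  Subtype.ext (Equiv.weightHom_injective P (LinearEquiv.ext h))

/-- Checked on M, where the Weyl group acts faithfully: w carries the i-th root and coroot to those
of w • i. This conjugation formula drives both the exchange condition and the bookkeeping of deleted
letters. -/
lemma weylGroup.ofIdx_smul_left (w : P.weylGroup) (i : ι) :
    weylGroup.ofIdx P (w • i) = w * weylGroup.ofIdx P i * w⁻¹ := by
  refine ext_smul fun m ↦ ?_
  rw [mul_smul, mul_smul, ofIdx_smul_eq, ofIdx_smul_eq, root_smul]
  have h : P.coroot' (w • i) m = P.coroot' i (w⁻¹ • m) := by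
    rw [← coroot'_smul w i (w⁻¹ • m), smul_inv_smul]
  rw [h, smul_sub, smul_inv_smul, smul_comm]

namespace Base

variable (b : P.Base)

lemma isPos_of_root_eq_neg {j k : ι} (h : P.root j = -P.root k) : b.IsPos j ↔ ¬ b.IsPos k := by
  let _ := P.indexNeg
  rw [← IsPos.neg_iff_not]
  have : j = -k := P.root.injective (by simpa using h)
  rw [this]

/-- The index of -α_i is written `weylGroup.ofIdx P i • i`, so that negation of roots is expressed
by the group action on ι. -/
lemma root_smul_ofIdx_self (w : P.weylGroup) (i : ι) :
    P.root (w • weylGroup.ofIdx P i • i) = -P.root (w • i) := by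
  rw [weylGroup.root_smul, weylGroup.root_smul w, weylGroup.ofIdx_smul_idx,
    P.root_reflectionPerm, P.reflection_apply_self, smul_neg]

lemma isPos_smul_ofIdx_self (w : P.weylGroup) (i : ι) :
    b.IsPos (w • weylGroup.ofIdx P i • i) ↔ ¬ b.IsPos (w • i) := by
  exact b.isPos_of_root_eq_neg (root_smul_ofIdx_self w i)

lemma isPos_ofIdx_self (i : ι) : b.IsPos (weylGroup.ofIdx P i • i) ↔ ¬ b.IsPos i := by
  simpa using b.isPos_smul_ofIdx_self 1 i

/-- The positive roots made negative by `w`. -/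
def inversions [Finite ι] (w : P.weylGroup) : Finset ι :=
  Set.Finite.toFinset (Set.toFinite {j | b.IsPos j ∧ ¬ b.IsPos (w • j)})

@[simp]
lemma mem_inversions [Finite ι] {w : P.weylGroup} {j : ι} :
    j ∈ b.inversions w ↔ b.IsPos j ∧ ¬ b.IsPos (w • j) := by simp [inversions]

@[simp]
lemma inversions_one [Finite ι] : b.inversions (1 : P.weylGroup) = ∅ := by ext; simp

lemma wordProd_cons (i : b.support) (I : List b.support) :
    b.wordProd (i :: I) = weylGroup.ofIdx P i * b.wordProd I := by simp [wordProd]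

lemma wordProd_append (I J : List b.support) :
    b.wordProd (I ++ J) = b.wordProd I * b.wordProd J := by simp [wordProd]

@[simp] lemma wordProd_nil : b.wordProd [] = 1 := rfl

lemma wordProd_singleton (i : b.support) : b.wordProd [i] = weylGroup.ofIdx P i := by
  simp [wordProd]

lemma wordProd_reverse (I : List b.support) : b.wordProd I.reverse = (b.wordProd I)⁻¹ := by
  induction I with
  | nil => simp
  | cons i I ih =>
    rw [List.reverse_cons, wordProd_append, wordProd_singleton, wordProd_cons, ih, mul_inv_rev,
      weylGroup.ofIdx_inv]

section reduced

variable [Finite ι] [P.IsReduced]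

lemma isPos_ofIdx_smul {i : ι} (hi : i ∈ b.support) {j : ι} (hij : j ≠ i) (hj : b.IsPos j) :
    b.IsPos (weylGroup.ofIdx P i • j) :=
  hj.reflectionPerm hi hij

lemma eq_of_not_isPos_ofIdx_smul {i : ι} (hi : i ∈ b.support) {j : ι} (hj : b.IsPos j)
    (h : ¬ b.IsPos (weylGroup.ofIdx P i • j)) : j = i := by
  by_contra hij
  exact h (b.isPos_ofIdx_smul hi hij hj)

/-- Left multiplication by a simple reflection which creates an inversion. -/
lemma inversions_ofIdx_mul (w : P.weylGroup) {i : ι} (hi : i ∈ b.support)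
    (h : b.IsPos (w⁻¹ • i)) :
    ∃ h' : w⁻¹ • i ∉ b.inversions w,
      b.inversions (weylGroup.ofIdx P i * w) = (b.inversions w).cons (w⁻¹ • i) h' := by
  have hi' := isPos_of_mem_support hi
  refine ⟨by simp [hi'], ?_⟩
  ext j
  simp only [mem_inversions, Finset.mem_cons, mul_smul]
  refine ⟨fun ⟨h1, h2⟩ ↦ ?_, ?_⟩
  -- The only positive root made negative by s_i is α_i, so in the first case w • j = i.
  · by_cases h3 : b.IsPos (w • j)
    · left
      rw [← b.eq_of_not_isPos_ofIdx_smul hi h3 h2, inv_smul_smul]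
    · exact Or.inr ⟨h1, h3⟩
  · rintro (rfl | ⟨h1, h2⟩)
    · refine ⟨h, ?_⟩
      rw [smul_inv_smul, b.isPos_ofIdx_self]
      simpa
    · refine ⟨h1, fun h3 ↦ ?_⟩
      -- In this case j is the index of -w⁻¹α_i, which is negative by `h`.
      by_cases h4 : weylGroup.ofIdx P i • w • j = i
      · have h5 := congrArg (fun k ↦ w⁻¹ • weylGroup.ofIdx P i • k) h4
        simp only [weylGroup.ofIdx_smul_smul, inv_smul_smul] at h5
        rw [h5, b.isPos_smul_ofIdx_self] at h1
        exact h1 h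
      · have := b.isPos_ofIdx_smul hi h4 h3
        rw [weylGroup.ofIdx_smul_smul] at this
        exact h2 this

lemma card_inversions_ofIdx_mul (w : P.weylGroup) {i : ι} (hi : i ∈ b.support)
    (h : b.IsPos (w⁻¹ • i)) :
    (b.inversions (weylGroup.ofIdx P i * w)).card = (b.inversions w).card + 1 := by
  obtain ⟨h', e⟩ := b.inversions_ofIdx_mul w hi h
  rw [e, Finset.card_cons]

lemma card_inversions_ofIdx_mul_of_not (w : P.weylGroup) {i : ι} (hi : i ∈ b.support)
    (h : ¬ b.IsPos (w⁻¹ • i)) :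
    (b.inversions (weylGroup.ofIdx P i * w)).card + 1 = (b.inversions w).card := by
  rw [← b.card_inversions_ofIdx_mul _ hi, ← mul_assoc, weylGroup.ofIdx_mul_self, one_mul]
  rwa [mul_inv_rev, weylGroup.ofIdx_inv, mul_smul, b.isPos_smul_ofIdx_self]

/-- The map β ↦ -w⁻¹β is a bijection from the inversions of w⁻¹ onto those of w. -/
lemma card_inversions_inv (w : P.weylGroup) :
    (b.inversions w⁻¹).card = (b.inversions w).card := by
  refine Finset.card_bij (fun j _ ↦ weylGroup.ofIdx P (w⁻¹ • j) • w⁻¹ • j) (fun j hj ↦ ?_)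
    (fun j _ k _ h ↦ ?_) (fun j hj ↦ ?_)
  · rw [mem_inversions] at hj ⊢
    rw [b.isPos_ofIdx_self, b.isPos_smul_ofIdx_self, smul_inv_smul]
    exact ⟨hj.2, by simpa using hj.1⟩
  · have h' := congrArg P.root h
    rw [weylGroup.ofIdx_smul_idx, weylGroup.ofIdx_smul_idx, P.root_reflectionPerm,
      P.reflection_apply_self, P.root_reflectionPerm, P.reflection_apply_self, neg_inj] at h'
    exact smul_left_cancel _ (P.root.injective h')
  · rw [mem_inversions] at hj
    have e : weylGroup.ofIdx P j • w⁻¹ • w • j = w⁻¹ • weylGroup.ofIdx P (w • j) • w • j := by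
      rw [weylGroup.ofIdx_smul_left, mul_smul, mul_smul, inv_smul_smul, inv_smul_smul]
    refine ⟨weylGroup.ofIdx P (w • j) • w • j, ?_, ?_⟩
    · rw [mem_inversions, ← e, inv_smul_smul, b.isPos_ofIdx_self, b.isPos_ofIdx_self]
      exact ⟨hj.2, by simpa using hj.1⟩
    · rw [← e, inv_smul_smul, weylGroup.ofIdx_smul_left, weylGroup.ofIdx_mul_self]
      simp

lemma card_inversions_mul_ofIdx (w : P.weylGroup) {i : ι} (hi : i ∈ b.support)
    (h : b.IsPos (w • i)) :
    (b.inversions (w * weylGroup.ofIdx P i)).card = (b.inversions w).card + 1 := by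
  rw [← card_inversions_inv, mul_inv_rev, weylGroup.ofIdx_inv, b.card_inversions_ofIdx_mul _ hi,
    card_inversions_inv]
  rwa [inv_inv]

lemma card_inversions_wordProd_le (I : List b.support) :
    (b.inversions (b.wordProd I)).card ≤ I.length := by
  induction I with
  | nil => simp
  | cons i I ih =>
    rw [wordProd_cons, List.length_cons]
    by_cases h : b.IsPos ((b.wordProd I)⁻¹ • (i : ι))
    · rw [b.card_inversions_ofIdx_mul _ i.2 h]; omega
    · have := b.card_inversions_ofIdx_mul_of_not _ i.2 h
      omega

/-- The exchange condition. -/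
lemma exchange (J : List b.support) (k : b.support)
    (h : ¬ b.IsPos (b.wordProd J • (k : ι))) :
    ∃ J' : List b.support, J'.length + 1 = J.length ∧
      b.wordProd J * weylGroup.ofIdx P k = b.wordProd J' := by
  induction J with
  | nil => simp [isPos_of_mem_support k.2] at h
  | cons j J ih =>
    -- Read from the right, the letter at which α_k turns negative is the one to delete. If it is
    -- the first letter j and v is the product of the rest, then v α_k = α_j, so s_j = v s_k v⁻¹ and
    -- s_j v s_k = v.
    by_cases h1 : b.IsPos (b.wordProd J • (k : ι))
    · rw [wordProd_cons, mul_smul] at h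
      have h2 := b.eq_of_not_isPos_ofIdx_smul j.2 h1 h
      refine ⟨J, rfl, ?_⟩
      rw [wordProd_cons, ← h2, weylGroup.ofIdx_smul_left]
      simp [mul_assoc, weylGroup.ofIdx_mul_self]
    · obtain ⟨J', hl, e⟩ := ih h1
      exact ⟨j :: J', by simp [hl], by rw [wordProd_cons, wordProd_cons, mul_assoc, e]⟩

lemma exchange_left (J : List b.support) (k : b.support)
    (h : ¬ b.IsPos ((b.wordProd J)⁻¹ • (k : ι))) :
    ∃ J' : List b.support, J'.length + 1 = J.length ∧
      weylGroup.ofIdx P k * b.wordProd J = b.wordProd J' := by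
  rw [← wordProd_reverse] at h
  obtain ⟨J', hl, e⟩ := b.exchange _ _ h
  refine ⟨J'.reverse, by simpa using hl, ?_⟩
  rw [wordProd_reverse, ← e, wordProd_reverse, mul_inv_rev, inv_inv, weylGroup.ofIdx_inv]

/-- Each letter changes the number of inversions by exactly one. If there are fewer inversions than
letters, some letter lowers the count, and exchange cancels it against a letter to its right. -/
lemma exists_wordProd_of_card_lt (I : List b.support)
    (h : (b.inversions (b.wordProd I)).card < I.length) :
    ∃ I' : List b.support, I'.length + 2 = I.length ∧ b.wordProd I' = b.wordProd I := by
  induction I with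
  | nil => simp at h
  | cons i I ih =>
    by_cases h1 : b.IsPos ((b.wordProd I)⁻¹ • (i : ι))
    · rw [wordProd_cons, b.card_inversions_ofIdx_mul _ i.2 h1, List.length_cons,
        add_lt_add_iff_right] at h
      obtain ⟨I', hl, e⟩ := ih h
      exact ⟨i :: I', by simp [← hl], by rw [wordProd_cons, wordProd_cons, e]⟩
    · obtain ⟨J', hl, e⟩ := b.exchange_left I i h1
      exact ⟨J', by simp [← hl], by rw [wordProd_cons, e]⟩

lemma exists_wordProd_eq (w : P.weylGroup) : ∃ I : List b.support, b.wordProd I = w := by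
  -- Every root arises from simple ones by negation and simple reflections; negation leaves the
  -- reflection unchanged, and a simple reflection conjugates it.
  have key (i : ι) : ∃ I : List b.support, b.wordProd I = weylGroup.ofIdx P i := by
    induction i using b.induction_reflect with
    | h₀ i ih =>
      obtain ⟨I, hI⟩ := ih
      refine ⟨I, hI.trans ?_⟩
      rw [← weylGroup.ofIdx_smul_idx, weylGroup.ofIdx_smul_left]
      simp [weylGroup.ofIdx_inv, weylGroup.ofIdx_mul_self]
    | h₁ i hi => exact ⟨[⟨i, hi⟩], b.wordProd_singleton ⟨i, hi⟩⟩
    | h₂ i j ih hj =>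
      obtain ⟨I, hI⟩ := ih
      refine ⟨⟨j, hj⟩ :: (I ++ [⟨j, hj⟩]), ?_⟩
      rw [wordProd_cons, wordProd_append, wordProd_singleton, hI, ← weylGroup.ofIdx_smul_idx,
        weylGroup.ofIdx_smul_left, weylGroup.ofIdx_inv, mul_assoc]
  obtain ⟨w, hw⟩ := w
  induction hw using weylGroup.induction with
  | mem i => exact key i
  | one => exact ⟨[], rfl⟩
  | mul g₁ g₂ h₁ h₂ ih₁ ih₂ =>
    obtain ⟨I₁, e₁⟩ := ih₁
    obtain ⟨I₂, e₂⟩ := ih₂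
    exact ⟨I₁ ++ I₂, by rw [wordProd_append, e₁, e₂]; rfl⟩

lemma exists_isReducedDecomposition (w : P.weylGroup) :
    ∃ I, b.IsReducedDecomposition I w := by
  have h : {n | ∃ I : List b.support, I.length = n ∧ b.wordProd I = w}.Nonempty := by
    obtain ⟨I, hI⟩ := b.exists_wordProd_eq w
    exact ⟨_, I, rfl, hI⟩
  obtain ⟨I, h1, h2⟩ := Nat.sInf_mem h
  exact ⟨I, h2, h1⟩

lemma length_wordProd_le (I : List b.support) : b.length (b.wordProd I) ≤ I.length :=
  Nat.sInf_le ⟨I, rfl, rfl⟩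

/-- The length is the number of inversions. -/
lemma length_eq_card_inversions (w : P.weylGroup) : b.length w = (b.inversions w).card := by
  obtain ⟨I, rfl, hl⟩ := b.exists_isReducedDecomposition w
  refine le_antisymm ?_ (hl ▸ b.card_inversions_wordProd_le I)
  by_contra! h
  rw [← hl] at h
  obtain ⟨I', h1, h2⟩ := b.exists_wordProd_of_card_lt I h
  have := b.length_wordProd_le I'
  rw [h2] at this
  omega

lemma length_inv (w : P.weylGroup) : b.length w⁻¹ = b.length w := by
  rw [length_eq_card_inversions, length_eq_card_inversions, card_inversions_inv]

lemma eq_one_of_length_eq_zero {w : P.weylGroup} (h : b.length w = 0) : w = 1 := by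
  obtain ⟨I, rfl, hl⟩ := b.exists_isReducedDecomposition w
  rw [h, List.length_eq_zero_iff] at hl
  simp [hl]

include b in
-- The action on the finite set of roots is faithful: an element fixing every root has no
-- inversions, hence length zero.
lemma finite_weylGroup : Finite P.weylGroup := by
  refine Finite.of_injective (MulAction.toPermHom P.weylGroup ι) ?_
  rw [injective_iff_map_eq_one]
  intro w hw
  refine b.eq_one_of_length_eq_zero ?_
  rw [length_eq_card_inversions, Finset.card_eq_zero]
  ext j
  have : w • j = j := DFunLike.congr_fun hw j
  simp [this]

lemma exists_isLongest : ∃ w : P.weylGroup, b.IsLongest w := by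
  have := b.finite_weylGroup
  exact Finite.exists_max b.length

variable {b} in
-- If w kept a simple root α_i positive, w s_i would be longer. Every positive root is reached from
-- simple ones by successively adding simple roots.
lemma IsLongest.not_isPos {w : P.weylGroup} (hw : b.IsLongest w) {j : ι} (hj : b.IsPos j) :
    ¬ b.IsPos (w • j) := by
  have key : ∀ i ∈ b.support, ¬ b.IsPos (w • i) := fun i hi h ↦ by
    have := hw (w * weylGroup.ofIdx P i)
    rw [length_eq_card_inversions, b.card_inversions_mul_ofIdx _ hi h,
      length_eq_card_inversions] at this
    omega
  refine hj.induction_on_add key fun i j k hk hi hj ↦ ?_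
  have h1 := key j hj
  -- Additivity is available for positive roots, so the claim is transferred to the negatives of the
  -- roots involved.
  rw [← isPos_smul_ofIdx_self] at h1 hi ⊢
  refine IsPos.add hi h1 ?_
  simp only [root_smul_ofIdx_self]
  rw [weylGroup.root_smul, hk, smul_add, ← weylGroup.root_smul, ← weylGroup.root_smul, neg_add]

variable {b} in
-- Since w₀ negates every root, the positive roots split into those kept positive by w⁻¹, which are
-- the inversions of w₀w⁻¹, and those made negative, which are the inversions of w⁻¹.
lemma IsLongest.length_mul_inv {w₀ : P.weylGroup} (h₀ : b.IsLongest w₀) (w : P.weylGroup) :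
    b.length (w₀ * w⁻¹) + b.length w = b.length w₀ := by
  classical
  rw [← b.length_inv w, length_eq_card_inversions, length_eq_card_inversions,
    length_eq_card_inversions, ← Finset.card_union_of_disjoint]
  · congr 1
    ext j
    simp only [Finset.mem_union, mem_inversions, mul_smul]
    refine ⟨by rintro (h | h) <;> exact ⟨h.1, h₀.not_isPos h.1⟩, fun ⟨h1, _⟩ ↦ ?_⟩
    by_cases h2 : b.IsPos (w⁻¹ • j)
    · exact Or.inl ⟨h1, h₀.not_isPos h2⟩
    · exact Or.inr ⟨h1, h2⟩
  · rw [Finset.disjoint_left]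
    intro j h1 h2
    simp only [mem_inversions, mul_smul] at h1 h2
    refine h1.2 ?_
    have h3 : b.IsPos (weylGroup.ofIdx P (w⁻¹ • j) • w⁻¹ • j) := (b.isPos_ofIdx_self _).2 h2.2
    have h4 := h₀.not_isPos h3
    rwa [isPos_smul_ofIdx_self, not_not] at h4

variable {b} in
lemma IsLongest.eq_of_length_eq {w₀ : P.weylGroup} (h₀ : b.IsLongest w₀) {w : P.weylGroup}
    (h : b.length w = b.length w₀) : w = w₀ := by
  have h1 := h₀.length_mul_inv w
  have h2 : w₀ * w⁻¹ = 1 := b.eq_one_of_length_eq_zero (by omega)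
  exact (mul_inv_eq_one.1 h2).symm

/-- `I` is a reduced word. -/
def IsReducedWord (I : List b.support) : Prop := I.length = b.length (b.wordProd I)

lemma IsReducedDecomposition.isReducedWord {b : P.Base} {I : List b.support} {w : P.weylGroup}
    (h : b.IsReducedDecomposition I w) : b.IsReducedWord I := by
  rw [IsReducedWord, h.1, h.2]

lemma isReducedWord_cons_iff {i : b.support} {I : List b.support} (hI : b.IsReducedWord I) :
    b.IsReducedWord (i :: I) ↔ b.IsPos ((b.wordProd I)⁻¹ • (i : ι)) := by
  rw [IsReducedWord, wordProd_cons, List.length_cons]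
  rw [IsReducedWord] at hI
  rw [length_eq_card_inversions] at hI ⊢
  by_cases h : b.IsPos ((b.wordProd I)⁻¹ • (i : ι))
  · simp [b.card_inversions_ofIdx_mul _ i.2 h, h, hI]
  · have := b.card_inversions_ofIdx_mul_of_not _ i.2 h
    simp only [h, iff_false]
    omega

lemma IsReducedWord.of_cons {b : P.Base} {i : b.support} {I : List b.support}
    (h : b.IsReducedWord (i :: I)) : b.IsReducedWord I := by
  refine le_antisymm ?_ (b.length_wordProd_le I)
  rw [IsReducedWord, wordProd_cons, List.length_cons, length_eq_card_inversions] at h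
  rw [length_eq_card_inversions]
  by_cases h1 : b.IsPos ((b.wordProd I)⁻¹ • (i : ι))
  · rw [b.card_inversions_ofIdx_mul _ i.2 h1] at h
    omega
  · have := b.card_inversions_ofIdx_mul_of_not _ i.2 h1
    omega

/-- Exchange gives a reduced expression of the same element that begins with i. A further Δ_i in
front then produces Δ_i ∘ Δ_i = 0. -/
lemma exists_cons_of_not_isReducedWord {i : b.support} {I : List b.support}
    (hI : b.IsReducedWord I) (h : ¬ b.IsReducedWord (i :: I)) :
    ∃ J : List b.support, b.IsReducedWord (i :: J) ∧ b.wordProd (i :: J) = b.wordProd I ∧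
      (i :: J).length = I.length := by
  rw [b.isReducedWord_cons_iff hI] at h
  obtain ⟨J, h1, h2⟩ := b.exchange_left I i h
  have h3 : b.wordProd (i :: J) = b.wordProd I := by
    rw [wordProd_cons, ← h2, ← mul_assoc, weylGroup.ofIdx_mul_self, one_mul]
  refine ⟨J, ?_, h3, by simpa using h1⟩
  rw [IsReducedWord, h3, ← hI, List.length_cons, h1]

end reduced

end Base

end RootPairing

/-! ### Divided differences on the symmetric algebra -/

namespace LatticeSym

open TensorProduct

variable (R : Type*) {M : Type*} [CommRing R] [AddCommGroup M]

lemma aeval_of_surjective : Function.Surjective (MvPolynomial.aeval (R := R) (of R (M := M))) := by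
  intro u
  induction u using SymmetricAlgebra.induction with
  | algebraMap r => exact ⟨MvPolynomial.C r, MvPolynomial.aeval_C _ r⟩
  | ι x =>
    induction x using TensorProduct.induction_on with
    | zero => exact ⟨0, by simp⟩
    | tmul r l =>
      refine ⟨MvPolynomial.C r * MvPolynomial.X l, ?_⟩
      have : r ⊗ₜ[ℤ] l = r • ((1 : R) ⊗ₜ[ℤ] l) := by simp [TensorProduct.smul_tmul']
      rw [map_mul, MvPolynomial.aeval_C, MvPolynomial.aeval_X, ← Algebra.smul_def, this, map_smul]
      rfl
    | add x y hx hy =>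
      obtain ⟨p, hp⟩ := hx
      obtain ⟨q, hq⟩ := hy
      exact ⟨p + q, by rw [map_add, map_add, hp, hq]⟩
  | mul a b ha hb =>
    obtain ⟨p, rfl⟩ := ha
    obtain ⟨q, rfl⟩ := hb
    exact ⟨p * q, map_mul _ p q⟩
  | add a b ha hb =>
    obtain ⟨p, rfl⟩ := ha
    obtain ⟨q, rfl⟩ := hb
    exact ⟨p + q, map_add _ p q⟩

variable {R}

/-- Induction by linear factors, the shape suited to the twisted Leibniz rule. -/
lemma induction_of_mul {motive : LatticeSym R M → Prop} (one : motive 1)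
    (smul : ∀ (r : R) u, motive u → motive (r • u)) (add : ∀ u v, motive u → motive v → motive (u + v))
    (mul : ∀ l u, motive u → motive (of R l * u)) (u : LatticeSym R M) : motive u := by
  obtain ⟨p, rfl⟩ := aeval_of_surjective R u
  induction p using MvPolynomial.induction_on with
  | C r =>
    rw [MvPolynomial.aeval_C, Algebra.algebraMap_eq_smul_one]
    exact smul r _ one
  | add p q hp hq =>
    rw [map_add]
    exact add _ _ hp hq
  | mul_X p l hp =>
    rw [map_mul, MvPolynomial.aeval_X, mul_comm]
    exact mul l _ hp

lemma divX_eq_of_eq {A : Type*} [CommRing A] {p q : Polynomial A} (h : p = Polynomial.X * q) :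
    p.divX = q := by
  ext n
  rw [h, Polynomial.coeff_divX, Polynomial.coeff_X_mul]

lemma C_sub_shift (f : M →ₗ[ℤ] ℤ) (u : LatticeSym R M) :
    Polynomial.C u - shift R f u = Polynomial.X * (Polynomial.C u - shift R f u).divX := by
  have h1 := Polynomial.X_mul_divX_add (Polynomial.C u - shift R f u)
  rw [Polynomial.coeff_sub, Polynomial.coeff_C_zero, coeff_zero_shift, sub_self, map_zero,
    add_zero] at h1
  exact h1.symm

lemma eval_shift (α : M) (f : M →ₗ[ℤ] ℤ) (u : LatticeSym R M) :
    (shift R f u).eval (of R α) = map R (LinearMap.id - f.smulRight α) u := by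
  have h3 : ((Polynomial.aeval (of R α)).restrictScalars R).comp (shift R f) =
      map R (LinearMap.id - f.smulRight α) := hom_ext fun l ↦ by
    rw [map, lift_of]
    simp [shift_of]
  rw [← h3]
  rfl

lemma map_of (g : M →ₗ[ℤ] M) (l : M) : map R g (of R l) = of R (g l) := lift_of R _ l

lemma divDiff_apply (α : M) (f : M →ₗ[ℤ] ℤ) (u : LatticeSym R M) :
    divDiff R α f u = ((Polynomial.C u - shift R f u).divX).eval (of R α) := rfl

lemma divDiff_of (α : M) (f : M →ₗ[ℤ] ℤ) (l : M) : divDiff R α f (of R l) = (f l : LatticeSym R M) := by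
  have : Polynomial.C (of R l) - shift R f (of R l) =
      Polynomial.X * Polynomial.C (f l : LatticeSym R M) := by
    rw [shift_of, sub_sub_cancel, zsmul_eq_mul, mul_comm]
    simp
  rw [divDiff_apply, divX_eq_of_eq this, Polynomial.eval_C]

lemma divDiff_one (α : M) (f : M →ₗ[ℤ] ℤ) : divDiff R α f 1 = 0 := by
  rw [divDiff_apply]
  simp

/-- The identity is proved in the polynomial ring, where t can be cancelled, and only then evaluated
at t = α. Cancelling α itself would be illegitimate, as it may be a zero divisor. -/
lemma divDiff_mul (α : M) (f : M →ₗ[ℤ] ℤ) (u v : LatticeSym R M) :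
    divDiff R α f (u * v) =
      divDiff R α f u * v + map R (LinearMap.id - f.smulRight α) u * divDiff R α f v := by
  have h : Polynomial.C (u * v) - shift R f (u * v) = Polynomial.X *
      ((Polynomial.C u - shift R f u).divX * Polynomial.C v +
        shift R f u * (Polynomial.C v - shift R f v).divX) := by
    rw [mul_add, ← mul_assoc, ← C_sub_shift, mul_left_comm, ← C_sub_shift, map_mul, map_mul]
    ring
  rw [divDiff_apply, divX_eq_of_eq h, Polynomial.eval_add, Polynomial.eval_mul,
    Polynomial.eval_mul, Polynomial.eval_C, eval_shift]
  rfl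

section reflection

variable {α : M} {f : M →ₗ[ℤ] ℤ} (hf : f α = 2)

include hf

lemma map_map_refl (u : LatticeSym R M) :
    map R (LinearMap.id - f.smulRight α) (map R (LinearMap.id - f.smulRight α) u) = u := by
  have : (map R (LinearMap.id - f.smulRight α)).comp (map R (LinearMap.id - f.smulRight α)) =
      AlgHom.id R _ := hom_ext fun l ↦ by
    rw [AlgHom.comp_apply, map_of, map_of, AlgHom.id_apply]
    congr 1
    simp [hf]
    module
  exact DFunLike.congr_fun this u

/-- Expanding the product of u with a linear form by Leibniz in both orders and comparing replaces
the usual argument of dividing by α. The next lemma works in the same way. -/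
lemma map_divDiff (u : LatticeSym R M) :
    map R (LinearMap.id - f.smulRight α) (divDiff R α f u) = divDiff R α f u := by
  induction u using induction_of_mul with
  | one => simp [divDiff_one]
  | smul r u hu => simp only [map_smul, hu]
  | add u v hu hv => simp only [map_add, hu, hv]
  | mul l u hu =>
    nth_rw 1 [divDiff_mul]
    rw [map_add, map_mul, map_mul, map_map_refl hf, hu, divDiff_of, map_intCast, mul_comm (of R l) u,
      divDiff_mul, divDiff_of]
    ring

lemma divDiff_map (u : LatticeSym R M) :
    divDiff R α f (map R (LinearMap.id - f.smulRight α) u) = -divDiff R α f u := by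
  induction u using induction_of_mul with
  | one => simp [divDiff_one]
  | smul r u hu => simp only [map_smul, hu, smul_neg]
  | add u v hu hv => simp only [map_add, hu, hv, neg_add]
  | mul l u hu =>
    rw [map_mul, divDiff_mul, hu, map_map_refl hf, map_of, divDiff_of, mul_comm (of R l) u,
      divDiff_mul, divDiff_of]
    simp [hf]
    ring

lemma divDiff_divDiff (u : LatticeSym R M) : divDiff R α f (divDiff R α f u) = 0 := by
  induction u using induction_of_mul with
  | one => simp [divDiff_one]
  | smul r u hu => simp only [map_smul, hu, smul_zero]
  | add u v hu hv => simp only [map_add, hu, hv, add_zero]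
  | mul l u hu =>
    rw [divDiff_mul, map_add, divDiff_mul, divDiff_mul, divDiff_map hf, hu, map_divDiff hf]
    have : divDiff R α f (divDiff R α f (of R l)) = 0 := by
      rw [divDiff_of, ← zsmul_one, map_zsmul, divDiff_one, smul_zero]
    rw [this]
    ring

end reflection

end LatticeSym

/-! ### Additive operators along words, and their independence of the reduced word. -/

namespace RootPairing.Base

variable {ι M N : Type*} [AddCommGroup M] [AddCommGroup N] {P : RootPairing ι ℤ M N}
  (b : P.Base) {R : Type*} [CommRing R]

lemma symWord_nil : b.symWord R [] = 1 := rfl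

lemma symWord_cons (i : b.support) (I : List b.support) (u : LatticeSym R M) :
    b.symWord R (i :: I) u = LatticeSym.divDiff R (P.root i) (P.coroot' i) (b.symWord R I u) := by
  simp [symWord]

lemma symWord_one {I : List b.support} (hI : I ≠ []) : b.symWord R I 1 = 0 := by
  induction I with
  | nil => exact absurd rfl hI
  | cons i I ih =>
    rw [symWord_cons]
    by_cases h : I = []
    · rw [h, symWord_nil, Module.End.one_apply, LatticeSym.divDiff_one]
    · rw [ih h, map_zero]

lemma symWord_append (I J : List b.support) (u : LatticeSym R M) :
    b.symWord R (I ++ J) u = b.symWord R I (b.symWord R J u) := by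
  simp [symWord]

lemma divDiff_of_mul (i : ι) (l : M) (u : LatticeSym R M) :
    LatticeSym.divDiff R (P.root i) (P.coroot' i) (LatticeSym.of R l * u) =
      P.coroot' i l • u + LatticeSym.of R (weylGroup.ofIdx P i • l) *
        LatticeSym.divDiff R (P.root i) (P.coroot' i) u := by
  rw [LatticeSym.divDiff_mul, LatticeSym.divDiff_of, LatticeSym.map_of, zsmul_eq_mul]
  rfl

lemma coroot'_root_self (i : ι) : P.coroot' i (P.root i) = 2 := P.root_coroot_two i

/-- The list of all `(γ, K)` where `K` arises from the word `I` by omitting one letter and `γ` is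
the root with `wordProd K = wordProd I * s_γ`. -/
def deletions : List b.support → List (ι × List b.support)
  | [] => []
  | i :: I => ((b.wordProd I)⁻¹ • (i : ι), I) ::
      (deletions I).map fun x ↦ (x.1, i :: x.2)

lemma of_mem_deletions {I : List b.support} {x : ι × List b.support} (hx : x ∈ b.deletions I) :
    x.2.length + 1 = I.length ∧ b.wordProd x.2 = b.wordProd I * weylGroup.ofIdx P x.1 := by
  induction I generalizing x with
  | nil => simp [deletions] at hx
  | cons i I ih =>
    simp only [deletions, List.mem_cons, List.mem_map] at hx
    obtain rfl | ⟨y, hy, rfl⟩ := hx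
    · refine ⟨rfl, ?_⟩
      rw [wordProd_cons, weylGroup.ofIdx_smul_left]
      simp [mul_assoc, ← mul_assoc (b.wordProd I), ← mul_assoc (weylGroup.ofIdx P (i : ι)), weylGroup.ofIdx_mul_self]
    · obtain ⟨h1, h2⟩ := ih hy
      exact ⟨by simp [h1], by rw [wordProd_cons, wordProd_cons, h2, mul_assoc]⟩

/-- Iterated Leibniz rule: either every letter passes by the linear form and moves it by its
reflection, or exactly one letter hits it, turns it into an integer and disappears from the word. -/
lemma symWord_of_mul (I : List b.support) (l : M) (u : LatticeSym R M) :
    b.symWord R I (LatticeSym.of R l * u) =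
      LatticeSym.of R (b.wordProd I • l) * b.symWord R I u +
        ((b.deletions I).map fun x ↦ P.coroot' x.1 l • b.symWord R x.2 u).sum := by
  induction I with
  | nil => simp [deletions, symWord_nil]
  | cons i I ih =>
    rw [symWord_cons, ih, map_add, divDiff_of_mul, deletions, List.map_cons, List.sum_cons,
      List.map_map, symWord_cons, wordProd_cons, mul_smul, map_list_sum, List.map_map]
    have h1 : P.coroot' ((b.wordProd I)⁻¹ • (i : ι)) l = P.coroot' i (b.wordProd I • l) := by
      rw [← weylGroup.coroot'_smul (b.wordProd I), smul_inv_smul]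
    have h2 : (⇑(LatticeSym.divDiff R (P.root i) (P.coroot' i)) ∘
        fun x : ι × List b.support ↦ P.coroot' x.1 l • b.symWord R x.2 u) =
        ((fun x : ι × List b.support ↦ P.coroot' x.1 l • b.symWord R x.2 u) ∘
          fun x ↦ (x.1, i :: x.2)) := by
      ext x
      simp only [Function.comp_apply, map_zsmul, symWord_cons]
    rw [h1, h2]
    ring

variable [Finite ι] [P.IsReduced]

/-- For a reduced word the roots attached to the deletions are the inversions, each occurring once.
Hence they depend on the group element only. -/
lemma map_fst_deletions {I : List b.support} (hI : b.IsReducedWord I) :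
    (((b.deletions I).map Prod.fst : List ι) : Multiset ι) =
      (b.inversions (b.wordProd I)).val := by
  induction I with
  | nil => simp [deletions]
  | cons i I ih =>
    have h := (b.isReducedWord_cons_iff hI.of_cons).1 hI
    obtain ⟨h', e⟩ := b.inversions_ofIdx_mul _ i.2 h
    rw [wordProd_cons, e, Finset.cons_val, ← ih hI.of_cons]
    simp [deletions, Function.comp_def]

/-- Independence for shorter words is a hypothesis, so that this can be used inside the induction
which proves independence. Where reducedness first fails, the reduced tail is rewritten to start
with the offending letter, and Δ_i² = 0. -/
lemma symWord_eq_zero_aux {n : ℕ} (hn : ∀ I J : List b.support, I.length < n →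
      b.IsReducedWord I → b.IsReducedWord J → b.wordProd I = b.wordProd J →
        b.symWord R I = b.symWord R J) (I : List b.support) (hI : ¬ b.IsReducedWord I)
    (hl : I.length ≤ n) : b.symWord R I = 0 := by
  induction I with
  | nil => exact absurd (Nat.le_zero.1 (b.length_wordProd_le [])).symm hI
  | cons i I ih =>
    ext u
    rw [symWord_cons, LinearMap.zero_apply]
    rw [List.length_cons] at hl
    by_cases h : b.IsReducedWord I
    · obtain ⟨J, h1, h2, h3⟩ := b.exists_cons_of_not_isReducedWord h hI
      rw [hn I (i :: J) (by omega) h h1 h2.symm, symWord_cons,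
        LatticeSym.divDiff_divDiff (coroot'_root_self _)]
    · rw [ih h (by omega), LinearMap.zero_apply, map_zero]

/-- The composition of divided differences along a reduced word depends only on the product of
the word. -/
theorem symWord_eq_of_wordProd_eq {I J : List b.support} (hI : b.IsReducedWord I)
    (hJ : b.IsReducedWord J) (h : b.wordProd I = b.wordProd J) :
    b.symWord R I = b.symWord R J := by
  classical
  generalize hn : I.length = n
  induction n using Nat.strong_induction_on generalizing I J with
  | _ n ih =>
  have hJn : J.length = n := by rw [hJ, ← h, ← hI, hn]
  obtain _ | n := n
  · rw [List.length_eq_zero_iff] at hn hJn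
    rw [hn, hJn]
  -- By induction a word of length n gives an operator depending only on its product v. The default
  -- 0 is the right value when v has no reduced word of length n, since non-reduced words of length
  -- n give 0.
  let G (v : P.weylGroup) : Module.End R (LatticeSym R M) :=
    if h : ∃ K, b.IsReducedDecomposition K v ∧ K.length = n then b.symWord R h.choose else 0
  have hG (K : List b.support) (hK : K.length = n) : b.symWord R K = G (b.wordProd K) := by
    by_cases hK' : b.IsReducedWord K
    · have h' : ∃ K', b.IsReducedDecomposition K' (b.wordProd K) ∧ K'.length = n :=
        ⟨K, ⟨rfl, hK'⟩, hK⟩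
      simp only [G, dif_pos h']
      exact ih n (Nat.lt_succ_self n) hK' h'.choose_spec.1.isReducedWord
        h'.choose_spec.1.1.symm hK
    · rw [b.symWord_eq_zero_aux (n := n) (fun I J hI h1 h2 h3 ↦ ih _ (by omega) h1 h2 h3 rfl) K
        hK' hK.le]
      symm
      refine dif_neg ?_
      rintro ⟨K', h1, h2⟩
      exact hK' (by rw [IsReducedWord, hK, ← h1.2, h2])
  -- All terms except the operator itself are now expressed through the product of I. As nonempty
  -- words kill 1, this recursion determines the operator, with no use of braid relations.
  have key (I : List b.support) (hI : b.IsReducedWord I) (hn : I.length = n + 1) (l : M)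
      (u : LatticeSym R M) : b.symWord R I (LatticeSym.of R l * u) =
      LatticeSym.of R (b.wordProd I • l) * b.symWord R I u +
        ((b.inversions (b.wordProd I)).val.map fun γ ↦
          P.coroot' γ l • G (b.wordProd I * weylGroup.ofIdx P γ) u).sum := by
    rw [symWord_of_mul, ← b.map_fst_deletions hI, Multiset.map_coe, Multiset.sum_coe, List.map_map]
    congr 2
    refine List.map_congr_left fun x hx ↦ ?_
    obtain ⟨h1, h2⟩ := b.of_mem_deletions hx
    rw [hG _ (by omega), h2]
    rfl
  have one (I : List b.support) (hn : I.length = n + 1) : b.symWord R I 1 = 0 :=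
    b.symWord_one fun h ↦ by simp [h] at hn
  ext u
  induction u using LatticeSym.induction_of_mul with
  | one => rw [one I hn, one J hJn]
  | smul r u hu => rw [map_smul, map_smul, hu]
  | add u v hu hv => rw [map_add, map_add, hu, hv]
  | mul l u hu => rw [key I hI hn, key J hJ hJn, hu, h]

theorem symWord_eq_zero {I : List b.support} (hI : ¬ b.IsReducedWord I) :
    b.symWord R I = 0 :=
  b.symWord_eq_zero_aux (fun _ _ _ h1 h2 h3 ↦ b.symWord_eq_of_wordProd_eq h1 h2 h3) I hI le_rfl

end RootPairing.Base

/-! ### Homogeneous representatives and base change from ℤ. -/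

namespace LatticeSym

open TensorProduct

variable (R : Type*) {M : Type*} [CommRing R] [AddCommGroup M]

lemma range_ι_eq_span :
    LinearMap.range (SymmetricAlgebra.ι R (R ⊗[ℤ] M)) = Submodule.span R (Set.range (of R (M := M))) := by
  refine le_antisymm ?_ (Submodule.span_le.2 ?_)
  · rintro _ ⟨x, rfl⟩
    induction x using TensorProduct.induction_on with
    | zero => simp
    | tmul r l =>
      have : r ⊗ₜ[ℤ] l = r • ((1 : R) ⊗ₜ[ℤ] l) := by simp [TensorProduct.smul_tmul']
      rw [this, map_smul]
      exact Submodule.smul_mem _ _ (Submodule.subset_span ⟨l, rfl⟩)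
    | add x y hx hy =>
      rw [map_add]
      exact add_mem hx hy
  · rintro _ ⟨l, rfl⟩
    exact ⟨1 ⊗ₜ l, rfl⟩

/-- Connects the power of the degree-one submodule with the homogeneous polynomials in which
`IsLift` is formulated. -/
lemma graded_eq_map (n : ℕ) : graded R M n =
    (MvPolynomial.homogeneousSubmodule M R n).map
      (MvPolynomial.aeval (R := R) (of R (M := M))).toLinearMap := by
  rw [graded, range_ι_eq_span, ← MvPolynomial.homogeneousSubmodule_one_pow, Submodule.map_pow,
    MvPolynomial.homogeneousSubmodule_one_eq_span_X, Submodule.map_span, ← Set.range_comp]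
  congr 3
  ext l
  simp

lemma exists_isHomogeneous_of_mem_graded {n : ℕ} {a : LatticeSym R M} (ha : a ∈ graded R M n) :
    ∃ p : MvPolynomial M R, p.IsHomogeneous n ∧ MvPolynomial.aeval (of R) p = a := by
  rw [graded_eq_map] at ha
  exact ha

lemma aeval_mem_graded {n : ℕ} {p : MvPolynomial M R} (hp : p.IsHomogeneous n) :
    MvPolynomial.aeval (of R) p ∈ graded R M n := by
  rw [graded_eq_map]
  exact ⟨p, hp, rfl⟩

/-- The base change map `S_ℤ(M) → S_R(M)`. -/
def baseChange : LatticeSym ℤ M →ₐ[ℤ] LatticeSym R M := lift ℤ (of R)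

lemma baseChange_of (l : M) : baseChange R (of ℤ l) = of R l := lift_of ℤ _ l

lemma baseChange_divDiff (α : M) (f : M →ₗ[ℤ] ℤ) (u : LatticeSym ℤ M) :
    baseChange R (divDiff ℤ α f u) = divDiff R α f (baseChange R u) := by
  induction u using induction_of_mul with
  | one => simp [divDiff_one]
  | smul r u hu => simp only [map_smul, hu, map_zsmul]
  | add u v hu hv => simp only [map_add, hu, hv]
  | mul l u hu =>
    rw [divDiff_mul, map_mul, divDiff_mul, divDiff_of, baseChange_of, divDiff_of, map_add, map_mul,
      map_mul, hu, map_of, map_of, baseChange_of, map_intCast]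

lemma baseChange_mem_graded {n : ℕ} {a : LatticeSym ℤ M} (ha : a ∈ graded ℤ M n) :
    baseChange R a ∈ graded R M n := by
  obtain ⟨p, hp, rfl⟩ := exists_isHomogeneous_of_mem_graded ℤ ha
  have : baseChange R (MvPolynomial.aeval (of ℤ) p) =
      MvPolynomial.aeval (of R) (MvPolynomial.map (algebraMap ℤ R) p) := by
    have h : (baseChange R).toRingHom.comp (MvPolynomial.aeval (of ℤ)).toRingHom =
        ((MvPolynomial.aeval (of R)).toRingHom.comp
          (MvPolynomial.map (algebraMap ℤ R) : MvPolynomial M ℤ →+* MvPolynomial M R)) := by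
      refine MvPolynomial.ringHom_ext (fun z ↦ ?_) fun l ↦ ?_
      · simp
      · simp [baseChange_of]
    exact DFunLike.congr_fun h p
  rw [this]
  exact aeval_mem_graded R (hp.map _)

end LatticeSym

/-! ### The torsion index as a value of the top operator over R. -/

namespace RootPairing.Base

variable {ι M N : Type*} [AddCommGroup M] [AddCommGroup N] {P : RootPairing ι ℤ M N}
  (b : P.Base) (R : Type*) [CommRing R]

lemma baseChange_symWord (I : List b.support) (u : LatticeSym ℤ M) :
    LatticeSym.baseChange R (b.symWord ℤ I u) = b.symWord R I (LatticeSym.baseChange R u) := by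
  induction I with
  | nil => rfl
  | cons i I ih => rw [symWord_cons, symWord_cons, LatticeSym.baseChange_divDiff, ih]

variable [Finite ι] [P.IsReduced]

/-- The torsion index generates the ideal spanned by all values, so it must be shown to be a value
itself. For fixed w₀ and word the values already form an ideal; uniqueness of the longest element
and independence of the word show that it contains the values for all other choices. -/
lemma exists_symWord_eq_torsionIndex {w₀ : P.weylGroup} (h₀ : b.IsLongest w₀)
    {I₀ : List b.support} (hI₀ : b.IsReducedDecomposition I₀ w₀) :
    ∃ a ∈ LatticeSym.graded R M (b.length w₀),
      b.symWord R I₀ a = algebraMap R _ (b.torsionIndex : R) := by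
  let J : Ideal ℤ := ((LatticeSym.graded ℤ M (b.length w₀)).map (b.symWord ℤ I₀)).comap
    (Algebra.linearMap ℤ (LatticeSym ℤ M))
  have hJ : (b.torsionIndex : ℤ) ∈ J := by
    have h := Submodule.IsPrincipal.generator_mem (Ideal.span {z : ℤ | ∃ (w₀ : P.weylGroup)
      (I : List b.support), b.IsLongest w₀ ∧ b.IsReducedDecomposition I w₀ ∧
        ∃ a ∈ LatticeSym.graded ℤ M (b.length w₀),
          b.symWord ℤ I a = algebraMap ℤ (LatticeSym ℤ M) z})
    refine J.mem_of_dvd (Int.dvd_natAbs.2 dvd_rfl) ((Ideal.span_le.2 ?_) h)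
    rintro z ⟨w₁, I₁, h₁, hI₁, a, ha, e⟩
    obtain rfl : w₁ = w₀ := h₀.eq_of_length_eq (le_antisymm (h₀ _) (h₁ _))
    refine ⟨a, ha, ?_⟩
    rw [b.symWord_eq_of_wordProd_eq hI₀.isReducedWord hI₁.isReducedWord (hI₀.1.trans hI₁.1.symm),
      e]
    rfl
  obtain ⟨a, ha, e⟩ := hJ
  refine ⟨_, LatticeSym.baseChange_mem_graded R ha, ?_⟩
  rw [← baseChange_symWord, e]
  simp

end RootPairing.Base

/-! ### Divided differences and the augmentation filtration -/

namespace FormalGroup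

open Topology

section

variable {R : Type*} [CommRing R] {B : Type*} [CommRing B] [Algebra R B] [UniformSpace B]
  [IsUniformAddGroup B] [IsTopologicalRing B] [CompleteSpace B] [T2Space B]
  [IsLinearTopology B B]

lemma evalPair_toPowerSeries (F : FormalGroup R) {a b : B} (ha : IsTopologicallyNilpotent a)
    (hb : IsTopologicallyNilpotent b) :
    evalPair F.toPowerSeries a b = a + b - a * b * evalPair F.gSeries a b := by
  rw [evalPair_eq _ ha hb, evalPair_eq _ ha hb, toPowerSeries_eq, map_sub, map_add, map_mul,
    map_mul, evalHom_X, evalHom_X]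
  rfl

end

namespace Ring

open scoped PowerSeries.WithPiTopology

variable {R : Type*} [CommRing R] {F : FormalGroup R} [F.IsComm] {M : Type*} [AddCommGroup M]

lemma divT_X_mul {A : Type*} [CommRing A] (g : PowerSeries A) : divT A (PowerSeries.X * g) = g := by
  ext n
  simp [divT, PowerSeries.coeff_succ_X_mul]

lemma X_mul_divT_sub_shift (f : M →+ ℤ) (u : F.Ring M) :
    PowerSeries.X * divT _ (PowerSeries.C u - shift F f u) = PowerSeries.C u - shift F f u :=
  X_mul_divT _ (by rw [map_sub, constantCoeff_shift, PowerSeries.constantCoeff_C, sub_self])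

lemma evalAt_C (l : M) (u : F.Ring M) : evalAt F l (PowerSeries.C u) = u :=
  (evalAt F l).commutes u

/-- The twisted Leibniz rule. -/
lemma divDiff_mul (α : M) (f : M →+ ℤ) (u v : F.Ring M) :
    divDiff F α f (u * v) = divDiff F α f u * v + map F (reflHom α f) u * divDiff F α f v := by
  have h : PowerSeries.C (u * v) - shift F f (u * v) = PowerSeries.X *
      (divT _ (PowerSeries.C u - shift F f u) * PowerSeries.C v +
        shift F f u * divT _ (PowerSeries.C v - shift F f v)) := by
    rw [mul_add, ← mul_assoc, X_mul_divT_sub_shift, mul_left_comm, X_mul_divT_sub_shift, map_mul,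
      map_mul]
    ring
  rw [divDiff_apply, h, divT_X_mul, map_add, map_mul, map_mul, evalAt_C, evalAt_shift]
  rfl

lemma continuous_aug : @Continuous _ _ _ ⊥ (aug F M) := by
  let _ : UniformSpace R := ⊥
  have : DiscreteUniformity R := ⟨rfl⟩
  have : IsUniformAddGroup R := inferInstance
  exact continuous_lift (B := R) _ _ _ _

lemma aug_comp_map {M' : Type*} [AddCommGroup M'] (f : M →+ M') (u : F.Ring M) :
    aug F M' (map F f u) = aug F M u := by
  let _ : UniformSpace R := ⊥
  have : DiscreteUniformity R := ⟨rfl⟩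
  have : IsUniformAddGroup R := inferInstance
  have h : (aug F M').comp (map F f) = aug F M :=
    hom_ext ((continuous_aug (F := F) (M := M')).comp (continuous_map f)) continuous_aug
      fun l ↦ by rw [AlgHom.comp_apply, map_x, aug_x, aug_x]
  exact DFunLike.congr_fun h u

lemma mem_augIdeal {u : F.Ring M} : u ∈ augIdeal F M ↔ aug F M u = 0 := Iff.rfl

lemma x_mem_augIdeal (l : M) : x F l ∈ augIdeal F M := aug_x l

/-- Modulo its constant term g is a multiple of t, and t is evaluated at x_l, which the augmentation
kills. -/
lemma aug_evalAt (l : M) (g : PowerSeries (F.Ring M)) :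
    aug F M (evalAt F l g) = aug F M (PowerSeries.constantCoeff g) := by
  have h : g = PowerSeries.C (PowerSeries.constantCoeff g) + PowerSeries.X *
      divT _ (g - PowerSeries.C (PowerSeries.constantCoeff g)) := by
    rw [X_mul_divT _ (by simp)]
    ring
  nth_rw 1 [h]
  rw [map_add, evalAt_C, map_mul, evalAt_X, map_add, map_mul, aug_x, zero_mul, _root_.add_zero]

/-- The variable `t` as a topologically nilpotent element. -/
def tNil (F : FormalGroup R) [F.IsComm] (M : Type*) [AddCommGroup M] :
    F.Nil (PowerSeries (F.Ring M)) := ⟨PowerSeries.X, PowerSeries.HasEval.X⟩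

lemma constantCoeff_zsmul_tNil (n : ℤ) :
    PowerSeries.constantCoeff (n • tNil F M).val = 0 := by
  have h : Nil.map F (constCoeff F M) continuous_constCoeff (n • tNil F M) = 0 := by
    have h : Nil.map F (constCoeff F M) continuous_constCoeff (tNil F M) = 0 :=
      Nil.ext (PowerSeries.constantCoeff_X (R := F.Ring M))
    rw [map_zsmul, h, smul_zero]
  exact congrArg Nil.val h

/-- As F(y, t) = y + t - y t g(y, t) and y is divisible by t, the correction term is divisible by
t². -/
lemma coeff_one_zsmul_tNil_add (n : ℤ) :
    PowerSeries.coeff 1 ((n • tNil F M + tNil F M).val) =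
      PowerSeries.coeff 1 (n • tNil F M).val + 1 := by
  rw [Nil.val_add, evalPair_toPowerSeries _ (Nil.property _) (Nil.property _), map_sub, map_add]
  have h := X_mul_divT _ (constantCoeff_zsmul_tNil (F := F) (M := M) n)
  have h1 : PowerSeries.coeff 1 (tNil F M).val = 1 := PowerSeries.coeff_one_X
  rw [h1]
  nth_rw 2 [← h]
  have h2 (g : PowerSeries (F.Ring M)) :
      PowerSeries.coeff 1 (PowerSeries.X * (PowerSeries.X * g)) = 0 := by
    rw [PowerSeries.coeff_succ_X_mul 0, PowerSeries.coeff_zero_X_mul]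
  rw [mul_assoc, mul_assoc, mul_left_comm (divT _ _)]
  exact (congrArg _ (h2 _)).trans (sub_zero _)

lemma coeff_one_zsmul_tNil (n : ℤ) : PowerSeries.coeff 1 (n • tNil F M).val = (n : F.Ring M) := by
  induction n using Int.induction_on with
  | zero =>
    rw [zero_zsmul]
    exact (map_zero (PowerSeries.coeff (R := F.Ring M) 1)).trans Int.cast_zero.symm
  | succ n ih => rw [add_zsmul, one_zsmul, coeff_one_zsmul_tNil_add, ih]; push_cast; ring
  | pred n ih =>
    have := coeff_one_zsmul_tNil_add (F := F) (M := M) (-n - 1)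
    rw [← add_one_zsmul, sub_add_cancel, ih] at this
    rw [eq_sub_of_add_eq this.symm]
    push_cast
    ring

/-- With y = (-f l) ·_F t, the shifted element is x_l + y - x_l y g(x_l, y). So (u - u')/t equals
-y/t plus a multiple of x_l; the augmentation sees only the constant term of -y/t, which is f l. -/
lemma aug_divDiff_x (α : M) (f : M →+ ℤ) (l : M) :
    aug F M (divDiff F α f (x F l)) = (f l : R) := by
  let y := (-f l) • tNil F M
  have hy : shift F f (x F l) = PowerSeries.C (x F l) + y.val - PowerSeries.C (x F l) * y.val *
      evalPair F.gSeries (PowerSeries.C (x F l)) y.val := by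
    have h : shiftHom F f l = Nil.map F (const F M) continuous_constHom (xHom F M l) + y := by
      simp only [y, neg_zsmul, shiftHom, sub_eq_add_neg]
      rfl
    rw [shift_x, h, Nil.val_add, evalPair_toPowerSeries _ (Nil.property _) (Nil.property _)]
    rfl
  have hy0 := X_mul_divT _ (constantCoeff_zsmul_tNil (F := F) (M := M) (-f l))
  have h2 : PowerSeries.C (x F l) - shift F f (x F l) = PowerSeries.X *
      (-divT _ y.val + PowerSeries.C (x F l) * (divT _ y.val *
        evalPair F.gSeries (PowerSeries.C (x F l)) y.val)) := by
    rw [hy, mul_add, mul_left_comm, ← mul_assoc PowerSeries.X, mul_neg, hy0]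
    ring
  rw [divDiff_apply, h2, divT_X_mul, map_add, map_add, map_mul, evalAt_C, map_mul, aug_x, zero_mul,
    _root_.add_zero, map_neg, map_neg, aug_evalAt]
  have h3 : PowerSeries.constantCoeff (divT _ y.val) = PowerSeries.coeff 1 y.val := by
    rw [← PowerSeries.coeff_zero_eq_constantCoeff_apply]
    simp [divT]
  rw [h3, coeff_one_zsmul_tNil]
  simp

lemma map_mem_augIdeal {M' : Type*} [AddCommGroup M'] (g : M →+ M') {u : F.Ring M}
    (hu : u ∈ augIdeal F M) : map F g u ∈ augIdeal F M' := by
  rwa [mem_augIdeal, aug_comp_map]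

lemma divDiff_mem_augIdeal_pow (α : M) (f : M →+ ℤ) {n : ℕ} {u : F.Ring M}
    (hu : u ∈ augIdeal F M ^ (n + 1)) : divDiff F α f u ∈ augIdeal F M ^ n := by
  induction n generalizing u with
  | zero => simp
  | succ n ih =>
    rw [pow_succ'] at hu
    refine Submodule.mul_induction_on hu (C := fun u ↦ divDiff F α f u ∈ augIdeal F M ^ (n + 1)) (fun v hv w hw ↦ ?_)
      (fun v w hv hw ↦ ?_)
    · rw [divDiff_mul]
      have h1 := Ideal.mul_mem_mul (map_mem_augIdeal (reflHom α f) hv) (ih hw)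
      rw [← pow_succ'] at h1
      exact Ideal.add_mem _ (Ideal.mul_mem_left _ _ hw) h1
    · rw [map_add]
      exact Ideal.add_mem _ hv hw

end Ring

open FormalGroup.Ring

variable {R : Type*} [CommRing R] {F : FormalGroup R} [F.IsComm] {M : Type*} [AddCommGroup M]

lemma aeval_x_mem {n : ℕ} {p : MvPolynomial M R} (hp : p.IsHomogeneous n) :
    MvPolynomial.aeval (x F) p ∈ augIdeal F M ^ n := by
  rw [p.as_sum, map_sum]
  refine Ideal.sum_mem _ fun d hd ↦ ?_
  rw [MvPolynomial.aeval_monomial]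
  refine Ideal.mul_mem_left _ _ ?_
  have hd' : ∑ l ∈ d.support, d l = n := by
    have := hp.degree_eq_sum_deg_support hd
    exact this.symm
  rw [← hd', ← Finset.prod_pow_eq_pow_sum]
  exact Ideal.prod_mem_prod fun l _ ↦ Ideal.pow_mem_pow (x_mem_augIdeal l) _

/-! ### Leading forms for the augmentation filtration. -/

namespace IsLift

lemma of_aeval {n : ℕ} {p : MvPolynomial M R} (hp : p.IsHomogeneous n) :
    F.IsLift n (MvPolynomial.aeval (LatticeSym.of R) p) (MvPolynomial.aeval (x F) p) :=
  ⟨p, hp, rfl, by simp⟩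

lemma of_mem {n : ℕ} {u : F.Ring M} (hu : u ∈ augIdeal F M ^ (n + 1)) : F.IsLift n 0 u :=
  ⟨0, MvPolynomial.isHomogeneous_zero _ _ _, map_zero _, by simpa⟩

lemma mem_pow {n : ℕ} {a : LatticeSym R M} {u : F.Ring M} (h : F.IsLift n a u) :
    u ∈ augIdeal F M ^ n := by
  obtain ⟨p, hp, -, hu⟩ := h
  have := add_mem (Ideal.pow_le_pow_right (Nat.le_succ n) hu) (aeval_x_mem (F := F) hp)
  simpa using this

lemma add {n : ℕ} {a a' : LatticeSym R M} {u u' : F.Ring M} (h : F.IsLift n a u)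
    (h' : F.IsLift n a' u') : F.IsLift n (a + a') (u + u') := by
  obtain ⟨p, hp, rfl, hu⟩ := h
  obtain ⟨p', hp', rfl, hu'⟩ := h'
  refine ⟨p + p', hp.add hp', map_add _ _ _, ?_⟩
  rw [map_add, add_sub_add_comm]
  exact add_mem hu hu'

lemma neg {n : ℕ} {a : LatticeSym R M} {u : F.Ring M} (h : F.IsLift n a u) :
    F.IsLift n (-a) (-u) := by
  obtain ⟨p, hp, rfl, hu⟩ := h
  refine ⟨-p, hp.neg, map_neg _ _, ?_⟩
  rw [map_neg, ← neg_sub', ]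
  exact neg_mem hu

lemma smul {n : ℕ} {a : LatticeSym R M} {u : F.Ring M} (h : F.IsLift n a u) (r : R) :
    F.IsLift n (r • a) (r • u) := by
  obtain ⟨p, hp, rfl, hu⟩ := h
  refine ⟨r • p, (MvPolynomial.homogeneousSubmodule M R n).smul_mem r hp, map_smul _ _ _, ?_⟩
  rw [map_smul, ← smul_sub, Algebra.smul_def]
  exact Ideal.mul_mem_left _ _ hu

lemma mul {m n : ℕ} {a a' : LatticeSym R M} {u u' : F.Ring M} (h : F.IsLift m a u)
    (h' : F.IsLift n a' u') : F.IsLift (m + n) (a * a') (u * u') := by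
  have hm := h.mem_pow
  obtain ⟨p, hp, rfl, hu⟩ := h
  obtain ⟨p', hp', rfl, hu'⟩ := h'
  refine ⟨p * p', hp.mul hp', map_mul _ _ _, ?_⟩
  have e : u * u' - MvPolynomial.aeval (x F) (p * p') =
      u * (u' - MvPolynomial.aeval (x F) p') +
        (u - MvPolynomial.aeval (x F) p) * MvPolynomial.aeval (x F) p' := by
    rw [map_mul]
    ring
  rw [e]
  refine add_mem ?_ ?_
  · rw [add_assoc, pow_add]
    exact Ideal.mul_mem_mul hm hu'
  · rw [add_right_comm, pow_add]
    exact Ideal.mul_mem_mul hu (aeval_x_mem hp')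

lemma of_x (l : M) : F.IsLift 1 (LatticeSym.of R l) (x F l) := by
  simpa using of_aeval (F := F) (MvPolynomial.isHomogeneous_X R l)

lemma of_aug (u : F.Ring M) (r : R) (h : aug F M u = r) :
    F.IsLift 0 (algebraMap R _ r) u := by
  refine ⟨MvPolynomial.C r, MvPolynomial.isHomogeneous_C _ _, MvPolynomial.aeval_C _ _, ?_⟩
  rw [_root_.zero_add, pow_one, MvPolynomial.aeval_C, mem_augIdeal, map_sub, h, AlgHom.commutes]
  exact sub_self r

lemma aug_eq_zero {n : ℕ} {a : LatticeSym R M} {u : F.Ring M} (h : F.IsLift (n + 1) a u) :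
    aug F M u = 0 :=
  Ideal.pow_le_self (Nat.succ_ne_zero n) h.mem_pow

/-- This is the only place where a leading form must determine the element, and it follows from R
embedding into its symmetric algebra. In higher degrees the argument only uses that a representing
polynomial exists, so the full isomorphism with the associated graded ring is not needed. -/
lemma aug_eq {r : R} {u : F.Ring M} (h : F.IsLift 0 (algebraMap R _ r) u) : aug F M u = r := by
  obtain ⟨p, hp, h1, h2⟩ := h
  rw [← MvPolynomial.totalDegree_zero_iff_isHomogeneous, MvPolynomial.totalDegree_eq_zero_iff_eq_C]
    at hp
  rw [hp, MvPolynomial.aeval_C, SymmetricAlgebra.algebraMap_inj] at h1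
  rw [hp, MvPolynomial.aeval_C, h1, _root_.zero_add, pow_one, mem_augIdeal, map_sub, AlgHom.commutes,
    sub_eq_zero] at h2
  exact h2

/-- Induction on the degree, splitting off a linear factor. The two Leibniz rules match term by
term, and the base case is Δ_α(x_l) ≡ ⟨l, α^∨⟩ modulo the augmentation ideal. -/
lemma divDiff_aeval (α : M) (f : M →ₗ[ℤ] ℤ) {n : ℕ} {p : MvPolynomial M R}
    (hp : p.IsHomogeneous (n + 1)) :
    F.IsLift n (LatticeSym.divDiff R α f (MvPolynomial.aeval (LatticeSym.of R) p))
      (divDiff F α f.toAddMonoidHom (MvPolynomial.aeval (x F) p)) := by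
  induction n generalizing p with
  | zero =>
    have hp' : p ∈ MvPolynomial.homogeneousSubmodule M R 1 := hp
    rw [MvPolynomial.homogeneousSubmodule_one_eq_span_X] at hp'
    clear hp
    rename' hp' => hp
    induction hp using Submodule.span_induction with
    | mem p hp =>
      obtain ⟨l, rfl⟩ := hp
      rw [MvPolynomial.aeval_X, MvPolynomial.aeval_X, LatticeSym.divDiff_of]
      convert! of_aug (F := F) (divDiff F α f.toAddMonoidHom (x F l)) (f l : R)
        (aug_divDiff_x _ _ _) using 1
    | zero => simpa using of_mem (zero_mem _)
    | add p q _ _ hp hq => simpa only [map_add] using hp.add hq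
    | smul r p _ hp => simpa only [map_smul] using hp.smul r
  | succ n ih =>
    have hp : p ∈ MvPolynomial.homogeneousSubmodule M R (n + 2) := hp
    rw [← MvPolynomial.homogeneousSubmodule_one_pow, pow_succ',
      MvPolynomial.homogeneousSubmodule_one_pow] at hp
    refine Submodule.mul_induction_on hp (fun v hv w hw ↦ ?_) (fun v w hv hw ↦ ?_)
    · rw [MvPolynomial.homogeneousSubmodule_one_eq_span_X] at hv
      induction hv using Submodule.span_induction with
      | mem p hp =>
        obtain ⟨l, rfl⟩ := hp
        rw [map_mul (MvPolynomial.aeval _), map_mul (MvPolynomial.aeval _), MvPolynomial.aeval_X,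
          MvPolynomial.aeval_X, LatticeSym.divDiff_mul,
          divDiff_mul, LatticeSym.divDiff_of, LatticeSym.map_of, map_x]
        refine add ?_ ?_
        · have h := of_aug (F := F) (divDiff F α f.toAddMonoidHom (x F l)) (f l : R)
            (aug_divDiff_x _ _ _)
          rw [map_intCast] at h
          simpa using h.mul (of_aeval (F := F) hw)
        · rw [add_comm n 1]
          exact (of_x _).mul (ih hw)
      | zero => simpa using of_mem (zero_mem _)
      | add p q _ _ hp hq => simpa only [map_add, add_mul] using hp.add hq
      | smul r p _ hp => simpa only [map_smul, Algebra.smul_mul_assoc] using hp.smul r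
    · simpa only [map_add] using hv.add hw

/-- On associated graded rings, the operator `Δ_α` induces the additive operator. -/
theorem divDiff (α : M) (f : M →ₗ[ℤ] ℤ) {n : ℕ} {a : LatticeSym R M} {u : F.Ring M}
    (h : F.IsLift (n + 1) a u) :
    F.IsLift n (LatticeSym.divDiff R α f a) (Ring.divDiff F α f.toAddMonoidHom u) := by
  obtain ⟨p, hp, rfl, hu⟩ := h
  have h1 := divDiff_aeval (F := F) α f hp
  have h2 := of_mem (F := F) (divDiff_mem_augIdeal_pow α f.toAddMonoidHom hu)
  have := h1.add h2
  rwa [_root_.add_zero, map_sub, add_sub_cancel] at this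

end IsLift

section words

variable {ι N : Type*} [AddCommGroup N] {P : RootPairing ι ℤ M N} (b : P.Base)

lemma DelWord_cons (i : b.support) (I : List b.support) (u : F.Ring M) :
    F.DelWord b (i :: I) u = F.Del P i (F.DelWord b I u) := by simp [DelWord]

lemma CWord_cons (i : b.support) (I : List b.support) (u : F.Ring M) :
    F.CWord b (i :: I) u = F.C P i (F.CWord b I u) := by simp [CWord]

/-- The summand u e_α stays in filtration n + 1, so it contributes nothing to the leading form in
degree n. -/
lemma IsLift.C (i : ι) {n : ℕ} {a : LatticeSym R M} {u : F.Ring M} (h : F.IsLift (n + 1) a u) :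
    F.IsLift n (-LatticeSym.divDiff R (P.root i) (P.coroot' i) a) (F.C P i u) := by
  have h1 := IsLift.of_mem (F := F) (n := n) (Ideal.mul_mem_right (F.e (P.root i)) _ h.mem_pow)
  have := h1.add (h.divDiff (P.root i) (P.coroot' i)).neg
  rw [_root_.zero_add, ← sub_eq_add_neg] at this
  exact this

lemma IsLift.delWord (I : List b.support) {n : ℕ} {a : LatticeSym R M} {u : F.Ring M}
    (h : F.IsLift (n + I.length) a u) : F.IsLift n (b.symWord R I a) (F.DelWord b I u) := by
  induction I generalizing n with
  | nil => exact h
  | cons i I ih =>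
    rw [RootPairing.Base.symWord_cons, DelWord_cons]
    exact (ih (n := n + 1) (by convert h using 1; simp; ring)).divDiff _ _

lemma IsLift.cWord (I : List b.support) {n : ℕ} {a : LatticeSym R M} {u : F.Ring M}
    (h : F.IsLift (n + I.length) a u) :
    F.IsLift n ((-1 : R) ^ I.length • b.symWord R I a) (F.CWord b I u) := by
  induction I generalizing n with
  | nil => simpa [RootPairing.Base.symWord_nil, CWord] using h
  | cons i I ih =>
    rw [RootPairing.Base.symWord_cons, CWord_cons]
    have := (ih (n := n + 1) (by convert h using 1; simp; ring)).C (P := P) i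
    rwa [map_smul, ← neg_one_smul R, smul_smul, ← pow_succ'] at this

end words

end FormalGroup

/-! ### Functoriality in the lattice and coordinates -/

namespace FormalGroup.Ring

open Topology

section functoriality

open scoped PowerSeries.WithPiTopology

variable {R : Type*} [CommRing R] {F : FormalGroup R} [F.IsComm] {M M' M'' : Type*}
  [AddCommGroup M] [AddCommGroup M'] [AddCommGroup M'']

lemma map_map (f : M →+ M') (g : M' →+ M'') (u : F.Ring M) :
    map F g (map F f u) = map F (g.comp f) u := by
  have hf : Continuous (map F f) := continuous_map f
  have hg : Continuous (map F g) := continuous_map g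
  have h : (map F g).comp (map F f) = map F (g.comp f) :=
    hom_ext (hg.comp hf) (continuous_map _) fun l ↦ by
      rw [AlgHom.comp_apply, map_x f l, map_x g (f l), map_x (g.comp f) l]
      rfl
  exact DFunLike.congr_fun h u

lemma map_id (u : F.Ring M) : map F (AddMonoidHom.id M) u = u := by
  have h : map F (AddMonoidHom.id M) = AlgHom.id R (F.Ring M) :=
    hom_ext (continuous_map _) continuous_id fun l ↦ map_x _ l
  exact DFunLike.congr_fun h u

/-- The coefficientwise action of `map F p` on power series. -/
def mapSeries (F : FormalGroup R) [F.IsComm] (p : M →+ M') :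
    PowerSeries (F.Ring M) →ₐ[R] PowerSeries (F.Ring M') :=
  PowerSeries.mapAlgHom (map F p)

lemma coeff_mapSeries (p : M →+ M') (n : ℕ) (g : PowerSeries (F.Ring M)) :
    PowerSeries.coeff n (mapSeries F p g) = map F p (PowerSeries.coeff n g) :=
  PowerSeries.coeff_map _ _ _

lemma continuous_mapSeries (p : M →+ M') : Continuous (mapSeries F p) :=
  continuous_pi fun d ↦ (continuous_map p).comp
    (MvPowerSeries.WithPiTopology.continuous_coeff (F.Ring M) d)

lemma mapSeries_X (p : M →+ M') : mapSeries F p PowerSeries.X = PowerSeries.X :=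
  PowerSeries.map_X _

lemma mapSeries_C (p : M →+ M') (u : F.Ring M) :
    mapSeries F p (PowerSeries.C u) = PowerSeries.C (map F p u) :=
  PowerSeries.map_C _ u

lemma mapSeries_shift (p : M →+ M') (f : M' →+ ℤ) (u : F.Ring M) :
    mapSeries F p (shift F (f.comp p) u) = shift F f (map F p u) := by
  have h : (mapSeries F p).comp (shift F (f.comp p)) = (shift F f).comp (map F p) := by
    have h1 : Continuous (mapSeries F p) := continuous_mapSeries p
    have h2 : Continuous (shift F (f.comp p)) := continuous_shift _
    have h3 : Continuous (shift F f) := continuous_shift f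
    have h4 : Continuous (map F p) := continuous_map p
    refine hom_ext (h1.comp h2) (h3.comp h4) fun l ↦ ?_
    rw [AlgHom.comp_apply, AlgHom.comp_apply, map_x p l, shift_x (f.comp p) l, shift_x f (p l)]
    have h1 : Nil.map F (mapSeries F p) (continuous_mapSeries p) (shiftHom F (f.comp p) l) =
        shiftHom F f (p l) := by
      have hX : Nil.map F (mapSeries F p) (continuous_mapSeries p)
          ⟨PowerSeries.X, PowerSeries.HasEval.X⟩ = ⟨PowerSeries.X, PowerSeries.HasEval.X⟩ :=
        Nil.ext (mapSeries_X p)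
      simp only [shiftHom, AddMonoidHom.sub_apply, AddMonoidHom.comp_apply, map_sub,
        zmultiplesHom_apply, map_zsmul, hX]
      congr 1
      exact Nil.ext ((mapSeries_C p _).trans (congrArg PowerSeries.C (map_x p l)))
    exact congrArg Nil.val h1
  exact DFunLike.congr_fun h u

lemma map_evalAt (p : M →+ M') (l : M) (g : PowerSeries (F.Ring M)) :
    map F p (evalAt F l g) = evalAt F (p l) (mapSeries F p g) := by
  have h1 := (PowerSeries.hasSum_aeval (R := F.Ring M) (tn_x (F := F) l) g).map (map F p)
    (continuous_map p)
  have h2 := PowerSeries.hasSum_aeval (R := F.Ring M') (tn_x (F := F) (p l)) (mapSeries F p g)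
  refine h1.unique ?_
  have e : (⇑(map F p) ∘ fun d ↦ PowerSeries.coeff d g • x F l ^ d) =
      fun d ↦ PowerSeries.coeff d (mapSeries F p g) • x F (p l) ^ d := by
    ext d
    rw [Function.comp_apply, smul_eq_mul, smul_eq_mul, map_mul, map_pow, map_x p l, coeff_mapSeries]
  rw [e]
  exact h2

/-- Naturality for lattice maps carrying root to root and pulling coroot back to coroot; it is
applied to the projection from the enlarged lattice. -/
lemma map_divDiff (p : M →+ M') (α : M) (f : M' →+ ℤ) (u : F.Ring M) :
    map F p (divDiff F α (f.comp p) u) = divDiff F (p α) f (map F p u) := by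
  rw [divDiff_apply, divDiff_apply, map_evalAt, ← mapSeries_C, ← mapSeries_shift, ← map_sub]
  congr 1

end functoriality

/-! ### Power series coordinates attached to a basis of the lattice. -/

section coordinates

open scoped MvPowerSeries.WithPiTopology

variable {R : Type*} [CommRing R] {F : FormalGroup R} [F.IsComm] {M : Type*} [AddCommGroup M]

lemma _root_.MvPowerSeries.le_order_of_mem_ker_pow {κ : Type*} {n : ℕ} {f : MvPowerSeries κ R}
    (hf : f ∈ RingHom.ker (MvPowerSeries.constantCoeff (σ := κ) (R := R)) ^ n) :
    (n : ℕ∞) ≤ f.order := by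
  induction n generalizing f with
  | zero => simp
  | succ n ih =>
    rw [pow_succ'] at hf
    refine Submodule.mul_induction_on hf (fun g hg h hh ↦ ?_) fun g h hg hh ↦ ?_
    · have h1 : 1 ≤ g.order := MvPowerSeries.one_le_order_iff_constCoeff_eq_zero.2 hg
      refine le_trans ?_ MvPowerSeries.le_order_mul
      rw [Nat.cast_add, Nat.cast_one, add_comm]
      exact add_le_add h1 (ih hh)
    · exact (le_min hg hh).trans MvPowerSeries.min_order_le_add

lemma _root_.MvPowerSeries.ker_constantCoeff_pow_subset [TopologicalSpace R] [DiscreteTopology R]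
    {κ : Type*} (U : Set (MvPowerSeries κ R)) (hU : U ∈ 𝓝 0) :
    ∃ n, ((RingHom.ker (MvPowerSeries.constantCoeff (σ := κ) (R := R)) ^ n : Ideal _) :
      Set (MvPowerSeries κ R)) ⊆ U := by
  obtain ⟨⟨J, d⟩, hJ, hU⟩ :=
    (MvPowerSeries.LinearTopology.hasBasis_nhds_zero (σ := κ) (R := R)).mem_iff.1 hU
  refine ⟨d.degree + 1, fun f hf ↦ hU ?_⟩
  rw [SetLike.mem_coe, MvPowerSeries.LinearTopology.mem_basis_iff]
  intro e he
  rw [MvPowerSeries.coeff_of_lt_order]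
  · exact zero_mem _
  · refine lt_of_lt_of_le ?_ (MvPowerSeries.le_order_of_mem_ker_pow hf)
    have := Finsupp.degree_mono he
    exact_mod_cast Nat.lt_succ_of_le this

lemma _root_.MvPowerSeries.eq_zero_of_mul_X_eq_zero {κ : Type*} {k : κ} {f : MvPowerSeries κ R}
    (h : f * MvPowerSeries.X k = 0) : f = 0 := by
  ext d
  have := MvPowerSeries.coeff_add_mul_monomial d (Finsupp.single k 1) f (1 : R)
  rw [← MvPowerSeries.X, h] at this
  simpa using this.symm

/-- A basis of `M` yields coordinates on `R⟦M⟧_F`. -/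
theorem exists_coordinates {κ : Type*} [Finite κ] (β : Module.Basis κ ℤ M) :
    ∃ (φ : F.Ring M →ₐ[R] MvPowerSeries κ R) (ψ : MvPowerSeries κ R →ₐ[R] F.Ring M),
      (∀ u, ψ (φ u) = u) ∧ (∀ k, φ (x F (β k)) = MvPowerSeries.X k) ∧
        ∀ u, MvPowerSeries.constantCoeff (φ u) = aug F M u := by
  let _ : UniformSpace R := ⊥
  have : DiscreteUniformity R := ⟨rfl⟩
  have : IsUniformAddGroup R := inferInstance
  have : ContinuousSMul R (F.Ring M) := continuousSMul_of_discrete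
  let c : MvPowerSeries κ R →ₐ[R] R :=
    { MvPowerSeries.constantCoeff with commutes' := fun r ↦ MvPowerSeries.constantCoeff_C r }
  have hc : Continuous c := MvPowerSeries.WithPiTopology.continuous_constantCoeff R
  have hX (k : κ) : IsTopologicallyNilpotent (MvPowerSeries.X k : MvPowerSeries κ R) :=
    MvPowerSeries.WithPiTopology.isTopologicallyNilpotent_of_constantCoeff_zero (by simp)
  -- M is free, so a homomorphism to the formal group of topologically nilpotent series may be
  -- prescribed on the basis; it induces φ, while ψ substitutes x_{β k} for the variables.
  let f : M →ₗ[ℤ] F.Nil (MvPowerSeries κ R) := β.constr ℤ fun k ↦ ⟨MvPowerSeries.X k, hX k⟩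
  have hf (k : κ) : f (β k) = ⟨MvPowerSeries.X k, hX k⟩ := β.constr_basis ℤ _ k
  have hK (l : M) : (f l).val ∈
      RingHom.ker (MvPowerSeries.constantCoeff (σ := κ) (R := R)) := by
    have h : (Nil.map F c hc).toIntLinearMap ∘ₗ f = 0 := β.ext fun k ↦ by
      rw [LinearMap.comp_apply, hf]
      exact Nil.ext (MvPowerSeries.constantCoeff_X k)
    exact congrArg Nil.val (DFunLike.congr_fun h l)
  have hβ : MvPowerSeries.HasEval fun k ↦ x F (β k) := ⟨fun k ↦ tn_x (β k), by simp⟩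
  let φ : F.Ring M →ₐ[R] MvPowerSeries κ R := lift f.toAddMonoidHom _ hK
    MvPowerSeries.ker_constantCoeff_pow_subset
  have hφ : Continuous φ := continuous_lift _ _ _ _
  have hφx (l : M) : φ (x F l) = (f l).val := lift_x _ _ _ _ l
  let ψ : MvPowerSeries κ R →ₐ[R] F.Ring M := MvPowerSeries.aeval (R := R) hβ
  have hψ : Continuous ψ := MvPowerSeries.continuous_aeval (R := R) hβ
  have hψX (k : κ) : ψ (MvPowerSeries.X k) = x F (β k) := by
    simpa using MvPowerSeries.aeval_coe (R := R) hβ (MvPolynomial.X k)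
  refine ⟨φ, ψ, fun u ↦ ?_, fun k ↦ by rw [hφx, hf], fun u ↦ ?_⟩
  -- Only this composite is computed: being a retract of the power series ring is enough to transfer
  -- regularity of the coordinates and the unit criterion.
  · have h : ψ.comp φ = AlgHom.id R _ := by
      refine hom_ext (hψ.comp hφ) continuous_id fun l ↦ ?_
      rw [AlgHom.comp_apply, hφx]
      have h : (Nil.map F ψ hψ).toIntLinearMap ∘ₗ f = (xHom F M).toIntLinearMap := β.ext fun k ↦ by
        rw [LinearMap.comp_apply, hf]
        exact Nil.ext (hψX k)
      exact congrArg Nil.val (DFunLike.congr_fun h l)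
    exact DFunLike.congr_fun h u
  · have h : c.comp φ = aug F M := by
      refine hom_ext (hc.comp hφ) continuous_aug fun l ↦ ?_
      rw [AlgHom.comp_apply, hφx, aug_x]
      exact hK l
    exact DFunLike.congr_fun h u

lemma eq_zero_of_mul_x_eq_zero {κ : Type*} [Finite κ] (β : Module.Basis κ ℤ M) (k : κ)
    {u : F.Ring M} (hu : u * x F (β k) = 0) : u = 0 := by
  obtain ⟨φ, ψ, h1, h2, -⟩ := exists_coordinates (R := R) (F := F) β
  have h3 : φ u * MvPowerSeries.X k = 0 := by
    rw [← h2 k, ← map_mul, hu, map_zero]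
  have h4 : φ u = 0 := MvPowerSeries.eq_zero_of_mul_X_eq_zero h3
  rw [← h1 u, h4, map_zero]

lemma isUnit_of_aug [Module.Free ℤ M] [Module.Finite ℤ M] {u : F.Ring M}
    (hu : IsUnit (aug F M u)) : IsUnit u := by
  obtain ⟨φ, ψ, h1, -, h3⟩ := exists_coordinates (R := R) (F := F) (Module.Free.chooseBasis ℤ M)
  rw [← h3, ← MvPowerSeries.isUnit_iff_constantCoeff] at hu
  rw [← h1 u]
  exact hu.map ψ

end coordinates

end FormalGroup.Ring

/-! ### Operators which expand in a group of automorphisms -/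

section expansion

variable {R S W : Type*} [CommRing R] [CommRing S] [Algebra R S] [Group W] [Fintype W]
  (ρ : W →* (S →ₐ[R] S))

/-- After multiplication by a regular element, `f` is an `S`-linear combination of the
automorphisms `ρ w`. -/
def ExpandsIn (f : S → S) : Prop :=
  ∃ s ∈ nonZeroDivisors S, s • f ∈ Submodule.span S (Set.range fun w ↦ (ρ w : S → S))

variable {ρ}

namespace ExpandsIn

lemma of_apply (w : W) : ExpandsIn ρ (ρ w) :=
  ⟨1, one_mem _, by rw [one_smul]; exact Submodule.subset_span ⟨w, rfl⟩⟩

lemma id : ExpandsIn ρ _root_.id := by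
  have h := of_apply (ρ := ρ) 1
  rwa [map_one] at h

lemma add {f g : S → S} (hf : ExpandsIn ρ f) (hg : ExpandsIn ρ g) : ExpandsIn ρ (f + g) := by
  obtain ⟨s, hs, hf⟩ := hf
  obtain ⟨t, ht, hg⟩ := hg
  refine ⟨s * t, mul_mem hs ht, ?_⟩
  have e : (s * t) • (f + g) = t • s • f + s • t • g := by
    rw [smul_add, smul_smul, smul_smul, mul_comm t s]
  rw [e]
  exact add_mem (Submodule.smul_mem _ _ hf) (Submodule.smul_mem _ _ hg)

lemma smul {f : S → S} (hf : ExpandsIn ρ f) (a : S) : ExpandsIn ρ (a • f) := by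
  obtain ⟨s, hs, hf⟩ := hf
  exact ⟨s, hs, by rw [smul_comm]; exact Submodule.smul_mem _ _ hf⟩

lemma of_smul {f : S → S} {s : S} (hs : s ∈ nonZeroDivisors S) (hf : ExpandsIn ρ (s • f)) :
    ExpandsIn ρ f := by
  obtain ⟨t, ht, hf⟩ := hf
  exact ⟨t * s, mul_mem ht hs, by rwa [mul_smul]⟩

lemma neg {f : S → S} (hf : ExpandsIn ρ f) : ExpandsIn ρ (-f) := by
  simpa using hf.smul (-1)

lemma sub {f g : S → S} (hf : ExpandsIn ρ f) (hg : ExpandsIn ρ g) : ExpandsIn ρ (f - g) := by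
  rw [sub_eq_add_neg]
  exact hf.add hg.neg

lemma sum {κ : Type*} (s : Finset κ) {f : κ → S → S} (hf : ∀ k ∈ s, ExpandsIn ρ (f k)) :
    ExpandsIn ρ (∑ k ∈ s, f k) := by
  refine Finset.sum_induction _ _ (fun _ _ ↦ add) ?_ hf
  simpa using (id (ρ := ρ)).smul 0

end ExpandsIn

lemma apply_mem_nonZeroDivisors (w : W) {s : S} (hs : s ∈ nonZeroDivisors S) :
    ρ w s ∈ nonZeroDivisors S := by
  have h1 (u : S) : ρ w (ρ w⁻¹ u) = u := by
    rw [← AlgHom.mul_apply, ← map_mul, mul_inv_cancel, map_one, AlgHom.one_apply]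
  have h2 (u : S) : ρ w⁻¹ (ρ w u) = u := by
    rw [← AlgHom.mul_apply, ← map_mul, inv_mul_cancel, map_one, AlgHom.one_apply]
  rw [mem_nonZeroDivisors_iff_right] at hs ⊢
  intro u hu
  have h3 := congrArg (ρ w⁻¹) hu
  rw [map_mul, h2, map_zero] at h3
  rw [← h1 u, hs _ h3, map_zero]

/-- Moving the denominator t of g past ρ w turns it into ρ w t. The product of these over the finite
group W is a common regular denominator. -/
lemma ExpandsIn.comp {f g : S → S} (hf : ExpandsIn ρ f) (hg : ExpandsIn ρ g) :
    ExpandsIn ρ (f ∘ g) := by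
  classical
  obtain ⟨s, hs, hf⟩ := hf
  obtain ⟨t, ht, hg⟩ := hg
  obtain ⟨q, hq⟩ := (Submodule.mem_span_range_iff_exists_fun S).1 hf
  refine ⟨s * ∏ w, ρ w t, mul_mem hs (prod_mem fun w _ ↦ apply_mem_nonZeroDivisors w ht), ?_⟩
  have e : (s * ∏ w, ρ w t) • (f ∘ g) =
      ∑ w, (q w * ∏ v ∈ Finset.univ.erase w, ρ v t) • (ρ w ∘ (t • g)) := by
    ext u
    have h := congrFun hq (g u)
    simp only [Pi.smul_apply, smul_eq_mul, Finset.sum_apply, Function.comp_apply, map_mul] at h ⊢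
    rw [mul_right_comm, ← h, Finset.sum_mul]
    refine Finset.sum_congr rfl fun w _ ↦ ?_
    rw [← Finset.mul_prod_erase _ _ (Finset.mem_univ w)]
    ring
  rw [e]
  refine Submodule.sum_mem _ fun w _ ↦ Submodule.smul_mem _ _ ?_
  -- What remains is that composition with ρ w is semilinear and permutes the spanning
  -- automorphisms, so it preserves their span.
  generalize t • g = g' at hg
  induction hg using Submodule.span_induction with
  | mem f hf =>
    obtain ⟨v, rfl⟩ := hf
    refine Submodule.subset_span ⟨w * v, ?_⟩
    simp only [map_mul]
    rfl
  | zero =>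
    have h0 : ρ w ∘ (0 : S → S) = 0 := by
      ext u
      simp
    rw [h0]
    exact zero_mem _
  | add f g _ _ hf hg =>
    convert! add_mem hf hg using 1
    ext u
    simp
  | smul a f _ hf =>
    convert! Submodule.smul_mem _ (ρ w a) hf using 1
    ext u
    simp

/-- If the operators `E w` admit a family of elements `u w` such that the matrix of all
`E v (u w)` is invertible, then every operator is an `S`-linear combination of them. -/
theorem ExpandsIn.exists_eq_sum [DecidableEq W] {E : W → S → S} (hE : ∀ w, ExpandsIn ρ (E w))
    {u : W → S} (hu : IsUnit (Matrix.of fun v w ↦ E v (u w)).det) {f : S → S}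
    (hf : ExpandsIn ρ f) : ∃ a : W → S, ∀ x, f x = ∑ v, a v * E v x := by
  choose s hs hsE using hE
  choose T hT using fun v ↦ (Submodule.mem_span_range_iff_exists_fun S).1 (hsE v)
  let A : Matrix W W S := Matrix.of fun v w ↦ ρ v (u w)
  let B : Matrix W W S := Matrix.of fun v w ↦ E v (u w)
  -- Clearing denominators gives diag(s) B = T A; the left side has regular determinant, hence so
  -- does A.
  have hA : A.det ∈ nonZeroDivisors S := by
    have h : Matrix.diagonal s * B = Matrix.of T * A := by
      ext v w
      rw [Matrix.diagonal_mul, Matrix.mul_apply]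
      have := congrFun (hT v) (u w)
      simp only [Finset.sum_apply, Pi.smul_apply, smul_eq_mul] at this
      exact this.symm
    have h' := congrArg Matrix.det h
    rw [Matrix.det_mul, Matrix.det_mul, Matrix.det_diagonal] at h'
    refine ((mul_mem_nonZeroDivisors (a := (Matrix.of T).det)).1 ?_).2
    rw [← h']
    exact mul_mem (prod_mem fun v _ ↦ hs v) hu.mem_nonZeroDivisors
  -- The only candidate, forced by the values of f at the u w. The difference f - Σ a_v E_v then
  -- vanishes at all u w; its expansion has coefficient vector q with q A = 0, so q = 0 because det
  -- A is regular.
  let a : W → S := Matrix.vecMul (fun w ↦ f (u w)) B⁻¹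
  have ha (w : W) : ∑ v, a v * E v (u w) = f (u w) := by
    have : Matrix.vecMul a B = fun w ↦ f (u w) := by
      rw [Matrix.vecMul_vecMul, Matrix.nonsing_inv_mul _ hu, Matrix.vecMul_one]
    exact congrFun this w
  have hd : ExpandsIn ρ (f - ∑ v, a v • E v) :=
    hf.sub (ExpandsIn.sum _ fun v _ ↦ ExpandsIn.smul ⟨s v, hs v, hsE v⟩ (a v))
  obtain ⟨t, ht, hd⟩ := hd
  obtain ⟨q, hq⟩ := (Submodule.mem_span_range_iff_exists_fun S).1 hd
  have hq0 : Matrix.vecMul q A = 0 := by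
    ext w
    have := congrFun hq (u w)
    simp only [Finset.sum_apply, Pi.smul_apply, smul_eq_mul, Pi.sub_apply, ha, sub_self,
      mul_zero] at this
    exact this
  have hq1 : q = 0 := by
    have h := congrArg (fun x ↦ Matrix.vecMul x A.adjugate) hq0
    simp only [Matrix.vecMul_vecMul, Matrix.mul_adjugate, Matrix.zero_vecMul, Matrix.vecMul_smul,
      Matrix.vecMul_one] at h
    ext v
    have h' : q v * A.det = 0 := by simpa [mul_comm] using congrFun h v
    exact (mem_nonZeroDivisors_iff_right.1 hA) _ h'
  refine ⟨a, fun x ↦ ?_⟩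
  have h := congrFun hq x
  simp only [hq1, Pi.zero_apply, zero_smul, Finset.sum_const_zero, Pi.smul_apply, smul_eq_mul,
    Pi.sub_apply, Finset.sum_apply] at h
  rw [← sub_eq_zero]
  exact (mem_nonZeroDivisors_iff_left.1 ht) _ h.symm

end expansion

/-! ### Enlarging the lattice so that roots become primitive -/

namespace RootPairing

variable {ι M N : Type*} [AddCommGroup M] [AddCommGroup N] (P : RootPairing ι ℤ M N)

/-- The lattice of all pairs in `M × M` whose difference lies in the root lattice. The Weyl group
acts on the first component. -/
def doubleLattice : Submodule ℤ (M × M) :=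
  (P.rootSpan ℤ).comap (LinearMap.fst ℤ M M - LinearMap.snd ℤ M M)

lemma mem_doubleLattice {m : M × M} : m ∈ P.doubleLattice ↔ m.1 - m.2 ∈ P.rootSpan ℤ := Iff.rfl

namespace doubleLattice

/-- The first projection. -/
def fst : P.doubleLattice →+ M := (LinearMap.fst ℤ M M ∘ₗ P.doubleLattice.subtype).toAddMonoidHom

/-- The diagonal embedding. -/
def diag : M →+ P.doubleLattice where
  toFun m := ⟨(m, m), by rw [mem_doubleLattice, sub_self]; exact zero_mem _⟩
  map_zero' := rfl
  map_add' _ _ := rfl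

lemma fst_comp_diag : (fst P).comp (diag P) = AddMonoidHom.id M := rfl

/-- The root `(α, 0)`. -/
def root (i : ι) : P.doubleLattice :=
  ⟨(P.root i, 0), by
    rw [mem_doubleLattice, sub_zero]
    exact Submodule.subset_span ⟨i, rfl⟩⟩

lemma smul_sub_mem_rootSpan (w : P.weylGroup) (m : M) : w • m - m ∈ P.rootSpan ℤ := by
  obtain ⟨w, hw⟩ := w
  induction hw using weylGroup.induction generalizing m with
  | mem i =>
    have h : (⟨_, P.reflection_mem_weylGroup i⟩ : P.weylGroup) • m - m =
        -(P.coroot' i m • P.root i) :=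
      (congrArg (· - m) (weylGroup.ofIdx_smul_eq i m)).trans (by simp)
    rw [h]
    exact neg_mem (Submodule.smul_mem _ _ (Submodule.subset_span ⟨i, rfl⟩))
  | one => 
    have h : (⟨1, one_mem _⟩ : P.weylGroup) • m = m := one_smul P.weylGroup m
    rw [h, sub_self]
    exact zero_mem _
  | mul g₁ g₂ h₁ h₂ ih₁ ih₂ =>
    rw [← Submonoid.mk_mul_mk _ _ _ h₁ h₂, mul_smul]
    have := add_mem (ih₁ ((⟨g₂, h₂⟩ : P.weylGroup) • m)) (ih₂ m)
    rwa [sub_add_sub_cancel] at this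

/-- The action of the Weyl group on the first component. -/
def act (w : P.weylGroup) : P.doubleLattice →+ P.doubleLattice where
  toFun m := ⟨(w • m.1.1, m.1.2), by
    have := add_mem (smul_sub_mem_rootSpan P w m.1.1) (P.mem_doubleLattice.1 m.2)
    rw [sub_add_sub_cancel] at this
    exact this⟩
  map_zero' := Subtype.ext (Prod.ext (smul_zero w) rfl)
  map_add' m n := Subtype.ext (Prod.ext (smul_add w m.1.1 n.1.1) rfl)

lemma act_one : act P 1 = AddMonoidHom.id _ := by
  ext m
  · exact one_smul P.weylGroup m.1.1
  · rfl

lemma act_mul (v w : P.weylGroup) : act P (v * w) = (act P v).comp (act P w) := by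
  ext m
  · exact mul_smul v w m.1.1
  · rfl

lemma act_root (w : P.weylGroup) (i : ι) : act P w (root P i) = root P (w • i) :=
  Subtype.ext (Prod.ext (weylGroup.root_smul w i).symm rfl)

/-- The coroots as linear forms. -/
def coroot (i : ι) : P.doubleLattice →+ ℤ := (P.coroot' i).toAddMonoidHom.comp (fst P)

lemma reflHom_root (i : ι) :
    FormalGroup.Ring.reflHom (root P i) (coroot P i) = act P (weylGroup.ofIdx P i) := by
  ext m
  · refine Eq.trans ?_ (weylGroup.ofIdx_smul_eq i m.1.1).symm
    change m.1.1 - (P.coroot' i m.1.1 • root P i).1.1 = _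
    simp [root]
  · change m.1.2 - (P.coroot' i m.1.1 • root P i).1.2 = m.1.2
    simp [root]

/-- The isomorphism `(κ, λ) ↦ (λ, κ - λ)`. -/
def equivProd : P.doubleLattice ≃ₗ[ℤ] M × P.rootSpan ℤ where
  toFun m := (m.1.2, ⟨m.1.1 - m.1.2, m.2⟩)
  invFun m := ⟨(m.1 + m.2.1, m.1), by
    rw [mem_doubleLattice, add_sub_cancel_left]
    exact m.2.2⟩
  map_add' m n := Prod.ext rfl (Subtype.ext (add_sub_add_comm _ _ _ _))
  map_smul' c m := Prod.ext rfl (Subtype.ext (smul_sub c _ _).symm)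
  left_inv m := Subtype.ext (Prod.ext (add_sub_cancel _ _) rfl)
  right_inv m := Prod.ext rfl (Subtype.ext (add_sub_cancel_left _ _))

variable {P} in
/-- A basis containing all simple roots. -/
def basis [Module.Free ℤ M] (b : P.Base) :
    Module.Basis (Module.Free.ChooseBasisIndex ℤ M ⊕ b.support) ℤ P.doubleLattice :=
  ((Module.Free.chooseBasis ℤ M).prod b.toWeightBasisInt).map (equivProd P).symm

lemma basis_inr [Module.Free ℤ M] (b : P.Base) (i : b.support) :
    basis b (Sum.inr i) = root P i := by
  rw [basis, Module.Basis.map_apply, LinearEquiv.symm_apply_eq]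
  refine Prod.ext ?_ (Subtype.ext ?_)
  · simp [equivProd, root]
  · simp [equivProd, root]

end doubleLattice

end RootPairing

/-! ### Lifting the operators to the enlarged lattice. -/

namespace FormalGroup

open FormalGroup.Ring RootPairing

variable {R : Type*} [CommRing R] (F : FormalGroup R) [F.IsComm]
  {ι M N : Type*} [AddCommGroup M] [AddCommGroup N] (P : RootPairing ι ℤ M N)

/-- The action of the Weyl group on the formal group ring of the enlarged lattice. -/
def doubleAct : P.weylGroup →* (F.Ring P.doubleLattice →ₐ[R] F.Ring P.doubleLattice) where
  toFun w := Ring.map F (doubleLattice.act P w)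
  map_one' := by
    ext u
    rw [doubleLattice.act_one]
    exact map_id u
  map_mul' v w := by
    ext u
    rw [doubleLattice.act_mul]
    exact (map_map _ _ u).symm

lemma doubleAct_apply (w : P.weylGroup) (u : F.Ring P.doubleLattice) :
    F.doubleAct P w u = Ring.map F (doubleLattice.act P w) u := rfl

/-- The operator `Δ_α` on the formal group ring of the enlarged lattice. -/
def doubleDel (i : ι) : Module.End R (F.Ring P.doubleLattice) :=
  divDiff F (doubleLattice.root P i) (doubleLattice.coroot P i)

lemma map_fst_doubleDel (i : ι) (u : F.Ring P.doubleLattice) :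
    Ring.map F (doubleLattice.fst P) (F.doubleDel P i u) =
      F.Del P i (Ring.map F (doubleLattice.fst P) u) :=
  map_divDiff _ _ _ u

lemma map_fst_surjective : Function.Surjective (Ring.map F (doubleLattice.fst P)) := fun u ↦
  ⟨Ring.map F (doubleLattice.diag P) u, by
    rw [map_map, doubleLattice.fst_comp_diag, map_id]⟩

variable [Finite ι] [P.IsReduced] [Module.Free ℤ M] [Module.Finite ℤ M]

variable {P} in
-- The vectors (α_i, 0) for simple roots belong to a basis, so their x is a coordinate. The
-- remaining roots follow by reflections, which act by automorphisms of the ring.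
lemma x_root_mem_nonZeroDivisors [Fintype P.weylGroup] (b : P.Base) (i : ι) :
    x F (doubleLattice.root P i) ∈ nonZeroDivisors (F.Ring P.doubleLattice) := by
  have key (i j : ι) (h : x F (doubleLattice.root P i) ∈ nonZeroDivisors (F.Ring P.doubleLattice)) :
      x F (doubleLattice.root P (P.reflectionPerm j i)) ∈
        nonZeroDivisors (F.Ring P.doubleLattice) := by
    have h' := apply_mem_nonZeroDivisors (ρ := F.doubleAct P) (weylGroup.ofIdx P j) h
    rwa [doubleAct_apply, map_x, doubleLattice.act_root] at h'
  induction i using b.induction_reflect with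
  | h₀ i ih => exact key i i ih
  | h₁ i hi =>
    rw [← doubleLattice.basis_inr P b ⟨i, hi⟩, mem_nonZeroDivisors_iff_right]
    intro u hu
    exact eq_zero_of_mul_x_eq_zero _ _ hu
  | h₂ i j ih hj => exact key i j ih

variable {P} in
-- The regular element x_α serves as denominator: x_α Δ_α = 1 - s_α.
lemma expandsIn_doubleDel [Fintype P.weylGroup] (b : P.Base) (i : ι) :
    ExpandsIn (F.doubleAct P) (F.doubleDel P i) := by
  refine ExpandsIn.of_smul (F.x_root_mem_nonZeroDivisors b i) ?_
  have e : x F (doubleLattice.root P i) • ⇑(F.doubleDel P i) =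
      (_root_.id : F.Ring P.doubleLattice → F.Ring P.doubleLattice) -
        ⇑(F.doubleAct P (weylGroup.ofIdx P i)) := by
    ext u
    rw [Pi.smul_apply, smul_eq_mul, Pi.sub_apply, doubleDel, x_mul_divDiff,
      doubleLattice.reflHom_root]
    rfl
  rw [e]
  exact ExpandsIn.id.sub (ExpandsIn.of_apply _)

variable {P} in
/-- Every operator in the algebra lifts to an operator for the enlarged lattice. -/
lemma exists_expandsIn_lift [Fintype P.weylGroup] (b : P.Base) {D : Module.End R (F.Ring M)}
    (hD : D ∈ F.operatorAlgebra P) :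
    ∃ D' : F.Ring P.doubleLattice → F.Ring P.doubleLattice, ExpandsIn (F.doubleAct P) D' ∧
      ∀ u, Ring.map F (doubleLattice.fst P) (D' u) = D (Ring.map F (doubleLattice.fst P) u) := by
  have mulLeft (a : F.Ring M) : ∃ D' : F.Ring P.doubleLattice → F.Ring P.doubleLattice,
      ExpandsIn (F.doubleAct P) D' ∧ ∀ u, Ring.map F (doubleLattice.fst P) (D' u) =
        a * Ring.map F (doubleLattice.fst P) u := by
    obtain ⟨a', rfl⟩ := F.map_fst_surjective P a
    exact ⟨_, ExpandsIn.id.smul a', fun u ↦ map_mul _ _ _⟩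
  induction hD using Algebra.adjoin_induction with
  | mem D hD =>
    obtain ⟨i, rfl⟩ | ⟨a, rfl⟩ := hD
    · exact ⟨_, F.expandsIn_doubleDel b i, F.map_fst_doubleDel P i⟩
    · exact mulLeft a
  | algebraMap r =>
    obtain ⟨D', h1, h2⟩ := mulLeft (algebraMap R _ r)
    refine ⟨D', h1, fun u ↦ (h2 u).trans ?_⟩
    rw [Module.algebraMap_end_apply, Algebra.smul_def]
  | add D₁ D₂ _ _ ih₁ ih₂ =>
    obtain ⟨D₁', h₁, e₁⟩ := ih₁
    obtain ⟨D₂', h₂, e₂⟩ := ih₂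
    refine ⟨_, h₁.add h₂, fun u ↦ ?_⟩
    rw [Pi.add_apply, map_add, e₁, e₂, LinearMap.add_apply]
  | mul D₁ D₂ _ _ ih₁ ih₂ =>
    obtain ⟨D₁', h₁, e₁⟩ := ih₁
    obtain ⟨D₂', h₂, e₂⟩ := ih₂
    refine ⟨_, h₁.comp h₂, fun u ↦ ?_⟩
    rw [Function.comp_apply, e₁, e₂, Module.End.mul_apply]

variable {P} in
/-- The composition of operators along a word for the enlarged lattice. -/
def doubleDelWord (b : P.Base) (I : List b.support) : Module.End R (F.Ring P.doubleLattice) :=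
  (I.map fun i ↦ F.doubleDel P (i : ι)).prod

variable {P} in
lemma map_fst_doubleDelWord (b : P.Base) (I : List b.support) (u : F.Ring P.doubleLattice) :
    Ring.map F (doubleLattice.fst P) (F.doubleDelWord b I u) =
      F.DelWord b I (Ring.map F (doubleLattice.fst P) u) := by
  induction I with
  | nil => rfl
  | cons i I ih => rw [DelWord_cons, ← ih, ← map_fst_doubleDel]; simp [doubleDelWord]

variable {P} in
lemma expandsIn_doubleDelWord [Fintype P.weylGroup] (b : P.Base) (I : List b.support) :
    ExpandsIn (F.doubleAct P) (F.doubleDelWord b I) := by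
  induction I with
  | nil => exact ExpandsIn.id
  | cons i I ih =>
    have e : F.doubleDelWord b (i :: I) = F.doubleDel P (i : ι) * F.doubleDelWord b I := by
      simp [doubleDelWord]
    rw [e]
    exact (F.expandsIn_doubleDel b (i : ι)).comp ih

variable {P} in
/-- If the matrix of all `ε Δ_{I_v} Δ_{I_w} (u₀)` is invertible, then every `ε D` is a linear
combination of the `ε Δ_{I_v}`. -/
theorem exists_aug_eq_sum [Fintype P.weylGroup] [DecidableEq P.weylGroup] (b : P.Base)
    (I : P.weylGroup → List b.support) (u₀ : F.Ring M)
    (h : IsUnit (Matrix.of fun v w ↦ aug F M (F.DelWord b (I v) (F.DelWord b (I w) u₀))).det)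
    {D : Module.End R (F.Ring M)} (hD : D ∈ F.operatorAlgebra P) :
    ∃ a : P.weylGroup → R, ∀ u, aug F M (D u) = ∑ v, a v * aug F M (F.DelWord b (I v) u) := by
  obtain ⟨u₀, rfl⟩ := F.map_fst_surjective P u₀
  obtain ⟨D', hD', e⟩ := F.exists_expandsIn_lift b hD
  -- The projection commutes with the augmentation, so the determinant upstairs has the given unit
  -- as its augmentation, and an element with unit augmentation is a unit.
  have hu : IsUnit (Matrix.of fun v w ↦
      F.doubleDelWord b (I v) (F.doubleDelWord b (I w) u₀)).det := by
    refine isUnit_of_aug ?_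
    rw [AlgHom.map_det]
    convert h using 2
    ext v w
    rw [AlgHom.mapMatrix_apply, Matrix.map_apply, Matrix.of_apply, Matrix.of_apply,
      ← aug_comp_map (doubleLattice.fst P), map_fst_doubleDelWord, map_fst_doubleDelWord]
  obtain ⟨a, ha⟩ := hD'.exists_eq_sum (E := fun v ↦ F.doubleDelWord b (I v))
    (fun v ↦ F.expandsIn_doubleDelWord b (I v)) hu
  refine ⟨fun v ↦ aug F _ (a v), fun u ↦ ?_⟩
  obtain ⟨u, rfl⟩ := F.map_fst_surjective P u
  rw [← e, aug_comp_map, ha, map_sum]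
  refine Finset.sum_congr rfl fun v _ ↦ ?_
  rw [map_mul, ← map_fst_doubleDelWord, aug_comp_map]

end FormalGroup

/-! ### The characteristic map -/

namespace Matrix

variable {W R : Type*} [Fintype W] [DecidableEq W] [CommRing R]

/-- A matrix which is triangular for a degree function, with units on the diagonal and vanishing
off-diagonal entries in each degree, has invertible determinant. -/
lemma isUnit_det_of_degree (A : Matrix W W R) (d : W → ℕ) (hA : ∀ v, IsUnit (A v v))
    (h : ∀ v x, d v ≤ d x → v ≠ x → A v x = 0) : IsUnit A.det := by
  have hT : Aᵀ.BlockTriangular d := fun i j hij ↦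
    h j i hij.le fun e ↦ hij.ne (congrArg d e)
  rw [← det_transpose, hT.det]
  refine IsUnit.prod_iff.2 fun a _ ↦ ?_
  have e : Aᵀ.toSquareBlock d a = diagonal fun i ↦ A i.1 i.1 := by
    ext i j
    rw [diagonal_apply]
    split_ifs with hij
    · rw [hij]; rfl
    · exact h j i (j.2.trans i.2.symm).le fun e ↦ hij (Subtype.ext e.symm)
  rw [e, det_diagonal]
  exact IsUnit.prod_iff.2 fun i _ ↦ hA i

variable {V : Type*} [AddCommGroup V] [Module R V]

/-- Evaluating a relation among the h w at the e v puts its coefficients in the kernel of an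
invertible matrix. The e v need not span. -/
lemma linearIndependent_of_isUnit_det {e : W → V} {h : W → Module.Dual R V}
    (hu : IsUnit (of fun v w ↦ h w (e v)).det) : LinearIndependent R h := by
  rw [Fintype.linearIndependent_iff]
  intro g hg
  have : (of fun v w ↦ h w (e v)) *ᵥ g = 0 := by
    ext v
    have := LinearMap.congr_fun hg (e v)
    simpa [mulVec, dotProduct, mul_comm] using this
  exact congrFun (mulVec_injective_of_isUnit ((isUnit_iff_isUnit_det _).2 hu)
    (this.trans (mulVec_zero _).symm))

/-- Solving the linear system for the values of φ on the e v yields a combination of the h w that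
agrees with φ on a spanning family. -/
lemma span_eq_top_of_isUnit_det {e : W → V} (he : Submodule.span R (Set.range e) = ⊤)
    {h : W → Module.Dual R V} (hu : IsUnit (of fun v w ↦ h w (e v)).det) :
    Submodule.span R (Set.range h) = ⊤ := by
  rw [eq_top_iff]
  intro φ _
  set B : Matrix W W R := of fun v w ↦ h w (e v) with hB
  have key : φ = ∑ w, (B⁻¹ *ᵥ fun v ↦ φ (e v)) w • h w := by
    refine LinearMap.ext_on_range he fun v ↦ ?_
    have := congrFun (mulVec_mulVec (fun v ↦ φ (e v)) B B⁻¹) v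
    rw [mul_nonsing_inv _ hu, one_mulVec] at this
    rw [← this, LinearMap.sum_apply, mulVec, dotProduct]
    exact Finset.sum_congr rfl fun w _ ↦ mul_comm _ _
  rw [key]
  exact Submodule.sum_mem _ fun w _ ↦ Submodule.smul_mem _ _ (Submodule.subset_span ⟨w, rfl⟩)

end Matrix

/-! ### Invertibility of the pairing matrix, and bases of the dual of εD. -/

namespace FormalGroup

open FormalGroup.Ring RootPairing

variable {R : Type*} [CommRing R] (F : FormalGroup R) [F.IsComm]
  {ι M N : Type*} [Finite ι] [AddCommGroup M] [AddCommGroup N] (P : RootPairing ι ℤ M N)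
  [P.IsReduced] (b : P.Base)

variable {F P b}

/-- If the `u w` have the leading forms `± Δ_w a` with `Δ_{w₀} a` invertible, then the matrix of
the `ε Δ_v (u w)` is invertible. -/
theorem isUnit_det_aug_delWord [Fintype P.weylGroup] [DecidableEq P.weylGroup]
    {w₀ : P.weylGroup} (h₀ : b.IsLongest w₀) {I₀ : List b.support}
    (hI₀ : b.IsReducedDecomposition I₀ w₀) {a : LatticeSym R M} {t : R} (ht : IsUnit t)
    (ha : b.symWord R I₀ a = algebraMap R _ t) {I : P.weylGroup → List b.support}
    (hI : ∀ w, b.IsReducedDecomposition (I w) w) {ε : P.weylGroup → R} (hε : ∀ w, IsUnit (ε w))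
    {u : P.weylGroup → F.Ring M} (hu : ∀ w n, n + (I w).length = b.length w₀ →
      F.IsLift n (ε w • b.symWord R (I w) a) (u w)) :
    IsUnit (Matrix.of fun v w ↦ aug F M (F.DelWord b (I v) (u w))).det := by
  have lt {v w : P.weylGroup} (h : b.length v + b.length w < b.length w₀) :
      aug F M (F.DelWord b (I v) (u w)) = 0 := by
    -- Here k + 1 = N - l(v) - l(w) is the degree of the leading form that remains, so the element
    -- lies in the augmentation ideal.
    obtain ⟨k, hk⟩ := Nat.exists_eq_add_of_lt h
    refine IsLift.aug_eq_zero (n := k) (IsLift.delWord b (I v) (hu w _ ?_))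
    rw [(hI v).2, (hI w).2]
    omega
  have lift {v w : P.weylGroup} (h : b.length v + b.length w = b.length w₀) :
      F.IsLift 0 (ε w • b.symWord R (I v ++ I w) a) (F.DelWord b (I v) (u w)) := by
    rw [RootPairing.Base.symWord_append, ← map_smul]
    refine IsLift.delWord b (I v) (hu w _ ?_)
    rw [(hI v).2, (hI w).2]
    omega
  have wordProd (v w : P.weylGroup) : b.wordProd (I v ++ I w) = v * w := by
    rw [RootPairing.Base.wordProd_append, (hI v).1, (hI w).1]
  have ne {v w : P.weylGroup} (h : b.length v + b.length w = b.length w₀) (hvw : v * w ≠ w₀) :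
      aug F M (F.DelWord b (I v) (u w)) = 0 := by
    refine IsLift.aug_eq (r := 0) ?_
    -- A reduced word of length N would represent an element of maximal length, which can only be
    -- w₀.
    have hr : ¬ b.IsReducedWord (I v ++ I w) := fun hr ↦ hvw <| h₀.eq_of_length_eq <| by
      rw [RootPairing.Base.IsReducedWord, wordProd, List.length_append, (hI v).2, (hI w).2] at hr
      omega
    have := lift h
    rwa [b.symWord_eq_zero hr, LinearMap.zero_apply, smul_zero,
      ← map_zero (algebraMap R (LatticeSym R M))] at this
  have eq {v w : P.weylGroup} (h : b.length v + b.length w = b.length w₀) (hvw : v * w = w₀) :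
      aug F M (F.DelWord b (I v) (u w)) = ε w * t := by
    refine IsLift.aug_eq ?_
    have hr : b.IsReducedWord (I v ++ I w) := by
      rw [RootPairing.Base.IsReducedWord, wordProd, List.length_append, (hI v).2, (hI w).2, hvw, h]
    have := lift h
    rwa [b.symWord_eq_of_wordProd_eq hr hI₀.isReducedWord (by rw [wordProd, hvw, hI₀.1]), ha,
      Algebra.smul_def, ← map_mul] at this
  have inv₀ : w₀⁻¹ = w₀ := h₀.eq_of_length_eq (b.length_inv w₀)
  have len (x : P.weylGroup) : b.length x + b.length (x⁻¹ * w₀) = b.length w₀ := by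
    have h1 := h₀.length_mul_inv x⁻¹
    have h2 : (w₀ * x⁻¹⁻¹)⁻¹ = x⁻¹ * w₀ := by rw [mul_inv_rev, inv_inv, inv₀]
    rw [← h2, b.length_inv]
    rw [b.length_inv] at h1
    omega
  -- The column x is assigned to w = x⁻¹w₀, of length N - l(x). Then l(v) + l(w) ≤ N means l(v) ≤
  -- l(x), and vw = w₀ means v = x, which is the required triangular shape. Permuting columns
  -- changes the determinant by a sign only.
  let σ : Equiv.Perm P.weylGroup := (Equiv.inv _).trans (Equiv.mulRight w₀)
  have hB := Matrix.isUnit_det_of_degree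
    ((Matrix.of fun v w ↦ aug F M (F.DelWord b (I v) (u w))).submatrix id σ) b.length
    (fun v ↦ by
      change IsUnit (aug F M (F.DelWord b (I v) (u (v⁻¹ * w₀))))
      rw [eq (len v) (mul_inv_cancel_left _ _)]
      exact (hε _).mul ht)
    (fun v x hvx hne ↦ by
      change aug F M (F.DelWord b (I v) (u (x⁻¹ * w₀))) = 0
      have := len x
      rcases hvx.lt_or_eq with h | h
      · exact lt (by omega)
      · refine ne (by omega) fun e ↦ hne ?_
        rwa [← mul_assoc, mul_eq_right, mul_inv_eq_one] at e)
  rw [Matrix.det_permute'] at hB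
  exact (IsUnit.mul_iff.1 hB).2

variable (F P b)

/-- The form `ε ∘ Δ_I`. -/
def augDelWord (I : List b.support) : F.augOperators P :=
  ⟨(aug F M).toLinearMap ∘ₗ F.DelWord b I, F.DelWord b I,
    (F.operatorAlgebra P).list_prod_mem fun D hD ↦ by
      obtain ⟨i, _, rfl⟩ := List.mem_map.1 hD
      exact Algebra.subset_adjoin (Or.inl ⟨i, rfl⟩), rfl⟩

variable [Module.Free ℤ M] [Module.Finite ℤ M]

variable {F P b} in
-- Repackages the expansion of every ε D as a statement about the module εD, the spanning half of
-- the duality argument.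
lemma span_augDelWord [Fintype P.weylGroup] [DecidableEq P.weylGroup]
    {I : P.weylGroup → List b.support} {u₀ : F.Ring M}
    (h : IsUnit (Matrix.of fun v w ↦ aug F M (F.DelWord b (I v) (F.DelWord b (I w) u₀))).det) :
    Submodule.span R (Set.range fun w ↦ F.augDelWord P b (I w)) = ⊤ := by
  rw [eq_top_iff]
  rintro ⟨_, D, hD, rfl⟩ _
  obtain ⟨a, ha⟩ := F.exists_aug_eq_sum b I u₀ h hD
  have : (⟨_, D, hD, rfl⟩ : F.augOperators P) = ∑ v, a v • F.augDelWord P b (I v) := by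
    refine Subtype.ext (LinearMap.ext fun u ↦ ?_)
    rw [AddSubmonoidClass.coe_finsetSum, LinearMap.sum_apply]
    exact ha u
  rw [this]
  exact Submodule.sum_mem _ fun w _ ↦ Submodule.smul_mem _ _ (Submodule.subset_span ⟨w, rfl⟩)

lemma exists_isTop : ∃ u₀ : F.Ring M, F.IsTop b u₀ := by
  obtain ⟨w₀, h₀⟩ := b.exists_isLongest
  obtain ⟨I₀, hI₀⟩ := b.exists_isReducedDecomposition w₀
  obtain ⟨a, ha, e⟩ := b.exists_symWord_eq_torsionIndex R h₀ hI₀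
  obtain ⟨p, hp, rfl⟩ := LatticeSym.exists_isHomogeneous_of_mem_graded R ha
  exact ⟨_, w₀, I₀, h₀, hI₀, _, ha, e, IsLift.of_aeval hp⟩

variable {F P b}

/-- The two families attached to `u₀` are linearly independent and span the dual of `εD`. -/
theorem IsTop.linearIndependent_and_span (hτ : IsUnit (b.torsionIndex : R)) {u₀ : F.Ring M}
    (h : F.IsTop b u₀) {I : P.weylGroup → List b.support}
    (hI : ∀ w, b.IsReducedDecomposition (I w) w) :
    (LinearIndependent R (fun w ↦ F.charMap P (F.DelWord b (I w) u₀)) ∧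
      Submodule.span R (Set.range fun w ↦ F.charMap P (F.DelWord b (I w) u₀)) = ⊤) ∧
    (LinearIndependent R (fun w ↦ F.charMap P (F.CWord b (I w) u₀)) ∧
      Submodule.span R (Set.range fun w ↦ F.charMap P (F.CWord b (I w) u₀)) = ⊤) := by
  classical
  have := b.finite_weylGroup
  have := Fintype.ofFinite P.weylGroup
  obtain ⟨w₀, I₀, h₀, hI₀, a, -, ha, hu⟩ := h
  have h1 := isUnit_det_aug_delWord (F := F) h₀ hI₀ hτ ha hI (ε := 1) (fun _ ↦ isUnit_one)
    (u := fun w ↦ F.DelWord b (I w) u₀) fun w n hn ↦ by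
      rw [Pi.one_apply, one_smul]
      exact IsLift.delWord b (I w) (hn ▸ hu)
  have h2 := isUnit_det_aug_delWord (F := F) h₀ hI₀ hτ ha hI (ε := fun w ↦ (-1) ^ (I w).length)
    (fun _ ↦ isUnit_one.neg.pow _)
    (u := fun w ↦ F.CWord b (I w) u₀) fun w n hn ↦ IsLift.cWord b (I w) (hn ▸ hu)
  -- The spanning family ε Δ_{I_v} serves both cases: the C-family is paired with the same forms,
  -- through the matrix of `h2`.
  have hs := span_augDelWord h1
  refine ⟨⟨?_, ?_⟩, ?_, ?_⟩
  · exact Matrix.linearIndependent_of_isUnit_det (e := fun v ↦ F.augDelWord P b (I v)) h1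
  · exact Matrix.span_eq_top_of_isUnit_det (e := fun v ↦ F.augDelWord P b (I v)) hs h1
  · exact Matrix.linearIndependent_of_isUnit_det (e := fun v ↦ F.augDelWord P b (I v)) h2
  · exact Matrix.span_eq_top_of_isUnit_det (e := fun v ↦ F.augDelWord P b (I v)) hs h2

end FormalGroup

end

theorem mainTheorem1 {R : Type*} [CommRing R] (F : FormalGroup R) [F.IsComm]
    {ι M N : Type*} [Finite ι] [AddCommGroup M] [Module.Free ℤ M] [Module.Finite ℤ M]
    [AddCommGroup N] (P : RootPairing ι ℤ M N) [P.IsReduced] (b : P.Base)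
    (hτ : IsUnit (b.torsionIndex : R)) :
    (∃ u₀ : F.Ring M, F.IsTop b u₀) ∧
    (∀ u₀ : F.Ring M, F.IsTop b u₀ → ∀ I : P.weylGroup → List b.support,
      (∀ w, b.IsReducedDecomposition (I w) w) →
        (LinearIndependent R (fun w ↦ F.charMap P (F.DelWord b (I w) u₀)) ∧
          Submodule.span R (Set.range fun w ↦ F.charMap P (F.DelWord b (I w) u₀)) =
            LinearMap.range (F.charMap P)) ∧
        (LinearIndependent R (fun w ↦ F.charMap P (F.CWord b (I w) u₀)) ∧
          Submodule.span R (Set.range fun w ↦ F.charMap P (F.CWord b (I w) u₀)) =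
            LinearMap.range (F.charMap P))) ∧
    Function.Surjective (F.charMap P) := by
  obtain ⟨u₁, hu₁⟩ := F.exists_isTop P b
  -- One admissible u₁ with one choice of reduced words suffices: its family spans the whole dual
  -- and consists of values of c.
  have top : LinearMap.range (F.charMap P) = ⊤ := by
    choose I hI using b.exists_isReducedDecomposition
    rw [eq_top_iff, ← (hu₁.linearIndependent_and_span hτ hI).1.2, Submodule.span_le]
    rintro _ ⟨w, rfl⟩
    exact ⟨_, rfl⟩
  refine ⟨⟨u₁, hu₁⟩, fun u₀ hu₀ I hI ↦ ?_, LinearMap.range_eq_top.1 top⟩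
  rw [top]
  exact hu₀.linearIndependent_and_span hτ hI
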